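/- Let $d\geq 1$, $0<\sigma<\min\{2,d\}$, and $\frac4d<\alpha<\frac{4}{d-2}$ if $d\geq 3$ ($\frac4d<\alpha<\infty$ if $d=1,2$). Write $H^1=H^1(\mathbb R^d;\mathbb C)$ and, for $v\in H^1$, $$G(v)=\int_{\mathbb R^d}|x|^{-\sigma}|v(x)|^2\,dx,\qquad \mu_1=\inf\left\{\|\nabla v\|_{L^2}^2-G(v)\ :\ v\in H^1,\ \|v\|_{L^2}=1\right\}.$$ Let $\omega>-\mu_1$ and put $$S_\omega(v)=\tfrac12\|\nabla v\|_{L^2}^2-\tfrac12G(v)+\tfrac{\omega}{2}\|v\|_{L^2}^2-\tfrac1{\alpha+2}\|v\|_{L^{\alpha+2}}^{\alpha+2},$$ $$K_\omega(v)=\|\nabla v\|_{L^2}^2-G(v)+\omega\|v\|_{L^2}^2-\|v\|_{L^{\alpha+2}}^{\alpha+2},$$ $$Q(v)=\|\nabla v\|_{L^2}^2-\tfrac{\sigma}{2}G(v)-\tfrac{\beta}{\alpha+2}\|v\|_{L^{\alpha+2}}^{\alpha+2},\qquad \beta=\tfrac{d\alpha}{2}.$$ Let $\mathcal A_\omega=\{v\in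 H^1\setminus\{0\} : S_\omega'(v)=0\}$ be the set of nontrivial $H^1$ solutions of $-\Delta v+\omega v-|x|^{-\sigma}v-|v|^\alpha v=0$, and let $\mathcal G_\omega=\{\phi\in\mathcal A_\omega : S_\omega(\phi)\leq S_\omega(v)\ \text{for all } v\in\mathcal A_\omega\}$ be the set of ground states. For $\lambda>0$ let $\phi^\lambda(x)=\lambda^{d/2}\phi(\lambda x)$. Let $\phi\in\mathcal G_\omega$ be such that $\partial_\lambda^2S_\omega(\phi^\lambda)\big|_{\lambda=1}\leq 0$, and let $v\in H^1\setminus\{0\}$ satisfy $$\|v\|_{L^2}\leq\|\phi\|_{L^2},\qquad K_\omega(v)\leq 0,\qquad Q(v)\leq 0.$$ Then $$Q(v)\leq 2\left(S_\omega(v)-S_\omega(\phi)\right).$$ -/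

import Mathlib

namespace InversePowerNLS

open MeasureTheory

noncomputable section

/-- `ℝ^d` with its Euclidean norm and Lebesgue measure. -/
abbrev Space (d : ℕ) : Type := EuclideanSpace ℝ (Fin d)

/-- `g` is the weak gradient of `u`: `∫ ∂ᵢψ u = - ∫ ψ gᵢ` for all `ψ ∈ C_c^∞(ℝ^d)` and all `i`. -/
def IsWeakGradient {d : ℕ} (u : Space d → ℂ) (g : Space d → EuclideanSpace ℂ (Fin d)) : Prop :=
  ∀ ψ : Space d → ℝ, ContDiff ℝ (⊤ : ℕ∞) ψ → HasCompactSupport ψ → ∀ i : Fin d,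
    ∫ x, (fderiv ℝ ψ x (EuclideanSpace.single i 1)) • u x = - ∫ x, ψ x • (g x) i

theorem integrable_fderiv_smul {d : ℕ} {u : Space d → ℂ} (hu : MemLp u 2 volume)
    {ψ : Space d → ℝ} (hψ : ContDiff ℝ (⊤ : ℕ∞) ψ) (hc : HasCompactSupport ψ) (i : Fin d) :
    Integrable (fun x => (fderiv ℝ ψ x (EuclideanSpace.single i 1)) • u x) volume := by
  have hl : LocallyIntegrable u volume := hu.locallyIntegrable (by norm_num)
  refine hl.integrable_smul_left_of_hasCompactSupport ?_ ?_
  · exact (hψ.continuous_fderiv (by simp)).clm_apply continuous_const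
  · exact (hc.fderiv (𝕜 := ℝ)).comp_left
      (g := fun L : Space d →L[ℝ] ℝ => L (EuclideanSpace.single i 1)) rfl

theorem integrable_smul_coord {d : ℕ} {g : Space d → EuclideanSpace ℂ (Fin d)}
    (hg : MemLp g 2 volume) {ψ : Space d → ℝ} (hψ : ContDiff ℝ (⊤ : ℕ∞) ψ) (hc : HasCompactSupport ψ)
    (i : Fin d) : Integrable (fun x => ψ x • (g x) i) volume := by
  have hgi : MemLp (fun x => (g x) i) 2 volume :=
    (EuclideanSpace.proj (𝕜 := ℂ) i : EuclideanSpace ℂ (Fin d) →L[ℂ] ℂ).comp_memLp' hg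
  exact (hgi.locallyIntegrable (by norm_num)).integrable_smul_left_of_hasCompactSupport
    hψ.continuous hc

theorem IsWeakGradient.congr {d : ℕ} {u u' : Space d → ℂ}
    {g g' : Space d → EuclideanSpace ℂ (Fin d)} (h : IsWeakGradient u g)
    (hu : u' =ᵐ[volume] u) (hg : g' =ᵐ[volume] g) : IsWeakGradient u' g' := by
  intro ψ hψ hc i
  have h1 : ∫ x, (fderiv ℝ ψ x (EuclideanSpace.single i 1)) • u' x
      = ∫ x, (fderiv ℝ ψ x (EuclideanSpace.single i 1)) • u x :=
    integral_congr_ae (by filter_upwards [hu] with x hx; rw [hx])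
  have h2 : ∫ x, ψ x • (g' x) i = ∫ x, ψ x • (g x) i :=
    integral_congr_ae (by filter_upwards [hg] with x hx; rw [hx])
  rw [h1, h2]
  exact h ψ hψ hc i

/-- The complex Hilbert space `H¹(ℝ^d) = H¹(ℝ^d; ℂ)`, as the space of pairs `(u, ∇u)` of an
`L²` function and its (unique) weak gradient, also in `L²`. The norm inherited from the
`ℓ²`-product is `(‖u‖² + ‖∇u‖²)^{1/2}`. -/
def H1 (d : ℕ) : Submodule ℂ (WithLp 2 (Lp ℂ 2 (volume : Measure (Space d)) ×
    Lp (EuclideanSpace ℂ (Fin d)) 2 (volume : Measure (Space d)))) where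
  carrier := {p | IsWeakGradient (p.fst : Space d → ℂ)
    (p.snd : Space d → EuclideanSpace ℂ (Fin d))}
  zero_mem' := by
    have h : IsWeakGradient (fun _ : Space d => (0 : ℂ)) (fun _ => 0) := by
      intro ψ _ _ i
      simp
    exact h.congr (Lp.coeFn_zero ℂ 2 volume) (Lp.coeFn_zero _ 2 volume)
  add_mem' := by
    intro p q hp hq
    have h : IsWeakGradient (fun x => p.fst x + q.fst x) (fun x => p.snd x + q.snd x) := by
      intro ψ hψ hc i
      have e1 := integral_add (integrable_fderiv_smul (Lp.memLp p.fst) hψ hc i)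
        (integrable_fderiv_smul (Lp.memLp q.fst) hψ hc i)
      have e2 := integral_add (integrable_smul_coord (Lp.memLp p.snd) hψ hc i)
        (integrable_smul_coord (Lp.memLp q.snd) hψ hc i)
      simp only [smul_add, PiLp.add_apply]
      rw [e1, e2, hp ψ hψ hc i, hq ψ hψ hc i, neg_add]
    exact h.congr (Lp.coeFn_add p.fst q.fst) (Lp.coeFn_add p.snd q.snd)
  smul_mem' := by
    intro c p hp
    have h : IsWeakGradient (fun x => c • p.fst x) (fun x => c • p.snd x) := by
      intro ψ hψ hc i
      have e1 : ∀ x, (fderiv ℝ ψ x (EuclideanSpace.single i 1)) • c • p.fst x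
          = c • ((fderiv ℝ ψ x (EuclideanSpace.single i 1)) • p.fst x) :=
        fun x => smul_comm _ _ _
      have e2 : ∀ x, ψ x • (c • p.snd x) i = c • (ψ x • (p.snd x) i) := by
        intro x
        rw [PiLp.smul_apply]
        exact smul_comm _ _ _
      simp only [e1, e2]
      rw [integral_smul, integral_smul, hp ψ hψ hc i, smul_neg]
    exact h.congr (Lp.coeFn_smul c p.fst) (Lp.coeFn_smul c p.snd)

/-- The `L²` function underlying an element of `H¹`. -/
def fn {d : ℕ} (v : H1 d) : Lp ℂ 2 (volume : Measure (Space d)) :=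
  (v : WithLp 2 (Lp ℂ 2 (volume : Measure (Space d)) ×
    Lp (EuclideanSpace ℂ (Fin d)) 2 (volume : Measure (Space d)))).fst

/-- The weak gradient of an element of `H¹`. -/
def grad {d : ℕ} (v : H1 d) : Lp (EuclideanSpace ℂ (Fin d)) 2 (volume : Measure (Space d)) :=
  (v : WithLp 2 (Lp ℂ 2 (volume : Measure (Space d)) ×
    Lp (EuclideanSpace ℂ (Fin d)) 2 (volume : Measure (Space d)))).snd

theorem isWeakGradient_grad {d : ℕ} (v : H1 d) : IsWeakGradient (fn v) (grad v) := v.2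

theorem memLp_comp_dilation {d : ℕ} {F : Type*} [NormedAddCommGroup F] {f : Space d → F}
    (hf : MemLp f 2 volume) {lam : ℝ} (hlam : 0 < lam) :
    MemLp (fun x => f (lam • x)) 2 volume := by
  have hm : Measure.map (fun x : Space d => lam • x) volume
      = ENNReal.ofReal |(lam ^ Module.finrank ℝ (Space d))⁻¹| • volume :=
    Measure.map_addHaar_smul volume hlam.ne'
  have h : MemLp f 2 (Measure.map (fun x : Space d => lam • x) volume) := by
    rw [hm]
    exact hf.smul_measure ENNReal.ofReal_ne_top
  exact h.comp_of_map (measurable_const_smul lam).aemeasurable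

theorem isWeakGradient_dilation {d : ℕ} {u : Space d → ℂ} {g : Space d → EuclideanSpace ℂ (Fin d)}
    (h : IsWeakGradient u g) {lam : ℝ} (hlam : 0 < lam) :
    IsWeakGradient (fun x => lam ^ ((d : ℝ) / 2) • u (lam • x))
      (fun x => lam ^ ((d : ℝ) / 2 + 1) • g (lam • x)) := by
  intro ψ hψ hc i
  have hne : lam ≠ 0 := hlam.ne'
  have hψ' : ContDiff ℝ (⊤ : ℕ∞) (fun x : Space d => ψ (lam⁻¹ • x)) :=
    hψ.comp (contDiff_const_smul _)
  have hc' : HasCompactSupport (fun x : Space d => ψ (lam⁻¹ • x)) :=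
    hc.comp_homeomorph (Homeomorph.smulOfNeZero lam⁻¹ (inv_ne_zero hne))
  have key := h _ hψ' hc' i
  have hd : ∀ y : Space d, fderiv ℝ (fun x : Space d => ψ (lam⁻¹ • x)) y
      (EuclideanSpace.single i 1)
      = lam⁻¹ * fderiv ℝ ψ (lam⁻¹ • y) (EuclideanSpace.single i 1) := by
    intro y
    rw [fderiv_comp_smul]
    simp
  have e1 := Measure.integral_comp_smul (volume : Measure (Space d)) (fun y =>
    (fderiv ℝ (fun x : Space d => ψ (lam⁻¹ • x)) y (EuclideanSpace.single i 1)) • u y) lam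
  have e2 := Measure.integral_comp_smul (volume : Measure (Space d))
    (fun y => ψ (lam⁻¹ • y) • (g y) i) lam
  simp only [hd, smul_smul, inv_mul_cancel₀ hne, one_smul] at e1 e2 key
  rw [key, smul_neg, ← e2] at e1
  have hp : lam ^ ((d : ℝ) / 2) = lam ^ ((d : ℝ) / 2 + 1) * lam⁻¹ := by
    rw [Real.rpow_add hlam, Real.rpow_one, mul_assoc, mul_inv_cancel₀ hne, mul_one]
  have l1 : ∀ x, (fderiv ℝ ψ x (EuclideanSpace.single i 1)) • lam ^ ((d : ℝ) / 2) • u (lam • x)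
      = lam ^ ((d : ℝ) / 2 + 1) •
        ((lam⁻¹ * fderiv ℝ ψ x (EuclideanSpace.single i 1)) • u (lam • x)) := by
    intro x
    rw [smul_smul, smul_smul, hp]
    congr 1
    ring
  have l2 : ∀ x, ψ x • (lam ^ ((d : ℝ) / 2 + 1) • g (lam • x)) i
      = lam ^ ((d : ℝ) / 2 + 1) • (ψ x • (g (lam • x)) i) := by
    intro x
    rw [PiLp.smul_apply]
    exact smul_comm _ _ _
  simp only [l1, l2]
  rw [integral_smul, integral_smul, e1, smul_neg]

theorem memLp_scale_fn {d : ℕ} (v : H1 d) {lam : ℝ} (hlam : 0 < lam) :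
    MemLp (fun x : Space d => lam ^ ((d : ℝ) / 2) • fn v (lam • x)) 2 volume :=
  (memLp_comp_dilation (Lp.memLp (fn v)) hlam).const_smul (lam ^ ((d : ℝ) / 2))

theorem memLp_scale_grad {d : ℕ} (v : H1 d) {lam : ℝ} (hlam : 0 < lam) :
    MemLp (fun x : Space d => lam ^ ((d : ℝ) / 2 + 1) • grad v (lam • x)) 2 volume :=
  (memLp_comp_dilation (Lp.memLp (grad v)) hlam).const_smul (lam ^ ((d : ℝ) / 2 + 1))

/-- The `L²`-invariant scaling `v^λ(x) = λ^{d/2} v(λx)` for `λ > 0`, whose weak gradient is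
`λ^{d/2+1} (∇v)(λx)`. Only `λ > 0` is meaningful; the value for `λ ≤ 0` is set to `0`. -/
def scale {d : ℕ} (lam : ℝ) (v : H1 d) : H1 d :=
  if hlam : 0 < lam then
    ⟨WithLp.toLp 2 ((memLp_scale_fn v hlam).toLp, (memLp_scale_grad v hlam).toLp),
      (isWeakGradient_dilation (isWeakGradient_grad v) hlam).congr
        (memLp_scale_fn v hlam).coeFn_toLp (memLp_scale_grad v hlam).coeFn_toLp⟩
  else 0

/-- `G(v) = ∫ |x|^{-σ} |v(x)|² dx`. -/
def G {d : ℕ} (σ : ℝ) (v : H1 d) : ℝ := ∫ x : Space d, ‖x‖ ^ (-σ) * ‖fn v x‖ ^ 2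

/-- `‖v‖_{L^{α+2}}^{α+2} = ∫ |v(x)|^{α+2} dx`. -/
def N {d : ℕ} (α : ℝ) (v : H1 d) : ℝ := ∫ x : Space d, ‖fn v x‖ ^ (α + 2)

/-- `μ₁ = inf { ‖∇v‖² - G(v) : v ∈ H¹, ‖v‖_{L²} = 1 }`. -/
def mu1 (d : ℕ) (σ : ℝ) : ℝ :=
  sInf {r : ℝ | ∃ v : H1 d, ‖fn v‖ = 1 ∧ r = ‖grad v‖ ^ 2 - G σ v}

/-- The action `S_ω`. -/
def S {d : ℕ} (σ α ω : ℝ) (v : H1 d) : ℝ :=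
  1 / 2 * ‖grad v‖ ^ 2 - 1 / 2 * G σ v + ω / 2 * ‖fn v‖ ^ 2 - 1 / (α + 2) * N α v

/-- The Nehari functional `K_ω`. -/
def K {d : ℕ} (σ α ω : ℝ) (v : H1 d) : ℝ :=
  ‖grad v‖ ^ 2 - G σ v + ω * ‖fn v‖ ^ 2 - N α v

/-- The virial functional `Q`, with `β = dα/2`. -/
def Q {d : ℕ} (σ α : ℝ) (v : H1 d) : ℝ :=
  ‖grad v‖ ^ 2 - σ / 2 * G σ v - (d * α / 2) / (α + 2) * N α v

/-- `𝒜_ω`: the nonzero `v ∈ H¹` with `S_ω'(v) = 0` (Fréchet derivative on the real Banach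
space underlying `H¹`), i.e. the nontrivial solutions of
`-Δv + ωv - |x|^{-σ}v - |v|^α v = 0`. -/
def criticalPoints (d : ℕ) (σ α ω : ℝ) : Set (H1 d) :=
  {v | v ≠ 0 ∧ HasFDerivAt (S σ α ω) (0 : H1 d →L[ℝ] ℝ) v}

/-- `𝒢_ω`: the ground states, i.e. the minimizers of `S_ω` over `𝒜_ω`. -/
def groundStates (d : ℕ) (σ α ω : ℝ) : Set (H1 d) :=
  {φ | φ ∈ criticalPoints d σ α ω ∧ ∀ v ∈ criticalPoints d σ α ω, S σ α ω φ ≤ S σ α ω v}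

end

end InversePowerNLS

namespace InversePowerNLS

open MeasureTheory Filter Topology
open scoped ENNReal NNReal

noncomputable section

/-! ### Translations and averages of `H¹` functions -/

/-! Write q for `quadForm` and e = (α+2)/2. Since ω > -μ₁, q is coercive on H¹, so N(v) ≤ M q(v)^e
has a finite best constant M. A maximizing sequence on {q = 1} converges weakly, up to a
subsequence. A zero weak limit is impossible: G would tend to 0 along the sequence, and a translated
profile w would do at least as well for the free form as the optimal ratio M, whereas G(w) > 0 makes
q(w) strictly smaller. A nonzero weak limit carries all of q, by Brezis–Lieb and the strict
inequality x^e < x on (0,1). So M is attained (`Admissible.exists_maximizer`).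

A suitable multiple of a maximizer is a critical point of S_ω. Comparing actions shows that every
ground state φ is an optimizer with M q(φ)^{α/2} = 1 (`Admissible.exists_of_mem_groundStates`). Two
facts follow: q(φ) ≤ q(v) whenever v ≠ 0 and K_ω(v) ≤ 0, and Q(φ) = 0, because λ ↦ M q(φ^λ)^e -
N(φ^λ) is minimal at λ = 1.

For the estimate put σ = 2a, β = 2b, with 0 < a < 1 < b, and n = N(v)/(α+2). Choose s = λ² ≤ 1 such
that N(v^λ) = N(φ). Then q(v^λ) ≥ N(φ), that is S_ω(v^λ) ≥ S_ω(φ), and it suffices to show Q(v) ≤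
2(S_ω(v) - S_ω(v^λ)). Eliminating ‖∇v‖² through Q(v) turns this into s Q(v) + G(v)(1 - a + as - s^a)
≤ 2n(b - 1 - bs + s^b). The first term is nonpositive. An upper bound for G(v) in terms of n comes
from Q(v) ≤ 0, q(v^λ) ≥ N(φ), the mass condition, and the curvature condition, which reads
a(1-a)G(φ) ≤ 2b(b-1) s^b n. What remains is an inequality in s alone (`mul_rpow_mul_le`).

The functional analysis rests on one device: averages over balls satisfy ‖u - A_r u‖_{L²} ≤
r‖∇u‖_{L²}. This gives the subcritical Sobolev embedding, Rellich compactness and the nonvanishing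
of sequences with large N. -/

theorem enorm_integral_rpow_le {X E : Type*} [MeasurableSpace X] [NormedAddCommGroup E]
    [NormedSpace ℝ E] {ν : Measure X} [IsProbabilityMeasure ν] {f : X → E}
    (hf : AEStronglyMeasurable f ν) {q : ℝ} (hq : 1 ≤ q) :
    ‖∫ x, f x ∂ν‖ₑ ^ q ≤ ∫⁻ x, ‖f x‖ₑ ^ q ∂ν := by
  have hq0 : 0 < q := by linarith
  have h1 : ‖∫ x, f x ∂ν‖ₑ ≤ eLpNorm f 1 ν := by
    rw [eLpNorm_one_eq_lintegral_enorm]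
    exact enorm_integral_le_lintegral_enorm f
  have h2 : eLpNorm f 1 ν ≤ eLpNorm f (ENNReal.ofReal q) ν :=
    eLpNorm_le_eLpNorm_of_exponent_le (by simpa using hq) hf
  have h3 := eLpNorm_eq_lintegral_rpow_enorm_toReal (μ := ν) (f := f) (p := ENNReal.ofReal q)
    (by simpa using hq0) ENNReal.ofReal_ne_top
  rw [ENNReal.toReal_ofReal hq0.le] at h3
  calc ‖∫ x, f x ∂ν‖ₑ ^ q ≤ (eLpNorm f (ENNReal.ofReal q) ν) ^ q :=
        ENNReal.rpow_le_rpow (h1.trans h2) hq0.le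
    _ = ∫⁻ x, ‖f x‖ₑ ^ q ∂ν := by
        rw [h3, ← ENNReal.rpow_mul, one_div, inv_mul_cancel₀ hq0.ne', ENNReal.rpow_one]

theorem lintegral_enorm_rpow_two {X E : Type*} [MeasurableSpace X] [NormedAddCommGroup E]
    {ν : Measure X} (f : Lp E 2 ν) :
    ∫⁻ x, ‖f x‖ₑ ^ (2 : ℝ) ∂ν = ENNReal.ofReal (‖f‖ ^ 2) := by
  have h3 := eLpNorm_eq_lintegral_rpow_enorm_toReal (μ := ν) (f := f) (p := 2)
    (by simp) (by simp)
  rw [ENNReal.ofReal_pow (norm_nonneg _), ofReal_norm, Lp.enorm_def, h3, ← ENNReal.rpow_natCast,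
    ← ENNReal.rpow_mul]
  simp

/-- This justifies Fubini for products of an L² function with a translate of another. The shear
(x,t) ↦ (x + th, t) preserves the product measure, so both squares are integrable, and 2AB ≤ A² + B²
dominates the product. -/
theorem integrable_mul_translate {d : ℕ} {E F : Type*} [NormedAddCommGroup E]
    [NormedAddCommGroup F] {f₁ : Space d → E} {f₂ : Space d → F}
    (h₁ : MemLp f₁ 2 volume) (h₂ : MemLp f₂ 2 volume)
    (ν : Measure ℝ) [IsProbabilityMeasure ν] (h : Space d) {W : Space d × ℝ → ℂ}
    (hW : AEStronglyMeasurable W ((volume : Measure (Space d)).prod ν))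
    (hle : ∀ z, ‖W z‖ ≤ ‖f₁ z.1‖ * ‖f₂ (z.1 + z.2 • h)‖) :
    Integrable W ((volume : Measure (Space d)).prod ν) := by
  have i1 : Integrable (fun x => ‖f₁ x‖ ^ 2) volume := h₁.integrable_norm_pow (by norm_num)
  have i2 : Integrable (fun x => ‖f₂ x‖ ^ 2) volume := h₂.integrable_norm_pow (by norm_num)
  have j1 : Integrable (fun z : Space d × ℝ => ‖f₁ z.1‖ ^ 2)
      ((volume : Measure (Space d)).prod ν) :=
    i1.comp_fst ν
  have hmp : MeasurePreserving (fun z : ℝ × Space d => (z.1, z.2 + z.1 • h))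
      (ν.prod volume) (ν.prod volume) :=
    (MeasurePreserving.id ν).skew_product (g := fun t x => x + t • h) (by fun_prop)
      (Eventually.of_forall fun t => (measurePreserving_add_right volume (t • h)).map_eq)
  have hmp2 : MeasurePreserving (fun z : Space d × ℝ => z.1 + z.2 • h)
      ((volume : Measure (Space d)).prod ν) volume :=
    (measurePreserving_snd (μ := ν) (ν := (volume : Measure (Space d)))).comp
      (hmp.comp (Measure.measurePreserving_swap (μ := (volume : Measure (Space d))) (ν := ν)))
  have j2 : Integrable (fun z : Space d × ℝ => ‖f₂ (z.1 + z.2 • h)‖ ^ 2)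
      ((volume : Measure (Space d)).prod ν) := hmp2.integrable_comp_of_integrable i2
  refine (j1.add j2).mono' hW (Eventually.of_forall fun z => (hle z).trans ?_)
  simp only [Pi.add_apply]
  nlinarith [sq_nonneg (‖f₁ z.1‖ - ‖f₂ (z.1 + z.2 • h)‖), sq_nonneg (‖f₁ z.1‖),
    sq_nonneg (‖f₂ (z.1 + z.2 • h)‖)]

/-- The derivative `h · ∇u` in the direction `h`, in terms of the gradient `g` of `u`. -/
def dirDeriv {d : ℕ} (h : Space d) (g : EuclideanSpace ℂ (Fin d)) : ℂ := ∑ i, (h i : ℂ) * g i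

theorem norm_dirDeriv_le {d : ℕ} (h : Space d) (g : EuclideanSpace ℂ (Fin d)) :
    ‖dirDeriv h g‖ ≤ ‖h‖ * ‖g‖ := by
  have e : dirDeriv h g
      = inner ℂ (WithLp.toLp 2 (fun i => (h i : ℂ)) : EuclideanSpace ℂ (Fin d)) g := by
    simp [dirDeriv, PiLp.inner_apply, mul_comm]
  rw [e]
  refine (norm_inner_le_norm _ _).trans (le_of_eq ?_)
  congr 1
  simp [EuclideanSpace.norm_eq]

theorem continuous_dirDeriv {d : ℕ} (h : Space d) : Continuous (dirDeriv h) := by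
  unfold dirDeriv
  fun_prop

theorem memLp_dirDeriv {d : ℕ} (h : Space d) {g : Space d → EuclideanSpace ℂ (Fin d)}
    (hg : MemLp g 2 volume) : MemLp (fun x => dirDeriv h (g x)) 2 volume :=
  hg.of_le_mul (c := ‖h‖) ((continuous_dirDeriv h).comp_aestronglyMeasurable hg.1)
    (Eventually.of_forall fun x => norm_dirDeriv_le h (g x))

theorem IsWeakGradient.integral_fderiv_apply_smul {d : ℕ} {u : Space d → ℂ}
    {g : Space d → EuclideanSpace ℂ (Fin d)} (hw : IsWeakGradient u g) (hu : MemLp u 2 volume)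
    (hg : MemLp g 2 volume) {ψ : Space d → ℝ} (hψ : ContDiff ℝ (⊤ : ℕ∞) ψ)
    (hc : HasCompactSupport ψ) (h : Space d) :
    ∫ x, (fderiv ℝ ψ x h) • u x = - ∫ x, ψ x • dirDeriv h (g x) := by
  have hh : h = ∑ i, h i • EuclideanSpace.single i (1 : ℝ) := by
    ext j
    simp [Pi.single_apply]
  have e1 : ∀ x, (fderiv ℝ ψ x h) • u x
      = ∑ i, h i • ((fderiv ℝ ψ x (EuclideanSpace.single i 1)) • u x) := by
    intro x
    conv_lhs => rw [hh]
    simp only [map_sum, map_smul, Finset.sum_smul, smul_assoc]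
  have e2 : ∀ x, ψ x • dirDeriv h (g x) = ∑ i, h i • (ψ x • (g x) i) := by
    intro x
    simp only [dirDeriv, Finset.smul_sum, Complex.real_smul]
    exact Finset.sum_congr rfl fun i _ => by ring
  simp only [e1, e2]
  have s1 : ∀ i ∈ Finset.univ, Integrable
      (fun x => h i • ((fderiv ℝ ψ x (EuclideanSpace.single i 1)) • u x)) volume :=
    fun i _ => (integrable_fderiv_smul hu hψ hc i).smul (h i)
  have s2 : ∀ i ∈ Finset.univ, Integrable (fun x => h i • (ψ x • (g x) i)) volume :=
    fun i _ => (integrable_smul_coord hg hψ hc i).smul (h i)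
  rw [integral_finsetSum _ s1, integral_finsetSum _ s2, ← Finset.sum_neg_distrib]
  refine Finset.sum_congr rfl fun i _ => ?_
  rw [integral_smul, integral_smul, hw ψ hψ hc i, smul_neg]

/-- Uniform probability measure on `[0, 1]`. -/
abbrev unitMeasure : Measure ℝ := volume.restrict (Set.Ioc 0 1)

instance : IsProbabilityMeasure unitMeasure := ⟨by simp [unitMeasure]⟩

/-- The fundamental theorem of calculus along h, by duality: tested against ψ, translations move
onto ψ, where the classical theorem applies, and Fubini exchanges the x and t integrals. -/
theorem IsWeakGradient.translate_sub_ae_eq {d : ℕ} {u : Space d → ℂ}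
    {g : Space d → EuclideanSpace ℂ (Fin d)} (hw : IsWeakGradient u g) (hu : MemLp u 2 volume)
    (hg : MemLp g 2 volume) (hgm : StronglyMeasurable g) (h : Space d) :
    ∀ᵐ x, u (x + h) - u x = ∫ t, dirDeriv h (g (x + t • h)) ∂unitMeasure := by
  set p : Space d → ℂ := fun x => dirDeriv h (g x) with hp
  have hpL : MemLp p 2 volume := memLp_dirDeriv h hg
  have hpm : StronglyMeasurable p := (continuous_dirDeriv h).comp_stronglyMeasurable hgm
  have hmeas : StronglyMeasurable (fun z : Space d × ℝ => p (z.1 + z.2 • h)) :=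
    hpm.comp_measurable (by fun_prop)
  have htr : ∀ c : Space d, MemLp (fun x => u (x + c)) 2 volume := fun c =>
    hu.comp_measurePreserving (measurePreserving_add_right volume c)
  have hEm : StronglyMeasurable (fun x => ∫ t, p (x + t • h) ∂unitMeasure) :=
    hmeas.integral_prod_right'
  refine ae_eq_of_integral_contDiff_smul_eq (μ := volume) ?_ ?_ ?_
  · exact ((htr h).sub hu).locallyIntegrable (by norm_num)
  · rw [locallyIntegrable_iff]
    intro k hk
    -- Pairing with the indicator of the compact set k turns integrability on the product space into
    -- local integrability of the t-average.
    have hW := integrable_mul_translate (f₁ := Set.indicator k (fun _ => (1 : ℂ))) (f₂ := p)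
      (memLp_indicator_const 2 hk.measurableSet 1 (Or.inr hk.measure_ne_top)) hpL unitMeasure h
      (W := fun z => Set.indicator k (fun _ => (1 : ℂ)) z.1 * p (z.1 + z.2 • h))
      ((((stronglyMeasurable_const.indicator hk.measurableSet).comp_measurable
        measurable_fst).mul hmeas).aestronglyMeasurable) (fun z => by simp)
    have := hW.integral_prod_left
    rw [← integrable_indicator_iff hk.measurableSet]
    refine this.congr (Eventually.of_forall fun x => ?_)
    by_cases hx : x ∈ k <;> simp [hx, hp]
  · intro ψ hψ hc
    have hψL : MemLp ψ 2 volume := hψ.continuous.memLp_of_hasCompactSupport hc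
    have hdc : Continuous (fun x => fderiv ℝ ψ x h) :=
      (hψ.continuous_fderiv (by simp)).clm_apply continuous_const
    have hdL : MemLp (fun x => fderiv ℝ ψ x h) 2 volume :=
      hdc.memLp_of_hasCompactSupport ((hc.fderiv (𝕜 := ℝ)).comp_left
        (g := fun L : Space d →L[ℝ] ℝ => L h) rfl)
    have I1 : Integrable (fun z : Space d × ℝ => ψ z.1 • p (z.1 + z.2 • h))
        ((volume : Measure (Space d)).prod unitMeasure) :=
      integrable_mul_translate hψL hpL unitMeasure h
        (((hψ.continuous.comp continuous_fst).aestronglyMeasurable).smul hmeas.aestronglyMeasurable)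
        (fun z => by rw [norm_smul])
    have I2 : Integrable (fun z : Space d × ℝ => (fderiv ℝ ψ (z.1 + z.2 • (-h)) h) • u z.1)
        ((volume : Measure (Space d)).prod unitMeasure) :=
      integrable_mul_translate hu hdL unitMeasure (-h)
        ((hdc.comp (by fun_prop)).aestronglyMeasurable.smul hu.1.comp_fst)
        (fun z => by rw [norm_smul, mul_comm])
    have hshift : ∀ t : ℝ, ∫ x, ψ x • p (x + t • h)
        = - ∫ x, (fderiv ℝ ψ (x + t • (-h)) h) • u x := by
      intro t
      have s1 : ∫ x, ψ x • p (x + t • h) = ∫ x, ψ (x + t • (-h)) • p x := by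
        rw [← integral_add_right_eq_self (fun x => ψ (x + t • (-h)) • p x) (t • h)]
        simp [add_assoc]
      rw [s1]
      have := hw.integral_fderiv_apply_smul hu hg (ψ := fun x => ψ (x + t • (-h)))
        (hψ.comp (contDiff_id.add contDiff_const))
        (hc.comp_homeomorph (Homeomorph.addRight (t • (-h)))) h
      simp only [fderiv_comp_add_right] at this
      rw [this, neg_neg]
    have hftc : ∀ x, ∫ t, (fderiv ℝ ψ (x + t • (-h)) h) ∂unitMeasure = ψ x - ψ (x - h) := by
      intro x
      have hder : ∀ t ∈ Set.uIcc (0 : ℝ) 1, HasDerivAt (fun t : ℝ => - ψ (x + t • (-h)))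
          (fderiv ℝ ψ (x + t • (-h)) h) t := by
        intro t _
        have d1 : HasDerivAt (fun t : ℝ => x + t • (-h)) (-h) t := by
          simpa using ((hasDerivAt_id t).smul_const (-h)).const_add x
        have d2 : HasFDerivAt ψ (fderiv ℝ ψ (x + t • (-h))) (x + t • (-h)) :=
          (hψ.differentiable (by simp) _).hasFDerivAt
        have := (d2.comp_hasDerivAt t d1).fun_neg
        rw [map_neg, neg_neg] at this
        exact this
      have hInt : IntervalIntegrable (fun t : ℝ => fderiv ℝ ψ (x + t • (-h)) h) volume 0 1 :=
        (hdc.comp (by fun_prop)).intervalIntegrable _ _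
      have := intervalIntegral.integral_eq_sub_of_hasDerivAt hder hInt
      rw [intervalIntegral.integral_of_le zero_le_one] at this
      rw [this]
      simp [sub_eq_add_neg, add_comm]
    have L1 : ∫ x, ψ x • (u (x + h) - u x) = ∫ x, (ψ (x - h) - ψ x) • u x := by
      have a1 : Integrable (fun x => ψ x • u (x + h)) volume :=
        ((htr h).locallyIntegrable (by norm_num)).integrable_smul_left_of_hasCompactSupport
          hψ.continuous hc
      have a2 : Integrable (fun x => ψ x • u x) volume :=
        (hu.locallyIntegrable (by norm_num)).integrable_smul_left_of_hasCompactSupport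
          hψ.continuous hc
      have a3 : Integrable (fun x => ψ (x - h) • u x) volume := by
        have := a1.comp_sub_right h
        simpa using this
      have e : ∫ x, ψ x • u (x + h) = ∫ x, ψ (x - h) • u x := by
        rw [← integral_add_right_eq_self (fun x => ψ (x - h) • u x) h]
        simp
      simp only [smul_sub, sub_smul]
      rw [integral_sub a1 a2, integral_sub a3 a2, e]
    rw [L1]
    have R1 : ∫ x, ψ x • ∫ t, p (x + t • h) ∂unitMeasure
        = ∫ t, (∫ x, ψ x • p (x + t • h)) ∂unitMeasure := by
      simp only [← integral_smul]
      exact integral_integral_swap (f := fun x t => ψ x • p (x + t • h)) I1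
    rw [R1]
    simp only [hshift]
    rw [integral_neg,
      ← integral_integral_swap (f := fun x t => (fderiv ℝ ψ (x + t • (-h)) h) • u x) I2,
      ← integral_neg]
    refine integral_congr_ae (Eventually.of_forall fun x => ?_)
    simp only
    rw [integral_smul_const, hftc x, ← neg_smul, neg_sub]

/-- Jensen's inequality in t, then translation invariance of the x integral. -/
theorem IsWeakGradient.lintegral_translate_sub_le {d : ℕ} {u : Space d → ℂ}
    {g : Space d → EuclideanSpace ℂ (Fin d)} (hw : IsWeakGradient u g) (hu : MemLp u 2 volume)
    (hg : MemLp g 2 volume) (hgm : StronglyMeasurable g) (h : Space d) :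
    ∫⁻ x, ‖u (x + h) - u x‖ₑ ^ (2 : ℝ) ≤ ‖h‖ₑ ^ (2 : ℝ) * ∫⁻ x, ‖g x‖ₑ ^ (2 : ℝ) := by
  have hm : StronglyMeasurable (fun z : Space d × ℝ => g (z.1 + z.2 • h)) :=
    hgm.comp_measurable (by fun_prop)
  have hpt : ∀ᵐ x, ‖u (x + h) - u x‖ₑ ^ (2 : ℝ)
      ≤ ∫⁻ t, ‖h‖ₑ ^ (2 : ℝ) * ‖g (x + t • h)‖ₑ ^ (2 : ℝ) ∂unitMeasure := by
    filter_upwards [hw.translate_sub_ae_eq hu hg hgm h] with x hx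
    rw [hx]
    refine (enorm_integral_rpow_le ?_ (by norm_num)).trans (lintegral_mono fun t => ?_)
    · exact ((continuous_dirDeriv h).comp_stronglyMeasurable
        (hgm.comp_measurable (by fun_prop))).aestronglyMeasurable
    · rw [← ENNReal.mul_rpow_of_nonneg _ _ (by norm_num)]
      refine ENNReal.rpow_le_rpow ?_ (by norm_num)
      rw [← ofReal_norm, ← ofReal_norm, ← ofReal_norm, ← ENNReal.ofReal_mul (norm_nonneg _)]
      exact ENNReal.ofReal_le_ofReal (norm_dirDeriv_le h _)
  refine (lintegral_mono_ae hpt).trans ?_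
  rw [lintegral_lintegral_swap]
  · have : ∀ t : ℝ, ∫⁻ x, ‖h‖ₑ ^ (2 : ℝ) * ‖g (x + t • h)‖ₑ ^ (2 : ℝ)
        = ‖h‖ₑ ^ (2 : ℝ) * ∫⁻ x, ‖g x‖ₑ ^ (2 : ℝ) := by
      intro t
      rw [lintegral_const_mul']
      · rw [lintegral_add_right_eq_self (fun x => ‖g x‖ₑ ^ (2 : ℝ)) (t • h)]
      · exact ENNReal.rpow_ne_top_of_nonneg (by norm_num) enorm_ne_top
    simp only [this, lintegral_const, measure_univ, mul_one, le_refl]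
  · exact ((hm.enorm.pow_const _).const_mul _).aemeasurable

/-- The uniform probability measure on the ball of radius `r` around the origin. -/
def ballMeasure (d : ℕ) (r : ℝ) : Measure (Space d) :=
  (volume (Metric.ball (0 : Space d) r))⁻¹ • volume.restrict (Metric.ball 0 r)

theorem isProbabilityMeasure_ballMeasure (d : ℕ) {r : ℝ} (hr : 0 < r) :
    IsProbabilityMeasure (ballMeasure d r) := by
  constructor
  simp only [ballMeasure, Measure.smul_apply, Measure.restrict_apply_univ, smul_eq_mul]
  exact ENNReal.inv_mul_cancel (Metric.measure_ball_pos volume 0 hr).ne' measure_ball_lt_top.ne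

/-- The average of `u` over the ball of radius `r` around `x`. -/
def avg {d : ℕ} (r : ℝ) (u : Space d → ℂ) (x : Space d) : ℂ := ∫ y, u (x + y) ∂ballMeasure d r

theorem ballMeasure_absolutelyContinuous (d : ℕ) (r : ℝ) : ballMeasure d r ≪ volume :=
  (Measure.smul_absolutelyContinuous).trans Measure.restrict_le_self.absolutelyContinuous

theorem ballMeasure_le (d : ℕ) (r : ℝ) :
    ballMeasure d r ≤ (volume (Metric.ball (0 : Space d) r))⁻¹ • volume := by
  unfold ballMeasure
  gcongr
  exact Measure.restrict_le_self

theorem integrable_ballMeasure {d : ℕ} {u : Space d → ℂ} (hu : MemLp u 2 volume) {r : ℝ}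
    (hr : 0 < r) (x : Space d) : Integrable (fun y => u (x + y)) (ballMeasure d r) := by
  have := isProbabilityMeasure_ballMeasure d hr
  have h1 : MemLp (fun y => u (x + y)) 2 volume :=
    hu.comp_measurePreserving (measurePreserving_add_left volume x)
  have h2 : MemLp (fun y => u (x + y)) 2 (ballMeasure d r) :=
    h1.of_measure_le_smul (c := (volume (Metric.ball (0 : Space d) r))⁻¹)
      (ENNReal.inv_ne_top.2 (Metric.measure_ball_pos volume 0 hr).ne') (ballMeasure_le d r)
  exact h2.integrable (by norm_num)

theorem stronglyMeasurable_avg {d : ℕ} {u : Space d → ℂ} (hum : StronglyMeasurable u) {r : ℝ}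
    (hr : 0 < r) : StronglyMeasurable (avg r u) := by
  have := isProbabilityMeasure_ballMeasure d hr
  have hm : StronglyMeasurable (fun z : Space d × Space d => u (z.1 + z.2)) :=
    hum.comp_measurable (by fun_prop)
  exact hm.integral_prod_right'

/-- The function minus its ball average is an average of differences u(x) - u(x+y) with |y| < r.
Jensen reduces the bound to the translation estimate, with |y| replaced by r. -/
theorem IsWeakGradient.lintegral_sub_avg_le {d : ℕ} {u : Space d → ℂ}
    {g : Space d → EuclideanSpace ℂ (Fin d)} (hw : IsWeakGradient u g) (hu : MemLp u 2 volume)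
    (hum : StronglyMeasurable u)
    (hg : MemLp g 2 volume) (hgm : StronglyMeasurable g) {r : ℝ} (hr : 0 < r) :
    ∫⁻ x, ‖u x - avg r u x‖ₑ ^ (2 : ℝ) ≤ ENNReal.ofReal r ^ (2 : ℝ) * ∫⁻ x, ‖g x‖ₑ ^ (2 : ℝ) := by
  have := isProbabilityMeasure_ballMeasure d hr
  have hm : StronglyMeasurable (fun z : Space d × Space d => u (z.1 + z.2) - u z.1) :=
    (hum.comp_measurable (by fun_prop)).sub (hum.comp_measurable (by fun_prop))
  have hpt : ∀ x, ‖u x - avg r u x‖ₑ ^ (2 : ℝ)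
      ≤ ∫⁻ y, ‖u (x + y) - u x‖ₑ ^ (2 : ℝ) ∂ballMeasure d r := by
    intro x
    have e : avg r u x - u x = ∫ y, (u (x + y) - u x) ∂ballMeasure d r := by
      rw [integral_sub (integrable_ballMeasure hu hr x) (integrable_const _)]
      simp [avg]
    rw [← enorm_neg, neg_sub, e]
    exact enorm_integral_rpow_le
      (hm.comp_measurable (measurable_prodMk_left (x := x))).aestronglyMeasurable (by norm_num)
  refine (lintegral_mono hpt).trans ?_
  rw [lintegral_lintegral_swap (hm.enorm.pow_const _).aemeasurable]
  have hb : ∀ᵐ y ∂ballMeasure d r, ∫⁻ x, ‖u (x + y) - u x‖ₑ ^ (2 : ℝ)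
      ≤ ENNReal.ofReal r ^ (2 : ℝ) * ∫⁻ x, ‖g x‖ₑ ^ (2 : ℝ) := by
    have hball : ∀ᵐ y ∂ballMeasure d r, y ∈ Metric.ball (0 : Space d) r :=
      Measure.smul_absolutelyContinuous.ae_le (ae_restrict_mem measurableSet_ball)
    filter_upwards [hball] with y hy
    refine (hw.lintegral_translate_sub_le hu hg hgm y).trans ?_
    gcongr
    rw [← ofReal_norm]
    exact ENNReal.ofReal_le_ofReal (mem_ball_zero_iff.1 hy).le
  refine (lintegral_mono_ae hb).trans ?_
  simp

theorem enorm_avg_rpow_le {d : ℕ} {u : Space d → ℂ} (hum : StronglyMeasurable u) {r : ℝ}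
    (hr : 0 < r) {q : ℝ} (hq : 1 ≤ q) (x : Space d) :
    ‖avg r u x‖ₑ ^ q
      ≤ (volume (Metric.ball (0 : Space d) r))⁻¹ * ∫⁻ y in Metric.ball x r, ‖u y‖ₑ ^ q := by
  have := isProbabilityMeasure_ballMeasure d hr
  refine (enorm_integral_rpow_le
    (hum.comp_measurable (by fun_prop)).aestronglyMeasurable hq).trans (le_of_eq ?_)
  rw [ballMeasure, lintegral_smul_measure, smul_eq_mul]
  congr 1
  rw [← lintegral_indicator measurableSet_ball, ← lintegral_indicator measurableSet_ball,
    ← lintegral_add_left_eq_self ((Metric.ball x r).indicator fun y => ‖u y‖ₑ ^ q) x]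
  refine lintegral_congr fun y => ?_
  by_cases hy : y ∈ Metric.ball (0 : Space d) r
  · have : x + y ∈ Metric.ball x r := by simpa using hy
    rw [Set.indicator_of_mem hy, Set.indicator_of_mem this]
    rfl
  · have : x + y ∉ Metric.ball x r := by simpa using hy
    rw [Set.indicator_of_notMem hy, Set.indicator_of_notMem this]

end

end InversePowerNLS

namespace InversePowerNLS

open MeasureTheory Filter Topology
open scoped ENNReal NNReal

noncomputable section

/-! ### The Sobolev embedding -/

theorem norm_sq_eq {d : ℕ} (v : H1 d) : ‖v‖ ^ 2 = ‖fn v‖ ^ 2 + ‖grad v‖ ^ 2 :=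
  WithLp.prod_norm_sq_eq_of_L2 _

theorem norm_fn_le {d : ℕ} (v : H1 d) : ‖fn v‖ ≤ ‖v‖ := by
  have := norm_sq_eq v
  exact le_of_sq_le_sq (by nlinarith [sq_nonneg ‖grad v‖]) (norm_nonneg _)

theorem norm_grad_le {d : ℕ} (v : H1 d) : ‖grad v‖ ≤ ‖v‖ := by
  have := norm_sq_eq v
  exact le_of_sq_le_sq (by nlinarith [sq_nonneg ‖fn v‖]) (norm_nonneg _)

theorem lintegral_fn_sub_avg_le {d : ℕ} (v : H1 d) {r : ℝ} (hr : 0 < r) :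
    ∫⁻ x, ‖fn v x - avg r (fn v) x‖ₑ ^ (2 : ℝ) ≤ ENNReal.ofReal (r ^ 2 * ‖grad v‖ ^ 2) := by
  refine ((isWeakGradient_grad v).lintegral_sub_avg_le (Lp.memLp _) (Lp.stronglyMeasurable _)
    (Lp.memLp _) (Lp.stronglyMeasurable _) hr).trans (le_of_eq ?_)
  rw [lintegral_enorm_rpow_two, ENNReal.ofReal_mul (by positivity), ENNReal.ofReal_pow hr.le,
    ENNReal.rpow_two]

/-- The `L^q` norm is bounded on the unit ball of `H¹`. -/
def SobolevBound (d : ℕ) (q : ℝ) : Prop :=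
  ∃ C : ℝ, 0 ≤ C ∧ ∀ v : H1 d, ‖v‖ ≤ 1 → ∫⁻ x, ‖fn v x‖ₑ ^ q ≤ ENNReal.ofReal C

theorem sobolevBound_two (d : ℕ) : SobolevBound d 2 := by
  refine ⟨1, zero_le_one, fun v hv => ?_⟩
  rw [lintegral_enorm_rpow_two]
  exact ENNReal.ofReal_le_ofReal (pow_le_one₀ (norm_nonneg _) ((norm_fn_le v).trans hv))

theorem volume_ball_real (d : ℕ) {r : ℝ} (hr : 0 < r) :
    volume (Metric.ball (0 : Space d) r)
      = ENNReal.ofReal (r ^ d * (volume (Metric.ball (0 : Space d) 1)).toReal) := by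
  rw [Measure.addHaar_ball_of_pos volume 0 hr, ENNReal.ofReal_mul (by positivity),
    ENNReal.ofReal_toReal measure_ball_lt_top.ne]
  simp

/-- Averages over balls of radius `≥ r` are small when `r` is large with respect to the bound. -/
theorem norm_avg_rpow_le {d : ℕ} {u : Space d → ℂ} (hum : StronglyMeasurable u) {r : ℝ}
    (hr : 0 < r) {q C : ℝ} (hq : 1 ≤ q) (hC : 0 ≤ C) (h : ∫⁻ x, ‖u x‖ₑ ^ q ≤ ENNReal.ofReal C)
    (x : Space d) :
    ‖avg r u x‖ ^ q ≤ C / (r ^ d * (volume (Metric.ball (0 : Space d) 1)).toReal) := by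
  have hw : 0 < (volume (Metric.ball (0 : Space d) 1)).toReal :=
    ENNReal.toReal_pos (Metric.measure_ball_pos volume 0 one_pos).ne' measure_ball_lt_top.ne
  have hpos : 0 < r ^ d * (volume (Metric.ball (0 : Space d) 1)).toReal := by positivity
  have h1 : ‖avg r u x‖ₑ ^ q ≤ ENNReal.ofReal
      (C / (r ^ d * (volume (Metric.ball (0 : Space d) 1)).toReal)) := by
    refine (enorm_avg_rpow_le hum hr hq x).trans ?_
    rw [volume_ball_real d hr, div_eq_inv_mul, ENNReal.ofReal_mul (inv_nonneg.2 hpos.le),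
      ENNReal.ofReal_inv_of_pos hpos]
    gcongr
    exact (setLIntegral_le_lintegral _ _).trans h
  rw [← ofReal_norm, ENNReal.ofReal_rpow_of_nonneg (norm_nonneg _) (by linarith)] at h1
  exact (ENNReal.ofReal_le_ofReal_iff (by positivity)).1 h1

/-- On a dyadic level of |u|, if the average is at most half the level, then the oscillation e is at
least t/2. Two of the q' powers are paid by e², the others by the height of the level. -/
theorem rpow_le_of_dyadic {q' t e : ℝ} (hq' : 2 ≤ q') {k : ℕ} (h1 : (2 : ℝ) ^ k ≤ t)
    (h2 : t < 2 ^ (k + 1)) (he : t - 2 ^ k / 2 ≤ e) :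
    t ^ q' ≤ 4 * ((2 : ℝ) ^ (k + 1)) ^ (q' - 2) * e ^ 2 := by
  have hk : (0 : ℝ) < 2 ^ k := by positivity
  have ht : 0 < t := by linarith
  have e1 : t ^ q' = t ^ (q' - 2) * t ^ 2 := by
    rw [← Real.rpow_two, ← Real.rpow_add ht]
    congr 1
    ring
  have e2 : t ^ (q' - 2) ≤ ((2 : ℝ) ^ (k + 1)) ^ (q' - 2) :=
    Real.rpow_le_rpow ht.le h2.le (by linarith)
  have e3 : t ^ 2 ≤ 4 * e ^ 2 := by nlinarith
  calc t ^ q' = t ^ (q' - 2) * t ^ 2 := e1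
    _ ≤ ((2 : ℝ) ^ (k + 1)) ^ (q' - 2) * (4 * e ^ 2) := by gcongr
    _ = _ := by ring

/-- At height |u| ~ 2^k, average over the radius r_k ~ 2^{-kq/d} at which the L^q bound forces
|A_{r_k}u| ≤ 2^{k-1}. That level then contributes at most a constant times 2^{k(q'-2)} r_k², and the
sum over k is geometric exactly when q' - 2 < 2q/d. -/
theorem SobolevBound.improve {d : ℕ} (hd : 1 ≤ d) {q q' : ℝ} (hq : 2 ≤ q) (hq' : 2 ≤ q')
    (hlt : q' < 2 + 2 * q / d) (h : SobolevBound d q) : SobolevBound d q' := by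
  obtain ⟨C, hC, hb⟩ := h
  set w : ℝ := (volume (Metric.ball (0 : Space d) 1)).toReal with hwdef
  have hw : 0 < w :=
    ENNReal.toReal_pos (Metric.measure_ball_pos volume 0 one_pos).ne' measure_ball_lt_top.ne
  have hdpos : (0 : ℝ) < d := by exact_mod_cast hd
  -- The radii will be ρ b^k. The factor ρ absorbs C, and ρ ≥ 1 is used for ρ ≤ ρ^d; the ratio b
  -- satisfies b^d = 2^{-q}.
  set ρ : ℝ := max 1 (C * 2 ^ q / w) with hρ
  have hρ1 : 1 ≤ ρ := le_max_left _ _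
  have hρd : C * 2 ^ q ≤ ρ ^ d * w := by
    have h1 : C * 2 ^ q / w ≤ ρ := le_max_right _ _
    have h2 : ρ ≤ ρ ^ d := le_self_pow₀ hρ1 (by omega)
    have := h1.trans h2
    rwa [div_le_iff₀ hw] at this
  set b : ℝ := 2 ^ (-(q / d)) with hbdef
  have hbpos : 0 < b := by positivity
  have hbd : b ^ d = (2 ^ q)⁻¹ := by
    rw [hbdef, ← Real.rpow_natCast, ← Real.rpow_mul (by norm_num), ← Real.rpow_neg (by norm_num)]
    congr 1
    field_simp
  have hrk : ∀ k : ℕ, 0 < ρ * b ^ k := fun k => by positivity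
  set c : ℕ → ℝ := fun k => 4 * ((2 : ℝ) ^ (k + 1)) ^ (q' - 2) with hc
  have hcpos : ∀ k, 0 ≤ c k := fun k => by positivity
  have hgeo : ∀ k, c k * (ρ * b ^ k) ^ 2
      = 4 * 2 ^ (q' - 2) * ρ ^ 2 * ((2 : ℝ) ^ (q' - 2) * b ^ 2) ^ k := by
    intro k
    simp only [hc]
    rw [pow_succ, Real.mul_rpow (by positivity) (by norm_num), ← Real.rpow_natCast (2 : ℝ) k,
      ← Real.rpow_mul (by norm_num), mul_comm (k : ℝ), Real.rpow_mul (by norm_num),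
      Real.rpow_natCast]
    ring
  have hratio : (2 : ℝ) ^ (q' - 2) * b ^ 2 < 1 := by
    rw [hbdef, ← Real.rpow_natCast, ← Real.rpow_mul (by norm_num), ← Real.rpow_add (by norm_num)]
    apply Real.rpow_lt_one_of_one_lt_of_neg (by norm_num)
    push_cast
    have : 2 * q / d = q / d * 2 := by ring
    linarith
  have hsum : Summable fun k => c k * (ρ * b ^ k) ^ 2 := by
    simp only [hgeo]
    exact (summable_geometric_of_lt_one (by positivity) hratio).mul_left _
  have hnn : ∀ k, 0 ≤ c k * (ρ * b ^ k) ^ 2 := fun k => mul_nonneg (hcpos k) (sq_nonneg _)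
  refine ⟨1 + ∑' k, c k * (ρ * b ^ k) ^ 2, add_nonneg zero_le_one (tsum_nonneg hnn),
    fun v hv => ?_⟩
  have hum := Lp.stronglyMeasurable (fn v)
  have havg : ∀ k x, ‖avg (ρ * b ^ k) (fn v) x‖ ≤ 2 ^ k / 2 := by
    intro k x
    have h1 := norm_avg_rpow_le hum (hrk k) (by linarith) hC (hb v hv) x
    have h2 : C / ((ρ * b ^ k) ^ d * w) ≤ ((2 : ℝ) ^ k / 2) ^ q := by
      have e1 : (b ^ k) ^ d = ((2 : ℝ) ^ q)⁻¹ ^ k := by rw [← pow_mul, mul_comm, pow_mul, hbd]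
      have e2 : ((2 : ℝ) ^ k / 2) ^ q = ((2 : ℝ) ^ q) ^ k / 2 ^ q := by
        rw [Real.div_rpow (by positivity) (by norm_num), ← Real.rpow_natCast, ← Real.rpow_natCast,
          ← Real.rpow_mul (by norm_num), ← Real.rpow_mul (by norm_num), mul_comm]
      have hq2 : (0 : ℝ) < 2 ^ q := by positivity
      have hq3 : (0 : ℝ) < ((2 : ℝ) ^ q) ^ k := by positivity
      rw [e2, mul_pow, e1, inv_pow, div_le_div_iff₀ (by positivity) hq2]
      calc C * 2 ^ q ≤ ρ ^ d * w := hρd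
        _ = _ := by field_simp
    exact (Real.rpow_le_rpow_iff (norm_nonneg _) (by positivity) (by linarith)).1 (h1.trans h2)
  have hpt : ∀ x, ‖fn v x‖ₑ ^ q' ≤ ‖fn v x‖ₑ ^ (2 : ℝ) + ∑' k : ℕ, ENNReal.ofReal (c k) *
      ‖fn v x - avg (ρ * b ^ k) (fn v) x‖ₑ ^ (2 : ℝ) := by
    intro x
    rcases le_total ‖fn v x‖ 1 with h1 | h1
    · refine le_add_right ?_
      refine ENNReal.rpow_le_rpow_of_exponent_ge ?_ hq'
      rw [← ofReal_norm]
      exact ENNReal.ofReal_le_one.2 h1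
    · obtain ⟨k, hk1, hk2⟩ := exists_nat_pow_near h1 (one_lt_two)
      refine le_add_left (le_trans ?_ (ENNReal.le_tsum k))
      have := rpow_le_of_dyadic hq' hk1 hk2 (e := ‖fn v x - avg (ρ * b ^ k) (fn v) x‖) (by
        have := norm_sub_norm_le (fn v x) (avg (ρ * b ^ k) (fn v) x)
        linarith [havg k x])
      rw [← ofReal_norm, ← ofReal_norm, ENNReal.rpow_two,
        ENNReal.ofReal_rpow_of_nonneg (norm_nonneg _) (by linarith),
        ← ENNReal.ofReal_pow (norm_nonneg _), ← ENNReal.ofReal_mul (hcpos k)]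
      exact ENNReal.ofReal_le_ofReal this
  refine (lintegral_mono hpt).trans ?_
  have hm : ∀ k : ℕ, Measurable fun x => ENNReal.ofReal (c k) *
      ‖fn v x - avg (ρ * b ^ k) (fn v) x‖ₑ ^ (2 : ℝ) := fun k =>
    ((hum.sub (stronglyMeasurable_avg hum (hrk k))).enorm.pow_const _).const_mul _
  rw [lintegral_add_left (hum.enorm.pow_const _), lintegral_tsum fun k => (hm k).aemeasurable,
    ENNReal.ofReal_add zero_le_one (tsum_nonneg hnn), ENNReal.ofReal_tsum_of_nonneg hnn hsum]
  refine add_le_add ?_ (ENNReal.tsum_le_tsum fun k => ?_)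
  · rw [lintegral_enorm_rpow_two]
    exact ENNReal.ofReal_le_ofReal (pow_le_one₀ (norm_nonneg _) ((norm_fn_le v).trans hv))
  · rw [lintegral_const_mul' _ _ ENNReal.ofReal_ne_top, ENNReal.ofReal_mul (hcpos k)]
    gcongr
    refine (lintegral_fn_sub_avg_le v (hrk k)).trans (ENNReal.ofReal_le_ofReal ?_)
    exact mul_le_of_le_one_right (sq_nonneg _)
      (pow_le_one₀ (norm_nonneg _) ((norm_grad_le v).trans hv))

/-- Bootstrap from L². The hypothesis on q says (d-2)q < 2d, that is, q is below the Sobolev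
exponent; below it each improvement gains at least a fixed amount. -/
theorem sobolevBound {d : ℕ} (hd : 1 ≤ d) {q : ℝ} (hq : 2 ≤ q) (hlt : q < 2 + 2 * q / d) :
    SobolevBound d q := by
  have hdpos : (0 : ℝ) < d := by exact_mod_cast hd
  -- The possible gain 2 + 2m/d - m is affine in m and takes these two values at m = 2 and m = q, so
  -- δ bounds it below on [2, q]. Steps of δ/2 keep the required inequality strict.
  set δ : ℝ := min (4 / d) (2 + 2 * q / d - q) with hδ
  have hδ0 : 0 < δ := lt_min (by positivity) (by linarith)
  have key : ∀ n : ℕ, SobolevBound d (min q (2 + n * (δ / 2))) := by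
    intro n
    induction n with
    | zero => simpa [hq] using sobolevBound_two d
    | succ n ih =>
      have hl : 2 ≤ min q (2 + n * (δ / 2)) := le_min hq (by
        have : 0 ≤ n * (δ / 2) := by positivity
        linarith)
      refine ih.improve hd hl (le_min hq ?_) ?_
      · have : 0 ≤ ((n + 1 : ℕ) : ℝ) * (δ / 2) := by positivity
        linarith
      · set m := min q (2 + n * (δ / 2)) with hm
        have h1 : min q (2 + ((n + 1 : ℕ) : ℝ) * (δ / 2)) ≤ m + δ / 2 := by
          rcases le_total q (2 + n * (δ / 2)) with h | h
          · rw [hm, min_eq_left h]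
            exact (min_le_left _ _).trans (by linarith)
          · rw [hm, min_eq_right h]
            refine (min_le_right _ _).trans (le_of_eq ?_)
            push_cast
            ring
        have h2 : m + δ ≤ 2 + 2 * m / d := by
          have hmq : m ≤ q := min_le_left _ _
          have d1 : δ ≤ 4 / d := min_le_left _ _
          have d2 : δ ≤ 2 + 2 * q / d - q := min_le_right _ _
          rcases le_total (2 / (d : ℝ)) 1 with h | h
          · have : (q - m) * (2 / (d : ℝ)) ≤ (q - m) * 1 :=
              mul_le_mul_of_nonneg_left h (by linarith)
            have e : 2 * q / d - 2 * m / d = (q - m) * (2 / (d : ℝ)) := by ring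
            linarith
          · have : (m - 2) * 1 ≤ (m - 2) * (2 / (d : ℝ)) :=
              mul_le_mul_of_nonneg_left h (by linarith)
            have e : 2 * m / d - 4 / d = (m - 2) * (2 / (d : ℝ)) := by ring
            linarith
        linarith
  obtain ⟨n, hn⟩ := exists_nat_gt ((q - 2) / (δ / 2))
  have := key n
  rwa [min_eq_left] at this
  rw [div_lt_iff₀ (by positivity)] at hn
  linarith

theorem fn_add {d : ℕ} (u v : H1 d) : fn (u + v) = fn u + fn v := rfl
theorem fn_sub {d : ℕ} (u v : H1 d) : fn (u - v) = fn u - fn v := rfl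
theorem fn_smul {d : ℕ} (c : ℂ) (v : H1 d) : fn (c • v) = c • fn v := rfl
theorem fn_real_smul {d : ℕ} (c : ℝ) (v : H1 d) : fn (c • v) = c • fn v := rfl
theorem grad_add {d : ℕ} (u v : H1 d) : grad (u + v) = grad u + grad v := rfl
theorem grad_smul {d : ℕ} (c : ℂ) (v : H1 d) : grad (c • v) = c • grad v := rfl
theorem grad_real_smul {d : ℕ} (c : ℝ) (v : H1 d) : grad (c • v) = c • grad v := rfl

/-- The **subcritical Sobolev inequality** `‖v‖_{L^q} ≤ C ‖v‖_{H¹}`. -/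
theorem exists_eLpNorm_le {d : ℕ} (hd : 1 ≤ d) {q : ℝ} (hq : 2 ≤ q) (hlt : q < 2 + 2 * q / d) :
    ∃ C : ℝ, 0 ≤ C ∧ ∀ v : H1 d,
      eLpNorm (fn v) (ENNReal.ofReal q) volume ≤ ENNReal.ofReal (C * ‖v‖) := by
  obtain ⟨C, hC, hb⟩ := sobolevBound hd hq hlt
  have hq0 : 0 < q := by linarith
  refine ⟨C ^ (1 / q), by positivity, fun v => ?_⟩
  rcases eq_or_ne v 0 with rfl | hv
  · have : (fn (0 : H1 d) : Space d → ℂ) =ᵐ[volume] 0 := Lp.coeFn_zero ℂ 2 volume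
    rw [eLpNorm_congr_ae this]
    simp
  have hn : 0 < ‖v‖ := norm_pos_iff.2 hv
  set w : H1 d := ((‖v‖⁻¹ : ℝ) : ℂ) • v with hw
  have hwn : ‖w‖ ≤ 1 := by
    rw [hw, norm_smul, Complex.norm_real, norm_inv, norm_norm, inv_mul_cancel₀ hn.ne']
  have hvw : v = ((‖v‖ : ℝ) : ℂ) • w := by
    rw [hw, smul_smul, ← Complex.ofReal_mul, mul_inv_cancel₀ hn.ne']
    simp
  have h1 : eLpNorm (fn w) (ENNReal.ofReal q) volume ≤ ENNReal.ofReal (C ^ (1 / q)) := by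
    rw [eLpNorm_eq_lintegral_rpow_enorm_toReal (by simpa using hq0) ENNReal.ofReal_ne_top,
      ENNReal.toReal_ofReal hq0.le, ← ENNReal.ofReal_rpow_of_nonneg hC (by positivity)]
    exact ENNReal.rpow_le_rpow (hb w hwn) (by positivity)
  have h2 : (fn v : Space d → ℂ) =ᵐ[volume] ((‖v‖ : ℝ) : ℂ) • (fn w : Space d → ℂ) := by
    conv_lhs => rw [hvw]
    rw [fn_smul]
    exact Lp.coeFn_smul _ _
  rw [eLpNorm_congr_ae h2, eLpNorm_const_smul, mul_comm, ENNReal.ofReal_mul (by positivity)]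
  gcongr
  rw [← ofReal_norm]
  simp

end

end InversePowerNLS

namespace InversePowerNLS

open MeasureTheory Filter Topology
open scoped ENNReal NNReal

noncomputable section

/-! ### `H¹` as a separable Hilbert space; weak convergence and local compactness -/

theorem continuous_integral_smul {X : Type*} [MeasurableSpace X] {ν : Measure X} {c : X → ℝ}
    (hc : MemLp c 2 ν) : Continuous fun f : Lp ℂ 2 ν => ∫ x, c x • f x ∂ν := by
  have hc' : MemLp (fun x => (c x : ℂ)) 2 ν := hc.ofReal
  have : (fun f : Lp ℂ 2 ν => ∫ x, c x • f x ∂ν) = fun f => inner ℂ (hc'.toLp _) f := by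
    funext f
    rw [L2.inner_def]
    refine integral_congr_ae ?_
    filter_upwards [hc'.coeFn_toLp] with x hx
    rw [hx]
    simp [mul_comm]
  rw [this]
  fun_prop

theorem isClosed_H1 (d : ℕ) : IsClosed (H1 d : Set (WithLp 2 (Lp ℂ 2 (volume : Measure (Space d)) ×
    Lp (EuclideanSpace ℂ (Fin d)) 2 (volume : Measure (Space d))))) := by
  have : (H1 d : Set (WithLp 2 (Lp ℂ 2 (volume : Measure (Space d)) ×
      Lp (EuclideanSpace ℂ (Fin d)) 2 (volume : Measure (Space d)))))
      = {p | ∀ ψ : Space d → ℝ, ContDiff ℝ (⊤ : ℕ∞) ψ → HasCompactSupport ψ → ∀ i : Fin d,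
        ∫ x, (fderiv ℝ ψ x (EuclideanSpace.single i 1)) • p.fst x
          = - ∫ x, ψ x • (p.snd x) i} := rfl
  rw [this]
  simp only [Set.ofPred_forall]
  refine isClosed_iInter fun ψ => isClosed_iInter fun hψ => isClosed_iInter fun hc =>
    isClosed_iInter fun i => isClosed_eq ?_ (Continuous.neg ?_)
  · have hdc : Continuous (fun x => fderiv ℝ ψ x (EuclideanSpace.single i 1)) :=
      (hψ.continuous_fderiv (by simp)).clm_apply continuous_const
    have hdL : MemLp (fun x => fderiv ℝ ψ x (EuclideanSpace.single i 1)) 2 volume :=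
      hdc.memLp_of_hasCompactSupport ((hc.fderiv (𝕜 := ℝ)).comp_left
        (g := fun L : Space d →L[ℝ] ℝ => L (EuclideanSpace.single i 1)) rfl)
    exact (continuous_integral_smul hdL).comp (WithLp.prod_continuous_ofLp 2 _ _).fst
  · have hψL : MemLp ψ 2 volume := hψ.continuous.memLp_of_hasCompactSupport hc
    set P := (EuclideanSpace.proj (𝕜 := ℂ) i : EuclideanSpace ℂ (Fin d) →L[ℂ] ℂ)
    have h1 := (continuous_integral_smul hψL).comp
      ((P.compLpL 2 (volume : Measure (Space d))).continuous.comp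
        (WithLp.prod_continuous_ofLp 2 (Lp ℂ 2 (volume : Measure (Space d))) _).snd)
    convert h1 using 2 with p
    refine integral_congr_ae ?_
    filter_upwards [P.coeFn_compLpL (p := 2) p.snd] with x hx
    simp only [Function.comp]
    erw [hx]
    rfl

instance (d : ℕ) : CompleteSpace (H1 d) := (isClosed_H1 d).completeSpace_coe

theorem fact_two_ne_top : Fact ((2 : ℝ≥0∞) ≠ ⊤) := ⟨by simp⟩

instance (d : ℕ) : SecondCountableTopology (H1 d) := by
  have := fact_two_ne_top
  have h1 : SecondCountableTopology (Lp ℂ 2 (volume : Measure (Space d))) :=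
    Lp.SecondCountableTopology
  have h2 : SecondCountableTopology
      (Lp (EuclideanSpace ℂ (Fin d)) 2 (volume : Measure (Space d))) :=
    Lp.SecondCountableTopology
  have : SecondCountableTopology (WithLp 2 (Lp ℂ 2 (volume : Measure (Space d)) ×
      Lp (EuclideanSpace ℂ (Fin d)) 2 (volume : Measure (Space d)))) :=
    (WithLp.homeomorphProd 2 _ _).secondCountableTopology
  exact TopologicalSpace.Subtype.secondCountableTopology _

/-- Weak convergence of a sequence in `H¹`. -/
def WeakTendsto {d : ℕ} (u : ℕ → H1 d) (w : H1 d) : Prop :=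
  ∀ f : H1 d →L[ℂ] ℂ, Tendsto (fun n => f (u n)) atTop (𝓝 (f w))

/-- Sequential Banach–Alaoglu in the dual of a separable space, transported by the Riesz isometry.
That isometry is conjugate linear, so values of f are recovered after conjugation. -/
theorem exists_weak_limit_subseq {E : Type*} [NormedAddCommGroup E] [InnerProductSpace ℂ E]
    [CompleteSpace E] [TopologicalSpace.SeparableSpace E] {u : ℕ → E} {B : ℝ}
    (hB : ∀ n, ‖u n‖ ≤ B) : ∃ w : E, ∃ k : ℕ → ℕ, StrictMono k ∧
      ∀ f : E →L[ℂ] ℂ, Tendsto (fun n => f (u (k n))) atTop (𝓝 (f w)) := by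
  obtain ⟨F, -, k, hk, hlim⟩ := (WeakDual.isSeqCompact_closedBall ℂ E 0 B)
    (x := fun n => StrongDual.toWeakDual (InnerProductSpace.toDual ℂ E (u n))) (fun n => by
      simp only [Set.mem_preimage, mem_closedBall_zero_iff]
      exact ((InnerProductSpace.toDual ℂ E).norm_map (u n)).trans_le (hB n))
  refine ⟨(InnerProductSpace.toDual ℂ E).symm (WeakDual.toStrongDual F), k, hk, fun f => ?_⟩
  set y := (InnerProductSpace.toDual ℂ E).symm f with hy
  have key : ∀ x : E, f x = (starRingEnd ℂ) (inner ℂ x y) := fun x => by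
    rw [inner_conj_symm, hy, InnerProductSpace.toDual_symm_apply]
  have h1 : Tendsto (fun n => inner ℂ (u (k n)) y) atTop (𝓝 (F y)) :=
    ((WeakDual.eval_continuous y).tendsto F).comp hlim
  have h2 := (Complex.continuous_conj.tendsto _).comp h1
  simp only [key, InnerProductSpace.toDual_symm_apply]
  exact h2

theorem exists_weakTendsto_subseq {d : ℕ} {u : ℕ → H1 d} {B : ℝ} (hB : ∀ n, ‖u n‖ ≤ B) :
    ∃ w : H1 d, ∃ k : ℕ → ℕ, StrictMono k ∧ WeakTendsto (u ∘ k) w :=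
  exists_weak_limit_subseq hB

theorem WeakTendsto.sub_const {d : ℕ} {u : ℕ → H1 d} {w : H1 d} (h : WeakTendsto u w) :
    WeakTendsto (fun n => u n - w) 0 := fun f => by
  have := (h f).sub_const (f w)
  simpa using this

/-! ### Ball averages as continuous functionals on H¹, and local compactness -/

theorem avg_congr_ae {d : ℕ} {u v : Space d → ℂ} (h : u =ᵐ[volume] v) (r : ℝ) (x : Space d) :
    avg r u x = avg r v x := by
  refine integral_congr_ae ((ballMeasure_absolutelyContinuous d r).ae_eq ?_)
  exact (measurePreserving_add_left volume x).quasiMeasurePreserving.ae_eq_comp h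

theorem norm_avg_le {d : ℕ} (v : H1 d) {r : ℝ} (hr : 0 < r) (x : Space d) :
    ‖avg r (fn v) x‖ ≤
      (√(r ^ d * (volume (Metric.ball (0 : Space d) 1)).toReal))⁻¹ * ‖v‖ := by
  have h1 := norm_avg_rpow_le (Lp.stronglyMeasurable (fn v)) hr (q := 2) (by norm_num)
    (sq_nonneg ‖fn v‖) (lintegral_enorm_rpow_two _).le x
  have h2 : 0 ≤ r ^ d * (volume (Metric.ball (0 : Space d) 1)).toReal := by positivity
  refine le_of_sq_le_sq ?_ (by positivity)
  rw [mul_pow, inv_pow, Real.sq_sqrt h2, ← div_eq_inv_mul, ← Real.rpow_two]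
  refine h1.trans ?_
  gcongr
  exact norm_fn_le v

/-- The average over a ball as a continuous linear functional on `H¹`. -/
def avgL {d : ℕ} {r : ℝ} (hr : 0 < r) (x : Space d) : H1 d →L[ℂ] ℂ :=
  LinearMap.mkContinuous
    { toFun := fun v => avg r (fn v) x
      map_add' := fun u v => by
        rw [fn_add, avg_congr_ae (Lp.coeFn_add _ _)]
        exact integral_add (integrable_ballMeasure (Lp.memLp _) hr x)
          (integrable_ballMeasure (Lp.memLp _) hr x)
      map_smul' := fun c v => by
        rw [fn_smul, avg_congr_ae (Lp.coeFn_smul _ _)]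
        exact integral_smul c (fun y => fn v (x + y)) } _ (fun v => norm_avg_le v hr x)

theorem avgL_apply {d : ℕ} {r : ℝ} (hr : 0 < r) (x : Space d) (v : H1 d) :
    avgL hr x v = avg r (fn v) x := rfl

theorem lintegral_ball_le_avg {d : ℕ} (v : H1 d) {r : ℝ} (hr : 0 < r) (s : Set (Space d)) :
    ∫⁻ x in s, ‖fn v x‖ₑ ^ (2 : ℝ) ≤ 2 * ENNReal.ofReal (r ^ 2 * ‖v‖ ^ 2)
      + 2 * ∫⁻ x in s, ‖avg r (fn v) x‖ₑ ^ (2 : ℝ) := by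
  have hum := Lp.stronglyMeasurable (fn v)
  have ham := stronglyMeasurable_avg hum hr
  have hpt : ∀ x, ‖fn v x‖ₑ ^ (2 : ℝ) ≤ 2 * ‖fn v x - avg r (fn v) x‖ₑ ^ (2 : ℝ)
      + 2 * ‖avg r (fn v) x‖ₑ ^ (2 : ℝ) := by
    intro x
    have h1 : ‖fn v x‖ₑ ≤ ‖fn v x - avg r (fn v) x‖ₑ + ‖avg r (fn v) x‖ₑ := by
      have := enorm_add_le (fn v x - avg r (fn v) x) (avg r (fn v) x)
      simpa using this
    refine (ENNReal.rpow_le_rpow h1 (by norm_num)).trans ?_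
    refine (ENNReal.rpow_add_le_mul_rpow_add_rpow _ _ (by norm_num)).trans (le_of_eq ?_)
    rw [mul_add]
    norm_num
  have hm : Measurable fun x => 2 * ‖fn v x - avg r (fn v) x‖ₑ ^ (2 : ℝ) :=
    ((hum.sub ham).enorm.pow_const _).const_mul _
  refine (lintegral_mono hpt).trans ?_
  rw [lintegral_add_left hm,
    lintegral_const_mul' _ _ (by simp), lintegral_const_mul' _ _ (by simp)]
  gcongr
  refine (setLIntegral_le_lintegral _ _).trans ((lintegral_fn_sub_avg_le v hr).trans ?_)
  apply ENNReal.ofReal_le_ofReal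
  gcongr
  exact norm_grad_le v

/-- **Rellich's theorem**: weak convergence in `H¹` implies convergence in `L²_loc`. -/
theorem WeakTendsto.tendsto_lintegral_ball {d : ℕ} {z : ℕ → H1 d} (h : WeakTendsto z 0) {B : ℝ}
    (hB : ∀ n, ‖z n‖ ≤ B) (R : ℝ) :
    Tendsto (fun n => ∫⁻ x in Metric.ball 0 R, ‖fn (z n) x‖ₑ ^ (2 : ℝ)) atTop (𝓝 0) := by
  have hB0 : 0 ≤ B := (norm_nonneg _).trans (hB 0)
  have havg : ∀ r : ℝ, 0 < r → Tendsto (fun n => ∫⁻ x in Metric.ball 0 R,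
      ‖avg r (fn (z n)) x‖ₑ ^ (2 : ℝ)) atTop (𝓝 0) := by
    intro r hr
    set c : ℝ := (√(r ^ d * (volume (Metric.ball (0 : Space d) 1)).toReal))⁻¹ with hc
    have := tendsto_lintegral_of_dominated_convergence (μ := volume.restrict (Metric.ball 0 R))
      (F := fun n x => ‖avg r (fn (z n)) x‖ₑ ^ (2 : ℝ)) (f := fun _ => 0)
      (fun _ => ENNReal.ofReal (c * B) ^ (2 : ℝ))
      (fun n => ((stronglyMeasurable_avg (Lp.stronglyMeasurable _) hr).enorm.pow_const _))
      (fun n => Eventually.of_forall fun x => ?_) ?_ (Eventually.of_forall fun x => ?_)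
    · simpa using this
    · refine ENNReal.rpow_le_rpow ?_ (by norm_num)
      rw [← ofReal_norm]
      refine ENNReal.ofReal_le_ofReal ((norm_avg_le (z n) hr x).trans ?_)
      gcongr
      exact hB n
    · simp only [lintegral_const, Measure.restrict_apply_univ]
      exact ENNReal.mul_ne_top (ENNReal.rpow_ne_top_of_nonneg (by norm_num) ENNReal.ofReal_ne_top)
        measure_ball_lt_top.ne
    · have h1 := (h (avgL hr x)).enorm
      simp only [map_zero, enorm_zero, avgL_apply] at h1
      have h2 := h1.ennrpow_const 2
      simpa using h2
  rw [ENNReal.tendsto_nhds_zero]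
  intro ε hε
  rcases eq_or_ne ε ⊤ with rfl | hε'
  · simp
  have he : 0 < ε.toReal := ENNReal.toReal_pos hε.ne' hε'
  -- With this radius the oscillation around the average costs at most ε/2, uniformly in n. For
  -- fixed r the averages tend to 0 pointwise with a uniform bound, so dominated convergence handles
  -- the rest.
  set r : ℝ := √(ε.toReal) / (2 * (B + 1)) with hrdef
  have hr : 0 < r := by positivity
  have hr2 : 2 * (r ^ 2 * B ^ 2) ≤ ε.toReal / 2 := by
    rw [hrdef, div_pow, Real.sq_sqrt he.le, mul_pow]
    have : B ^ 2 ≤ (B + 1) ^ 2 := by gcongr; linarith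
    rw [div_mul_eq_mul_div, mul_div_assoc', div_le_iff₀ (by positivity)]
    nlinarith
  have hev := (ENNReal.tendsto_nhds_zero.1 (havg r hr)) (ε / 4) (ENNReal.div_pos hε.ne' (by simp))
  filter_upwards [hev] with n hn
  refine (lintegral_ball_le_avg (z n) hr _).trans ?_
  have e1 : 2 * ENNReal.ofReal (r ^ 2 * ‖z n‖ ^ 2) ≤ ε / 2 := by
    have : 2 * ENNReal.ofReal (r ^ 2 * ‖z n‖ ^ 2) = ENNReal.ofReal (2 * (r ^ 2 * ‖z n‖ ^ 2)) := by
      rw [ENNReal.ofReal_mul (p := 2) (by norm_num), ENNReal.ofReal_ofNat]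
    rw [this]
    refine (ENNReal.ofReal_le_ofReal (q := ε.toReal / 2) ?_).trans (le_of_eq ?_)
    · refine le_trans ?_ hr2
      gcongr
      exact hB n
    · rw [ENNReal.ofReal_div_of_pos (by norm_num), ENNReal.ofReal_toReal hε',
        ENNReal.ofReal_ofNat]
  have e2 : 2 * (ε / 4) = ε / 2 := by
    rw [ENNReal.div_eq_inv_mul, ENNReal.div_eq_inv_mul, ← mul_assoc]
    congr 1
    have : (4 : ℝ≥0∞) = 2 * 2 := by norm_num
    rw [this, ENNReal.mul_inv (by simp) (by simp), ← mul_assoc,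
      ENNReal.mul_inv_cancel (by simp) (by simp), one_mul]
  calc _ ≤ ε / 2 + 2 * (ε / 4) := by gcongr
    _ = ε := by rw [e2, ENNReal.add_halves]

/-! ### Uniqueness of the gradient, translations -/

/-- Weak gradients are unique: every component of the gradient integrates to zero against all test
functions. Elements of H¹ may therefore be compared through their L² parts alone. -/
theorem eq_zero_of_fn_eq_zero {d : ℕ} {v : H1 d} (h : fn v = 0) : v = 0 := by
  have hg : grad v = 0 := by
    have h0 : (fn v : Space d → ℂ) =ᵐ[volume] 0 := by
      rw [h]
      exact Lp.coeFn_zero ℂ 2 volume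
    have hi : ∀ i : Fin d, ∀ᵐ x, (grad v x) i = 0 := by
      intro i
      refine ae_eq_zero_of_integral_contDiff_smul_eq_zero (μ := volume) ?_ fun ψ hψ hc => ?_
      · exact ((EuclideanSpace.proj (𝕜 := ℂ) i : EuclideanSpace ℂ (Fin d) →L[ℂ] ℂ).comp_memLp'
          (Lp.memLp (grad v))).locallyIntegrable (by norm_num)
      · have := isWeakGradient_grad v ψ hψ hc i
        rw [integral_congr_ae (g := fun _ => (0 : ℂ)) (by
          filter_upwards [h0] with x hx
          simp [hx])] at this
        simpa using this.symm
    rw [Lp.eq_zero_iff_ae_eq_zero]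
    filter_upwards [ae_all_iff.2 hi] with x hx
    ext i
    exact hx i
  rw [← norm_eq_zero, ← sq_eq_zero_iff, norm_sq_eq, h, hg]
  simp

theorem ext_ae {d : ℕ} {u v : H1 d} (h : (fn u : Space d → ℂ) =ᵐ[volume] fn v) : u = v := by
  rw [← sub_eq_zero]
  exact eq_zero_of_fn_eq_zero (by rw [fn_sub, sub_eq_zero]; exact Lp.ext h)

theorem isWeakGradient_translate {d : ℕ} {u : Space d → ℂ} {g : Space d → EuclideanSpace ℂ (Fin d)}
    (h : IsWeakGradient u g) (y : Space d) :
    IsWeakGradient (fun x => u (x + y)) (fun x => g (x + y)) := by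
  intro ψ hψ hc i
  have key := h (fun x => ψ (x + -y)) (hψ.comp (contDiff_id.add contDiff_const))
    (hc.comp_homeomorph (Homeomorph.addRight (-y))) i
  simp only [fderiv_comp_add_right] at key
  rw [← integral_add_right_eq_self _ y] at key
  nth_rw 2 [← integral_add_right_eq_self _ y] at key
  simpa using key

theorem memLp_translate {d : ℕ} {F : Type*} [NormedAddCommGroup F]
    (f : Lp F 2 (volume : Measure (Space d))) (y : Space d) :
    MemLp (fun x => f (x + y)) 2 volume :=
  (Lp.memLp f).comp_measurePreserving (measurePreserving_add_right volume y)

/-- The translate `x ↦ v (x + y)`. -/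
def shift {d : ℕ} (y : Space d) (v : H1 d) : H1 d :=
  ⟨WithLp.toLp 2 ((memLp_translate (fn v) y).toLp, (memLp_translate (grad v) y).toLp),
    (isWeakGradient_translate (isWeakGradient_grad v) y).congr
      (memLp_translate (fn v) y).coeFn_toLp (memLp_translate (grad v) y).coeFn_toLp⟩

theorem fn_shift_ae {d : ℕ} (y : Space d) (v : H1 d) :
    (fn (shift y v) : Space d → ℂ) =ᵐ[volume] fun x => fn v (x + y) :=
  (memLp_translate (fn v) y).coeFn_toLp

theorem ae_translate {d : ℕ} {F : Type*} {f g : Space d → F} (h : f =ᵐ[volume] g) (y : Space d) :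
    (fun x => f (x + y)) =ᵐ[volume] fun x => g (x + y) :=
  (measurePreserving_add_right volume y).quasiMeasurePreserving.ae_eq_comp h

theorem norm_fn_shift {d : ℕ} (y : Space d) (v : H1 d) : ‖fn (shift y v)‖ = ‖fn v‖ := by
  have : fn (shift y v) = (memLp_translate (fn v) y).toLp := rfl
  rw [this, Lp.norm_toLp, Lp.norm_def]
  congr 1
  exact eLpNorm_comp_measurePreserving (Lp.aestronglyMeasurable (fn v))
    (measurePreserving_add_right volume y)

theorem norm_grad_shift {d : ℕ} (y : Space d) (v : H1 d) : ‖grad (shift y v)‖ = ‖grad v‖ := by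
  have : grad (shift y v) = (memLp_translate (grad v) y).toLp := rfl
  rw [this, Lp.norm_toLp, Lp.norm_def]
  congr 1
  exact eLpNorm_comp_measurePreserving (Lp.aestronglyMeasurable (grad v))
    (measurePreserving_add_right volume y)

theorem norm_shift {d : ℕ} (y : Space d) (v : H1 d) : ‖shift y v‖ = ‖v‖ := by
  rw [← sq_eq_sq₀ (norm_nonneg _) (norm_nonneg _), norm_sq_eq, norm_sq_eq, norm_fn_shift,
    norm_grad_shift]

/-- G is not translation invariant, so the variational inequality must be applied in the original
frame. This identity moves a profile found in a translated frame back there. -/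
theorem shift_sub_shift_neg {d : ℕ} (y : Space d) (u w : H1 d) :
    shift y (u - shift (-y) w) = shift y u - w := by
  apply ext_ae
  have h1 := ae_translate (Lp.coeFn_sub (fn u) (fn (shift (-y) w))) y
  have h2 := ae_translate (fn_shift_ae (-y) w) y
  rw [fn_sub (shift y u) w]
  filter_upwards [fn_shift_ae y (u - shift (-y) w), h1, h2, fn_shift_ae y u,
    Lp.coeFn_sub (fn (shift y u)) (fn w)] with x a1 a2 a3 a4 a5
  rw [a1, a5, fn_sub, a2, Pi.sub_apply, Pi.sub_apply, a3, a4]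
  simp

theorem N_shift {d : ℕ} (α : ℝ) (y : Space d) (v : H1 d) : N α (shift y v) = N α v := by
  unfold N
  rw [← integral_add_right_eq_self (fun x => ‖fn v x‖ ^ (α + 2)) y]
  refine integral_congr_ae ?_
  filter_upwards [fn_shift_ae y v] with x hx
  rw [hx]

theorem avg_shift {d : ℕ} (r : ℝ) (y : Space d) (v : H1 d) :
    avg r (fn (shift y v)) 0 = avg r (fn v) y := by
  rw [avg_congr_ae (fn_shift_ae y v)]
  simp [avg, add_comm]

end

end InversePowerNLS

namespace InversePowerNLS

open MeasureTheory Filter Topology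
open scoped ENNReal NNReal

noncomputable section

/-! ### The potential energy -/

theorem integrableOn_norm_rpow_neg {d : ℕ} (hd : 1 ≤ d) {τ : ℝ} (hτ : τ < d) :
    IntegrableOn (fun x : Space d => ‖x‖ ^ (-τ)) (Metric.ball 0 1) volume := by
  have : Nontrivial (Space d) := by
    have : Nonempty (Fin d) := ⟨⟨0, hd⟩⟩
    infer_instance
  rw [integrableOn_fun_norm_addHaar volume (f := fun t => t ^ (-τ))]
  have h1 : IntegrableOn (fun t : ℝ => t ^ ((d : ℝ) - 1 - τ)) (Set.Ioo 0 1) volume :=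
    (intervalIntegral.integrableOn_Ioo_rpow_iff one_pos).2 (by linarith)
  refine h1.congr_fun (fun t ht => ?_) measurableSet_Ioo
  have ht0 : 0 < t := ht.1
  simp only [finrank_euclideanSpace, Fintype.card_fin, smul_eq_mul]
  rw [← Real.rpow_natCast, ← Real.rpow_add ht0, Nat.cast_sub hd]
  simp [sub_eq_add_neg]

theorem exists_ball_lintegral_lt {d : ℕ} (hd : 1 ≤ d) {τ : ℝ} (hτ : τ < d) {η : ℝ≥0∞} (hη : η ≠ 0) :
    ∃ δ : ℝ, 0 < δ ∧ ∫⁻ x in Metric.ball (0 : Space d) δ, ENNReal.ofReal (‖x‖ ^ (-τ)) < η := by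
  have hfin : ∫⁻ x in Metric.ball (0 : Space d) 1, ENNReal.ofReal (‖x‖ ^ (-τ)) ≠ ⊤ :=
    (integrableOn_norm_rpow_neg hd hτ).lintegral_lt_top.ne
  obtain ⟨m, hm0, hm⟩ := exists_pos_setLIntegral_lt_of_measure_lt hfin hη
  have hlim : Tendsto (fun r : ℝ => ENNReal.ofReal
      (r ^ d * (volume (Metric.ball (0 : Space d) 1)).toReal)) (𝓝[>] 0) (𝓝 0) := by
    have : Continuous fun r : ℝ => ENNReal.ofReal
      (r ^ d * (volume (Metric.ball (0 : Space d) 1)).toReal) :=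
    ENNReal.continuous_ofReal.comp (by fun_prop)
    have h := this.tendsto 0
    rw [zero_pow (by omega), zero_mul, ENNReal.ofReal_zero] at h
    exact h.mono_left nhdsWithin_le_nhds
  have hev := (hlim.eventually_lt_const hm0).and
    ((eventually_mem_nhdsWithin (a := (0 : ℝ)) (s := Set.Ioi 0)).and
      (eventually_nhdsWithin_of_eventually_nhds (eventually_le_nhds (zero_lt_one (α := ℝ)))))
  obtain ⟨δ, h1, h2, h3⟩ := hev.exists
  refine ⟨δ, h2, ?_⟩
  have h2' : 0 < δ := h2
  have := hm (Metric.ball 0 δ) (by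
    refine (Measure.restrict_apply_le _ _).trans_lt ?_
    rwa [volume_ball_real d h2'])
  rwa [Measure.restrict_restrict measurableSet_ball,
    Set.inter_eq_left.2 (Metric.ball_subset_ball h3)] at this

/-- In terms of κ = 1/q the conditions are κ < 1/2, κ > 1/2 - 1/d and 0 < κ < 1/2 - σ/(2d). They are
compatible because σ < 2 and σ < d. -/
theorem exists_sobolev_exponent {d : ℕ} (hd : 1 ≤ d) {σ : ℝ} (hσ : σ < min 2 (d : ℝ))
    (hσ0 : 0 < σ) :
    ∃ q : ℝ, 2 < q ∧ q < 2 + 2 * q / d ∧ σ * (q / (q - 2)) < d := by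
  have hd0 : (0 : ℝ) < d := by exact_mod_cast hd
  have hσ2 : σ < 2 := hσ.trans_le (min_le_left _ _)
  have hσd : σ < d := hσ.trans_le (min_le_right _ _)
  have hlt : max 0 (1 / 2 - 1 / (d : ℝ)) < 1 / 2 - σ / (2 * d) := by
    refine max_lt ?_ ?_
    · rw [sub_pos, div_lt_div_iff₀ (by positivity) (by norm_num)]
      linarith
    · have : σ / (2 * d) < 1 / (d : ℝ) := by
        rw [div_lt_div_iff₀ (by positivity) hd0]
        nlinarith
      linarith
  obtain ⟨κ, h1, h2⟩ := exists_between hlt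
  have hκ0 : 0 < κ := (le_max_left _ _).trans_lt h1
  have hκ1 : 1 / 2 - 1 / (d : ℝ) < κ := (le_max_right _ _).trans_lt h1
  have hκ2 : κ * (2 * d) < d - σ := by
    have : κ * (2 * d) < (1 / 2 - σ / (2 * d)) * (2 * d) := by gcongr
    have e : (1 / 2 - σ / (2 * d)) * (2 * d) = d - σ := by field_simp
    linarith
  have hκ3 : d < 2 + 2 * d * κ := by
    have : (1 / 2 - 1 / (d : ℝ)) * (2 * d) < κ * (2 * d) := by gcongr
    have e : (1 / 2 - 1 / (d : ℝ)) * (2 * d) = d - 2 := by field_simp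
    linarith
  have hκ4 : 2 * κ < 1 := by
    by_contra hcon
    have : 1 * (d : ℝ) ≤ 2 * κ * d := by
      gcongr
      linarith
    linarith
  refine ⟨1 / κ, ?_, ?_, ?_⟩
  · rw [lt_div_iff₀ hκ0]
    linarith
  · have e : 2 + 2 * (1 / κ) / d - 1 / κ = (2 * d * κ + 2 - d) / (κ * d) := by
      field_simp
    have : 0 < (2 * d * κ + 2 - d) / (κ * d) := div_pos (by linarith) (by positivity)
    linarith
  · have e : 1 / κ / (1 / κ - 2) = 1 / (1 - 2 * κ) := by
      have : 1 - 2 * κ ≠ 0 := by linarith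
      field_simp
    rw [e, mul_one_div, div_lt_iff₀ (by linarith)]
    linarith

/-- Hölder with exponents q/(q-2) and q/2: the weight to the power q/(q-2) is integrable near the
origin, so its norm over a small ball is small, while |v|² is controlled in L^{q/2} by Sobolev. -/
theorem exists_ball_potential_le {d : ℕ} (hd : 1 ≤ d) {σ : ℝ} (hσ0 : 0 < σ)
    (hσ : σ < min 2 (d : ℝ)) {ε : ℝ} (hε : 0 < ε) :
    ∃ δ : ℝ, 0 < δ ∧ ∀ v : H1 d, ∫⁻ x in Metric.ball (0 : Space d) δ,
      ENNReal.ofReal (‖x‖ ^ (-σ)) * ‖fn v x‖ₑ ^ (2 : ℝ) ≤ ENNReal.ofReal (ε * ‖v‖ ^ 2) := by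
  obtain ⟨q, hq2, hqd, hσq⟩ := exists_sobolev_exponent hd hσ hσ0
  obtain ⟨C, hC, hS⟩ := exists_eLpNorm_le hd hq2.le hqd
  set s : ℝ := q / (q - 2) with hs
  have hq0 : 0 < q := by linarith
  have hqm : 0 < q - 2 := by linarith
  have hconj : s.HolderConjugate (q / 2) := by
    rw [Real.holderConjugate_iff]
    refine ⟨?_, ?_⟩
    · rw [hs, lt_div_iff₀ hqm]
      linarith
    · rw [hs]
      field_simp
      ring
  have hs0 : 0 < s := hconj.pos
  have hη : (ENNReal.ofReal (ε / (C ^ 2 + 1))) ^ s ≠ 0 := by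
    have : 0 < ENNReal.ofReal (ε / (C ^ 2 + 1)) := ENNReal.ofReal_pos.2 (by positivity)
    exact (ENNReal.rpow_pos this ENNReal.ofReal_ne_top).ne'
  obtain ⟨δ, hδ0, hδ⟩ := exists_ball_lintegral_lt hd hσq hη
  refine ⟨δ, hδ0, fun v => ?_⟩
  have hm1 : Measurable fun x : Space d => ENNReal.ofReal (‖x‖ ^ (-σ)) := by fun_prop
  have hm2 : Measurable fun x : Space d => ‖fn v x‖ₑ ^ (2 : ℝ) :=
    (Lp.stronglyMeasurable (fn v)).enorm.pow_const _
  refine (ENNReal.lintegral_mul_le_Lp_mul_Lq (volume.restrict (Metric.ball (0 : Space d) δ)) hconj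
    hm1.aemeasurable hm2.aemeasurable).trans ?_
  have b1 : (∫⁻ x in Metric.ball (0 : Space d) δ, ENNReal.ofReal (‖x‖ ^ (-σ)) ^ s) ^ (1 / s)
      ≤ ENNReal.ofReal (ε / (C ^ 2 + 1)) := by
    have e : ∀ x : Space d, ENNReal.ofReal (‖x‖ ^ (-σ)) ^ s
        = ENNReal.ofReal (‖x‖ ^ (-(σ * s))) := by
      intro x
      rw [ENNReal.ofReal_rpow_of_nonneg (by positivity) hs0.le, ← Real.rpow_mul (norm_nonneg _)]
      congr 2
      ring
    simp only [e]
    refine (ENNReal.rpow_le_rpow hδ.le (by positivity)).trans (le_of_eq ?_)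
    rw [← ENNReal.rpow_mul, mul_one_div_cancel hs0.ne', ENNReal.rpow_one]
  have b2 : (∫⁻ x in Metric.ball (0 : Space d) δ, (‖fn v x‖ₑ ^ (2 : ℝ)) ^ (q / 2)) ^ (1 / (q / 2))
      ≤ ENNReal.ofReal ((C * ‖v‖) ^ 2) := by
    have e : ∀ x : Space d, (‖fn v x‖ₑ ^ (2 : ℝ)) ^ (q / 2) = ‖fn v x‖ₑ ^ q := by
      intro x
      rw [← ENNReal.rpow_mul]
      congr 1
      ring
    simp only [e]
    have h1 := hS v
    rw [eLpNorm_eq_lintegral_rpow_enorm_toReal (by simpa using hq0) ENNReal.ofReal_ne_top,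
      ENNReal.toReal_ofReal hq0.le] at h1
    have h2 := ENNReal.rpow_le_rpow h1 (z := 2) (by norm_num)
    rw [← ENNReal.rpow_mul] at h2
    have e2 : 1 / q * 2 = 1 / (q / 2) := by field_simp
    rw [e2] at h2
    rw [ENNReal.ofReal_pow (by positivity), ← ENNReal.rpow_two]
    refine le_trans ?_ h2
    exact ENNReal.rpow_le_rpow (setLIntegral_le_lintegral _ _) (by positivity)
  refine (mul_le_mul' b1 b2).trans ?_
  rw [← ENNReal.ofReal_mul (by positivity)]
  apply ENNReal.ofReal_le_ofReal
  rw [mul_pow, ← mul_assoc]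
  gcongr
  rw [div_mul_eq_mul_div, div_le_iff₀ (by positivity)]
  nlinarith

theorem lintegral_potential_split {d : ℕ} {σ δ R : ℝ} (hσ0 : 0 < σ) (hδ0 : 0 < δ) (hR0 : 0 < R)
    {f : Space d → ℝ≥0∞} (hfm : Measurable f) :
    ∫⁻ x, ENNReal.ofReal (‖x‖ ^ (-σ)) * f x
      ≤ (∫⁻ x in Metric.ball 0 δ, ENNReal.ofReal (‖x‖ ^ (-σ)) * f x)
        + (ENNReal.ofReal (δ ^ (-σ)) * (∫⁻ x in Metric.ball 0 R, f x)
        + ENNReal.ofReal (R ^ (-σ)) * ∫⁻ x, f x) := by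
  have hWm : Measurable fun x : Space d => ENNReal.ofReal (‖x‖ ^ (-σ)) * f x :=
    (by fun_prop : Measurable fun x : Space d => ENNReal.ofReal (‖x‖ ^ (-σ))).mul hfm
  have hpt : ∀ x, ENNReal.ofReal (‖x‖ ^ (-σ)) * f x
      ≤ (Metric.ball (0 : Space d) δ).indicator (fun x => ENNReal.ofReal (‖x‖ ^ (-σ)) * f x) x
        + (ENNReal.ofReal (δ ^ (-σ)) * (Metric.ball (0 : Space d) R).indicator f x
        + ENNReal.ofReal (R ^ (-σ)) * f x) := by
    intro x
    by_cases h1 : x ∈ Metric.ball (0 : Space d) δ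
    · rw [Set.indicator_of_mem h1]
      exact le_self_add
    · have hx1 : δ ≤ ‖x‖ := by simpa using h1
      rw [Set.indicator_of_notMem h1, zero_add]
      by_cases h2 : x ∈ Metric.ball (0 : Space d) R
      · rw [Set.indicator_of_mem h2]
        refine le_add_right ?_
        gcongr ENNReal.ofReal ?_ * _
        exact Real.rpow_le_rpow_of_nonpos hδ0 hx1 (by linarith)
      · have hx2 : R ≤ ‖x‖ := by simpa using h2
        refine le_add_left ?_
        gcongr ENNReal.ofReal ?_ * _
        exact Real.rpow_le_rpow_of_nonpos hR0 hx2 (by linarith)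
  refine (lintegral_mono hpt).trans (le_of_eq ?_)
  rw [lintegral_add_left (hWm.indicator measurableSet_ball),
    lintegral_add_left ((hfm.indicator measurableSet_ball).const_mul _),
    lintegral_const_mul' _ _ ENNReal.ofReal_ne_top, lintegral_const_mul' _ _ ENNReal.ofReal_ne_top,
    lintegral_indicator measurableSet_ball, lintegral_indicator measurableSet_ball]

/-- The potential energy is small compared to the `H¹` norm, up to a local `L²` norm. -/
theorem exists_potential_le {d : ℕ} (hd : 1 ≤ d) {σ : ℝ} (hσ0 : 0 < σ)
    (hσ : σ < min 2 (d : ℝ)) {ε : ℝ} (hε : 0 < ε) :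
    ∃ C R : ℝ, 0 ≤ C ∧ ∀ v : H1 d, ∫⁻ x, ENNReal.ofReal (‖x‖ ^ (-σ)) * ‖fn v x‖ₑ ^ (2 : ℝ)
      ≤ ENNReal.ofReal (ε * ‖v‖ ^ 2)
        + ENNReal.ofReal C * ∫⁻ x in Metric.ball 0 R, ‖fn v x‖ₑ ^ (2 : ℝ) := by
  obtain ⟨δ, hδ0, hδ⟩ := exists_ball_potential_le hd hσ0 hσ (half_pos hε)
  obtain ⟨R, hR0, hRσ⟩ : ∃ R : ℝ, 0 < R ∧ R ^ (-σ) = ε / 2 := by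
    refine ⟨(ε / 2) ^ (-(1 / σ)), by positivity, ?_⟩
    rw [← Real.rpow_mul (by positivity)]
    have : -(1 / σ) * -σ = 1 := by field_simp
    rw [this, Real.rpow_one]
  refine ⟨δ ^ (-σ), R, by positivity, fun v => ?_⟩
  have hsplit := lintegral_potential_split hσ0 hδ0 hR0
    (f := fun x => ‖fn v x‖ₑ ^ (2 : ℝ)) ((Lp.stronglyMeasurable (fn v)).enorm.pow_const _)
  refine hsplit.trans ?_
  rw [hRσ, lintegral_enorm_rpow_two, add_left_comm, add_comm (ENNReal.ofReal (ε * ‖v‖ ^ 2))]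
  gcongr
  refine (add_le_add (hδ v) (le_of_eq (ENNReal.ofReal_mul (by positivity)).symm)).trans ?_
  rw [← ENNReal.ofReal_add (by positivity) (by positivity)]
  apply ENNReal.ofReal_le_ofReal
  have : ‖fn v‖ ^ 2 ≤ ‖v‖ ^ 2 := pow_le_pow_left₀ (norm_nonneg _) (norm_fn_le v) 2
  nlinarith

theorem lintegral_potential_lt_top {d : ℕ} (hd : 1 ≤ d) {σ : ℝ} (hσ0 : 0 < σ)
    (hσ : σ < min 2 (d : ℝ)) (v : H1 d) :
    ∫⁻ x, ENNReal.ofReal (‖x‖ ^ (-σ)) * ‖fn v x‖ₑ ^ (2 : ℝ) < ⊤ := by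
  obtain ⟨C, R, -, h⟩ := exists_potential_le hd hσ0 hσ one_pos
  refine (h v).trans_lt (ENNReal.add_lt_top.2 ⟨ENNReal.ofReal_lt_top,
    ENNReal.mul_lt_top ENNReal.ofReal_lt_top ?_⟩)
  refine (setLIntegral_le_lintegral _ _).trans_lt ?_
  rw [lintegral_enorm_rpow_two]
  exact ENNReal.ofReal_lt_top

theorem memLp_weighted {d : ℕ} (hd : 1 ≤ d) {σ : ℝ} (hσ0 : 0 < σ)
    (hσ : σ < min 2 (d : ℝ)) (v : H1 d) :
    MemLp (fun x : Space d => (‖x‖ ^ (-(σ / 2))) • fn v x) 2 volume := by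
  refine ⟨?_, ?_⟩
  · exact ((by fun_prop : Measurable fun x : Space d =>
      ‖x‖ ^ (-(σ / 2))).aestronglyMeasurable).smul (Lp.aestronglyMeasurable _)
  · rw [eLpNorm_lt_top_iff_lintegral_rpow_enorm_lt_top (by simp) (by simp)]
    refine lt_of_eq_of_lt ?_ (lintegral_potential_lt_top hd hσ0 hσ v)
    refine lintegral_congr fun x => ?_
    rw [enorm_smul, ENNReal.mul_rpow_of_nonneg _ _ (by simp)]
    congr 1
    rw [Real.enorm_of_nonneg (by positivity),
      ENNReal.ofReal_rpow_of_nonneg (by positivity) (by simp),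
      ← Real.rpow_mul (norm_nonneg _)]
    congr 2
    simp

theorem norm_toLp_weighted_sq {d : ℕ} (hd : 1 ≤ d) {σ : ℝ} (hσ0 : 0 < σ)
    (hσ : σ < min 2 (d : ℝ)) (v : H1 d) :
    ‖(memLp_weighted hd hσ0 hσ v).toLp‖ ^ 2 = G σ v := by
  have h1 : (‖(memLp_weighted hd hσ0 hσ v).toLp‖ ^ 2 : ℝ)
      = ∫ x, ‖(MemLp.toLp _ (memLp_weighted hd hσ0 hσ v)) x‖ ^ 2 := by
    rw [← real_inner_self_eq_norm_sq, L2.inner_def]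
    simp only [real_inner_self_eq_norm_sq]
  rw [h1, G]
  refine integral_congr_ae ?_
  filter_upwards [(memLp_weighted hd hσ0 hσ v).coeFn_toLp] with x hx
  rw [hx, norm_smul, mul_pow, Real.norm_of_nonneg (by positivity), ← Real.rpow_natCast,
    ← Real.rpow_mul (norm_nonneg _)]
  congr 2
  simp

theorem ofReal_G {d : ℕ} (hd : 1 ≤ d) {σ : ℝ} (hσ0 : 0 < σ)
    (hσ : σ < min 2 (d : ℝ)) (v : H1 d) :
    ENNReal.ofReal (G σ v) = ∫⁻ x, ENNReal.ofReal (‖x‖ ^ (-σ)) * ‖fn v x‖ₑ ^ (2 : ℝ) := by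
  rw [← norm_toLp_weighted_sq hd hσ0 hσ, ← lintegral_enorm_rpow_two]
  refine lintegral_congr_ae ?_
  filter_upwards [(memLp_weighted hd hσ0 hσ v).coeFn_toLp] with x hx
  rw [hx, enorm_smul, ENNReal.mul_rpow_of_nonneg _ _ (by simp)]
  congr 1
  rw [Real.enorm_of_nonneg (by positivity), ENNReal.ofReal_rpow_of_nonneg (by positivity) (by simp),
    ← Real.rpow_mul (norm_nonneg _)]
  congr 2
  simp

theorem G_nonneg {d : ℕ} {σ : ℝ} (v : H1 d) : 0 ≤ G σ v := integral_nonneg fun x => by positivity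

/-- The potential energy is infinitesimally bounded with respect to the kinetic energy. -/
theorem exists_G_le {d : ℕ} (hd : 1 ≤ d) {σ : ℝ} (hσ0 : 0 < σ)
    (hσ : σ < min 2 (d : ℝ)) {ε : ℝ} (hε : 0 < ε) :
    ∃ C : ℝ, 0 ≤ C ∧ ∀ v : H1 d, G σ v ≤ ε * ‖v‖ ^ 2 + C * ‖fn v‖ ^ 2 := by
  obtain ⟨C, R, hC, h⟩ := exists_potential_le hd hσ0 hσ hε
  refine ⟨C, hC, fun v => ?_⟩
  have h1 := h v
  rw [← ofReal_G hd hσ0 hσ] at h1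
  have h2 : ENNReal.ofReal (G σ v) ≤ ENNReal.ofReal (ε * ‖v‖ ^ 2 + C * ‖fn v‖ ^ 2) := by
    refine h1.trans ?_
    rw [ENNReal.ofReal_add (by positivity) (by positivity), ENNReal.ofReal_mul hC,
      ← lintegral_enorm_rpow_two]
    gcongr
    exact Measure.restrict_le_self
  exact (ENNReal.ofReal_le_ofReal_iff (by positivity)).1 h2

theorem exists_G_le_norm {d : ℕ} (hd : 1 ≤ d) {σ : ℝ} (hσ0 : 0 < σ)
    (hσ : σ < min 2 (d : ℝ)) : ∃ C : ℝ, 0 ≤ C ∧ ∀ v : H1 d, G σ v ≤ C * ‖v‖ ^ 2 := by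
  obtain ⟨C, hC, h⟩ := exists_G_le hd hσ0 hσ one_pos
  refine ⟨1 + C, by positivity, fun v => (h v).trans ?_⟩
  have : C * ‖fn v‖ ^ 2 ≤ C * ‖v‖ ^ 2 := by
    gcongr
    exact norm_fn_le v
  linarith

/-- The potential is a compact perturbation: near the origin and near infinity it is small relative
to the H¹ norm, and Rellich handles the remaining local L² term. -/
theorem WeakTendsto.tendsto_G {d : ℕ} (hd : 1 ≤ d) {σ : ℝ} (hσ0 : 0 < σ)
    (hσ : σ < min 2 (d : ℝ)) {z : ℕ → H1 d} (h : WeakTendsto z 0) {B : ℝ}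
    (hB : ∀ n, ‖z n‖ ≤ B) : Tendsto (fun n => G σ (z n)) atTop (𝓝 0) := by
  have hB0 : 0 ≤ B := (norm_nonneg _).trans (hB 0)
  have key : Tendsto (fun n => ENNReal.ofReal (G σ (z n))) atTop (𝓝 0) := by
    rw [ENNReal.tendsto_nhds_zero]
    intro ε hε
    rcases eq_or_ne ε ⊤ with rfl | hε'
    · simp
    have he : 0 < ε.toReal := ENNReal.toReal_pos hε.ne' hε'
    obtain ⟨C, R, hC, hle⟩ := exists_potential_le hd hσ0 hσ
      (ε := ε.toReal / (2 * (B ^ 2 + 1))) (by positivity)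
    have h1 := ENNReal.Tendsto.const_mul (a := ENNReal.ofReal C) (h.tendsto_lintegral_ball hB R)
      (Or.inr ENNReal.ofReal_ne_top)
    rw [mul_zero] at h1
    filter_upwards [ENNReal.tendsto_nhds_zero.1 h1 (ε / 2) (ENNReal.half_pos hε.ne')] with n hn
    rw [ofReal_G hd hσ0 hσ]
    refine (hle (z n)).trans ((add_le_add ?_ hn).trans (ENNReal.add_halves ε).le)
    have : ε / 2 = ENNReal.ofReal (ε.toReal / 2) := by
      rw [ENNReal.ofReal_div_of_pos (by norm_num), ENNReal.ofReal_toReal hε', ENNReal.ofReal_ofNat]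
    rw [this]
    apply ENNReal.ofReal_le_ofReal
    have h2 : ‖z n‖ ^ 2 ≤ B ^ 2 + 1 := by
      have : ‖z n‖ ^ 2 ≤ B ^ 2 := pow_le_pow_left₀ (norm_nonneg _) (hB n) 2
      linarith
    calc ε.toReal / (2 * (B ^ 2 + 1)) * ‖z n‖ ^ 2
        ≤ ε.toReal / (2 * (B ^ 2 + 1)) * (B ^ 2 + 1) := by gcongr
      _ = ε.toReal / 2 := by field_simp
  have := (ENNReal.tendsto_toReal (by simp)).comp key
  simpa [Function.comp_def, ENNReal.toReal_ofReal, G_nonneg] using this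

theorem G_pos {d : ℕ} (hd : 1 ≤ d) {σ : ℝ} (hσ0 : 0 < σ)
    (hσ : σ < min 2 (d : ℝ)) {v : H1 d} (hv : v ≠ 0) : 0 < G σ v := by
  refine lt_of_le_of_ne (G_nonneg v) fun h0 => hv ?_
  have h1 := ofReal_G hd hσ0 hσ v
  have hm : Measurable fun x : Space d => ENNReal.ofReal (‖x‖ ^ (-σ)) * ‖fn v x‖ₑ ^ (2 : ℝ) :=
    (by fun_prop : Measurable fun x : Space d => ENNReal.ofReal (‖x‖ ^ (-σ))).mul
      ((Lp.stronglyMeasurable (fn v)).enorm.pow_const _)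
  rw [← h0, ENNReal.ofReal_zero, eq_comm, lintegral_eq_zero_iff hm] at h1
  have : Nontrivial (Space d) := by
    have : Nonempty (Fin d) := ⟨⟨0, hd⟩⟩
    infer_instance
  apply eq_zero_of_fn_eq_zero
  rw [Lp.eq_zero_iff_ae_eq_zero]
  -- The origin must be discarded, since the real power `0 ^ (-σ)` is 0 by convention and the weight
  -- is positive only elsewhere.
  have hne : ∀ᵐ x : Space d, x ≠ 0 := by
    simp [ae_iff]
  filter_upwards [h1, hne] with x hx hx0
  have h2 : 0 < ‖x‖ := norm_pos_iff.2 hx0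
  have h3 : 0 < ‖x‖ ^ (-σ) := by positivity
  simpa [h3.not_ge] using hx

/-! ### The potential energy as the squared norm of a bounded operator -/

theorem toLp_weighted_add {d : ℕ} (hd : 1 ≤ d) {σ : ℝ} (hσ0 : 0 < σ)
    (hσ : σ < min 2 (d : ℝ)) (u v : H1 d) : (memLp_weighted hd hσ0 hσ (u + v)).toLp
    = (memLp_weighted hd hσ0 hσ u).toLp + (memLp_weighted hd hσ0 hσ v).toLp := by
  apply Lp.ext
  filter_upwards [Lp.coeFn_add (fn u) (fn v), (memLp_weighted hd hσ0 hσ (u + v)).coeFn_toLp,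
    (memLp_weighted hd hσ0 hσ u).coeFn_toLp, (memLp_weighted hd hσ0 hσ v).coeFn_toLp,
    Lp.coeFn_add (memLp_weighted hd hσ0 hσ u).toLp (memLp_weighted hd hσ0 hσ v).toLp]
    with x h1 h2 h3 h4 h5
  rw [h2, h5, Pi.add_apply, h3, h4, fn_add, h1, Pi.add_apply, smul_add]

theorem toLp_weighted_smul {d : ℕ} (hd : 1 ≤ d) {σ : ℝ} (hσ0 : 0 < σ)
    (hσ : σ < min 2 (d : ℝ)) (c : ℂ) (v : H1 d) : (memLp_weighted hd hσ0 hσ (c • v)).toLp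
    = c • (memLp_weighted hd hσ0 hσ v).toLp := by
  apply Lp.ext
  filter_upwards [Lp.coeFn_smul c (fn v), (memLp_weighted hd hσ0 hσ (c • v)).coeFn_toLp,
    (memLp_weighted hd hσ0 hσ v).coeFn_toLp,
    Lp.coeFn_smul c (memLp_weighted hd hσ0 hσ v).toLp] with x h1 h2 h3 h4
  rw [h2, h4, Pi.smul_apply, h3, fn_smul, h1, Pi.smul_apply, smul_comm]

theorem exists_norm_toLp_weighted_le {d : ℕ} (hd : 1 ≤ d) {σ : ℝ} (hσ0 : 0 < σ)
    (hσ : σ < min 2 (d : ℝ)) : ∃ C : ℝ, ∀ v : H1 d,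
    ‖(memLp_weighted hd hσ0 hσ v).toLp‖ ≤ C * ‖v‖ := by
  obtain ⟨C, hC, h⟩ := exists_G_le_norm hd hσ0 hσ
  refine ⟨√C, fun v => le_of_sq_le_sq ?_ (by positivity)⟩
  rw [mul_pow, Real.sq_sqrt hC, norm_toLp_weighted_sq hd hσ0 hσ]
  exact h v

/-- Multiplication by `|x|^{-σ/2}`, as a bounded operator from `H¹` to `L²`. -/
def weightL {d : ℕ} (hd : 1 ≤ d) {σ : ℝ} (hσ0 : 0 < σ)
    (hσ : σ < min 2 (d : ℝ)) : H1 d →L[ℂ] Lp ℂ 2 (volume : Measure (Space d)) :=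
  LinearMap.mkContinuousOfExistsBound
    { toFun := fun v => (memLp_weighted hd hσ0 hσ v).toLp
      map_add' := toLp_weighted_add hd hσ0 hσ
      map_smul' := toLp_weighted_smul hd hσ0 hσ } (exists_norm_toLp_weighted_le hd hσ0 hσ)

theorem norm_weightL_sq {d : ℕ} (hd : 1 ≤ d) {σ : ℝ} (hσ0 : 0 < σ)
    (hσ : σ < min 2 (d : ℝ)) (v : H1 d) : ‖weightL hd hσ0 hσ v‖ ^ 2 = G σ v :=
  norm_toLp_weighted_sq hd hσ0 hσ v

end

end InversePowerNLS

namespace InversePowerNLS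

open MeasureTheory Filter Topology
open scoped ENNReal NNReal

noncomputable section

/-! ### The nonlinear term -/

/-- The `L^{α+2}` norm over the set `s`. -/
def lpNormOn {d : ℕ} (α : ℝ) (s : Set (Space d)) (v : H1 d) : ℝ :=
  (eLpNorm (fn v) (ENNReal.ofReal (α + 2)) (volume.restrict s)).toReal

/-- The exponent `α + 2` is superlinear and `H¹`-subcritical. -/
structure Subcritical (d : ℕ) (α : ℝ) : Prop where
  one_le : 1 ≤ d
  pos : 0 < α
  lt : α + 2 < 2 + 2 * (α + 2) / d

theorem lpNormOn_nonneg {d : ℕ} {α : ℝ} (s : Set (Space d)) (v : H1 d) : 0 ≤ lpNormOn α s v :=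
  ENNReal.toReal_nonneg

namespace Subcritical

theorem exists_eLpNorm_le {d : ℕ} {α : ℝ} (h : Subcritical d α) :
    ∃ C : ℝ, 0 ≤ C ∧ ∀ v : H1 d,
    eLpNorm (fn v) (ENNReal.ofReal (α + 2)) volume ≤ ENNReal.ofReal (C * ‖v‖) :=
  InversePowerNLS.exists_eLpNorm_le h.one_le (by linarith [h.pos]) h.lt

theorem memLp {d : ℕ} {α : ℝ} (h : Subcritical d α)
    (v : H1 d) : MemLp (fn v) (ENNReal.ofReal (α + 2)) volume := by
  obtain ⟨C, -, hC⟩ := h.exists_eLpNorm_le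
  exact ⟨Lp.aestronglyMeasurable _, (hC v).trans_lt ENNReal.ofReal_lt_top⟩

theorem integrable {d : ℕ} {α : ℝ} (h : Subcritical d α)
    (v : H1 d) : Integrable (fun x => ‖fn v x‖ ^ (α + 2)) volume := by
  have hp : 0 < α + 2 := by linarith [h.pos]
  have := (h.memLp v).integrable_norm_rpow (by simpa using hp) ENNReal.ofReal_ne_top
  rwa [ENNReal.toReal_ofReal hp.le] at this

theorem lpNormOn_rpow {d : ℕ} {α : ℝ} (h : Subcritical d α)
    (s : Set (Space d)) (v : H1 d) :
    lpNormOn α s v ^ (α + 2) = ∫ x in s, ‖fn v x‖ ^ (α + 2) := by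
  have hp : 0 < α + 2 := by linarith [h.pos]
  have h0 : 0 ≤ ∫ x in s, ‖fn v x‖ ^ (α + 2) := integral_nonneg fun x => by positivity
  have h1 := ((h.memLp v).restrict s).eLpNorm_eq_integral_rpow_norm (by simpa using hp)
    ENNReal.ofReal_ne_top
  rw [ENNReal.toReal_ofReal hp.le] at h1
  rw [lpNormOn, h1, ENNReal.toReal_ofReal (by positivity), ← Real.rpow_mul h0,
    inv_mul_cancel₀ hp.ne', Real.rpow_one]

theorem N_eq_univ {d : ℕ} {α : ℝ} (h : Subcritical d α)
    (v : H1 d) : N α v = lpNormOn α Set.univ v ^ (α + 2) := by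
  rw [h.lpNormOn_rpow, setIntegral_univ, N]

theorem N_eq_add {d : ℕ} {α : ℝ} (h : Subcritical d α)
    {s : Set (Space d)} (hs : MeasurableSet s) (v : H1 d) :
    N α v = lpNormOn α s v ^ (α + 2) + lpNormOn α sᶜ v ^ (α + 2) := by
  rw [h.lpNormOn_rpow, h.lpNormOn_rpow, integral_add_compl hs (h.integrable v), N]

theorem lpNormOn_add_le {d : ℕ} {α : ℝ} (h : Subcritical d α)
    (s : Set (Space d)) (u v : H1 d) :
    lpNormOn α s (u + v) ≤ lpNormOn α s u + lpNormOn α s v := by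
  have hu := (h.memLp u).restrict s
  have hv := (h.memLp v).restrict s
  have hp : 1 ≤ ENNReal.ofReal (α + 2) := by
    rw [ENNReal.one_le_ofReal]
    linarith [h.pos]
  have e : (fn (u + v) : Space d → ℂ) =ᵐ[volume.restrict s] fn u + fn v :=
    ae_restrict_of_ae (Lp.coeFn_add _ _)
  rw [lpNormOn, lpNormOn, lpNormOn, ← ENNReal.toReal_add hu.2.ne hv.2.ne, eLpNorm_congr_ae e]
  exact ENNReal.toReal_mono (ENNReal.add_ne_top.2 ⟨hu.2.ne, hv.2.ne⟩)
    (eLpNorm_add_le hu.1 hv.1 hp)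

theorem lpNormOn_smul {d : ℕ} {α : ℝ} (s : Set (Space d)) (c : ℝ) (v : H1 d) :
    lpNormOn α s (c • v) = |c| * lpNormOn α s v := by
  have e : (fn (c • v) : Space d → ℂ) =ᵐ[volume.restrict s] c • (fn v : Space d → ℂ) :=
    ae_restrict_of_ae (Lp.coeFn_smul c (fn v))
  rw [lpNormOn, lpNormOn, eLpNorm_congr_ae e, eLpNorm_const_smul, ENNReal.toReal_mul]
  simp

theorem lpNormOn_neg {d : ℕ} {α : ℝ} (s : Set (Space d)) (v : H1 d) :
    lpNormOn α s (-v) = lpNormOn α s v := by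
  have := lpNormOn_smul (α := α) s (-1) v
  simpa using this

theorem abs_lpNormOn_sub_le {d : ℕ} {α : ℝ} (h : Subcritical d α)
    (s : Set (Space d)) (u v : H1 d) :
    |lpNormOn α s u - lpNormOn α s v| ≤ lpNormOn α s (u - v) := by
  rw [abs_le]
  have h1 := h.lpNormOn_add_le s (u - v) v
  have h2 := h.lpNormOn_add_le s (-(u - v)) u
  rw [lpNormOn_neg] at h2
  simp only [sub_add_cancel, neg_sub] at h1 h2
  constructor <;> linarith

theorem exists_lpNormOn_le {d : ℕ} {α : ℝ} (h : Subcritical d α) :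
    ∃ C : ℝ, 0 ≤ C ∧ ∀ (s : Set (Space d)) (v : H1 d),
    lpNormOn α s v ≤ C * ‖v‖ := by
  obtain ⟨C, hC0, hC⟩ := h.exists_eLpNorm_le
  refine ⟨C, hC0, fun s v => ?_⟩
  refine ENNReal.toReal_le_of_le_ofReal (by positivity) (le_trans ?_ (hC v))
  exact eLpNorm_mono_measure _ Measure.restrict_le_self

theorem N_smul {d : ℕ} {α : ℝ} (h : Subcritical d α)
    (c : ℝ) (v : H1 d) : N α (c • v) = |c| ^ (α + 2) * N α v := by
  rw [h.N_eq_univ, h.N_eq_univ, lpNormOn_smul,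
    Real.mul_rpow (abs_nonneg _) (lpNormOn_nonneg _ _)]

theorem N_nonneg {d : ℕ} {α : ℝ} (v : H1 d) : 0 ≤ N α v := integral_nonneg fun x => by positivity

theorem N_pos {d : ℕ} {α : ℝ} (h : Subcritical d α)
    {v : H1 d} (hv : v ≠ 0) : 0 < N α v := by
  have hp : 0 < α + 2 := by linarith [h.pos]
  refine lt_of_le_of_ne (N_nonneg v) fun h0 => hv ?_
  rw [N, eq_comm, integral_eq_zero_iff_of_nonneg (fun x => by positivity) (h.integrable v)] at h0
  apply eq_zero_of_fn_eq_zero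
  rw [Lp.eq_zero_iff_ae_eq_zero]
  filter_upwards [h0] with x hx
  simpa [Real.rpow_eq_zero (norm_nonneg _) hp.ne'] using hx

/-- Midpoint convexity of N, from the triangle inequality and convexity of t ↦ t^{α+2}. It will
stand in for differentiability of N when critical points are produced. -/
theorem two_mul_N_le {d : ℕ} {α : ℝ} (h : Subcritical d α)
    (u w : H1 d) : 2 * N α u ≤ N α (u + w) + N α (u - w) := by
  have hp : 1 ≤ α + 2 := by linarith [h.pos]
  have h1 := h.lpNormOn_add_le Set.univ (u + w) (u - w)
  have e : u + w + (u - w) = (2 : ℝ) • u := by rw [two_smul]; abel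
  rw [e, lpNormOn_smul, abs_two] at h1
  rw [h.N_eq_univ, h.N_eq_univ, h.N_eq_univ]
  have hcv := (convexOn_rpow hp).2
  have hc := hcv (lpNormOn_nonneg (α := α) Set.univ (u + w))
    (lpNormOn_nonneg (α := α) Set.univ (u - w)) (by norm_num : (0 : ℝ) ≤ 1 / 2)
    (by norm_num : (0 : ℝ) ≤ 1 / 2) (by norm_num)
  simp only [smul_eq_mul] at hc
  have hm : lpNormOn α Set.univ u ^ (α + 2) ≤ (1 / 2 * lpNormOn α Set.univ (u + w)
      + 1 / 2 * lpNormOn α Set.univ (u - w)) ^ (α + 2) :=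
    Real.rpow_le_rpow (lpNormOn_nonneg _ _) (by linarith) (by linarith)
  linarith

theorem ofReal_setIntegral {d : ℕ} {α : ℝ} (h : Subcritical d α)
    (s : Set (Space d)) (v : H1 d) :
    ENNReal.ofReal (lpNormOn α s v ^ (α + 2)) = ∫⁻ x in s, ‖fn v x‖ₑ ^ (α + 2) := by
  rw [h.lpNormOn_rpow, ofReal_integral_eq_lintegral_ofReal (h.integrable v).integrableOn
    (Eventually.of_forall fun x => by positivity)]
  refine lintegral_congr fun x => ?_
  rw [← ofReal_norm, ENNReal.ofReal_rpow_of_nonneg (norm_nonneg _) (by linarith [h.pos])]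

end Subcritical

/-! ### Interpolation, Brezis–Lieb splitting and nonvanishing -/

theorem exists_rpow_le_add {p q : ℝ} (hp : 2 < p) (hq : p < q) {ε : ℝ} (hε : 0 < ε) :
    ∃ C : ℝ, 0 ≤ C ∧ ∀ t : ℝ, 0 ≤ t → t ^ p ≤ C * t ^ (2 : ℝ) + ε * t ^ q := by
  have hqp : 0 < q - p := by linarith
  -- Threshold with T^{p-q} = ε: below T the power t² dominates t^p with constant T^{p-2}, above T
  -- the power t^q does with constant ε.
  set T : ℝ := ε ^ (-(1 / (q - p))) with hT
  have hT0 : 0 < T := by positivity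
  have hTε : T ^ (p - q) = ε := by
    rw [hT, ← Real.rpow_mul hε.le]
    have : -(1 / (q - p)) * (p - q) = 1 := by
      field_simp
      ring
    rw [this, Real.rpow_one]
  refine ⟨T ^ (p - 2), by positivity, fun t ht => ?_⟩
  rcases ht.eq_or_lt with rfl | ht0
  · rw [Real.zero_rpow (by linarith), Real.zero_rpow (by norm_num), Real.zero_rpow (by linarith)]
    simp
  rcases le_total t T with h | h
  · have e : t ^ p = t ^ (p - 2) * t ^ (2 : ℝ) := by
      rw [← Real.rpow_add ht0]
      congr 1
      ring
    have : t ^ (p - 2) ≤ T ^ (p - 2) := Real.rpow_le_rpow ht h (by linarith)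
    rw [e]
    have h2 : 0 ≤ ε * t ^ q := by positivity
    have h3 : 0 ≤ t ^ (2 : ℝ) := by positivity
    nlinarith [mul_le_mul_of_nonneg_right this h3]
  · have e : t ^ p = t ^ (p - q) * t ^ q := by
      rw [← Real.rpow_add ht0]
      congr 1
      ring
    have : t ^ (p - q) ≤ T ^ (p - q) := Real.rpow_le_rpow_of_nonpos hT0 h (by linarith)
    rw [hTε] at this
    rw [e]
    have h2 : 0 ≤ T ^ (p - 2) * t ^ (2 : ℝ) := by positivity
    have h3 : 0 ≤ t ^ q := by positivity
    nlinarith [mul_le_mul_of_nonneg_right this h3]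

theorem enorm_rpow_le_add {p q C ε : ℝ} (hp : 2 < p) (hq : p < q) (hε : 0 < ε) (hC : 0 ≤ C)
    (h : ∀ t : ℝ, 0 ≤ t → t ^ p ≤ C * t ^ (2 : ℝ) + ε * t ^ q) (z : ℂ) :
    ‖z‖ₑ ^ p ≤ ENNReal.ofReal C * ‖z‖ₑ ^ (2 : ℝ) + ENNReal.ofReal ε * ‖z‖ₑ ^ q := by
  rw [← ofReal_norm, ENNReal.ofReal_rpow_of_nonneg (norm_nonneg _) (by linarith),
    ENNReal.ofReal_rpow_of_nonneg (norm_nonneg _) (by norm_num),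
    ENNReal.ofReal_rpow_of_nonneg (norm_nonneg _) (by linarith), ← ENNReal.ofReal_mul hC,
    ← ENNReal.ofReal_mul hε.le, ← ENNReal.ofReal_add (by positivity) (by positivity)]
  exact ENNReal.ofReal_le_ofReal (h _ (norm_nonneg _))

namespace Subcritical

/-- Strict subcriticality leaves room for an exponent q > α + 2 with H¹ control. Interpolation
between L² and L^q then upgrades L² information to L^{α+2}. -/
theorem exists_higher_exponent {d : ℕ} {α : ℝ} (h : Subcritical d α) :
    ∃ q : ℝ, α + 2 < q ∧ ∀ B : ℝ, ∃ C : ℝ, 0 ≤ C ∧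
    ∀ v : H1 d, ‖v‖ ≤ B → ∫⁻ x, ‖fn v x‖ₑ ^ q ≤ ENNReal.ofReal C := by
  have hd0 : (0 : ℝ) < d := by exact_mod_cast h.one_le
  obtain ⟨q, hq1, hq2⟩ := exists_between h.lt
  have hα := h.pos
  have hq0 : 0 < q := by linarith
  have hqd : q < 2 + 2 * q / d := hq2.trans_le (by gcongr)
  refine ⟨q, hq1, fun B => ?_⟩
  obtain ⟨C, hC0, hC⟩ := InversePowerNLS.exists_eLpNorm_le h.one_le (by linarith) hqd
  refine ⟨(C * max B 0) ^ q, by positivity, fun v hv => ?_⟩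
  have h1 := (hC v).trans (ENNReal.ofReal_le_ofReal
    (mul_le_mul_of_nonneg_left (hv.trans (le_max_left B 0)) hC0))
  rw [eLpNorm_eq_lintegral_rpow_enorm_toReal (by simpa using hq0) ENNReal.ofReal_ne_top,
    ENNReal.toReal_ofReal hq0.le] at h1
  have h2 := ENNReal.rpow_le_rpow h1 hq0.le
  rwa [← ENNReal.rpow_mul, one_div, inv_mul_cancel₀ hq0.ne', ENNReal.rpow_one,
    ENNReal.ofReal_rpow_of_nonneg (by positivity) hq0.le] at h2

/-- Weak convergence in `H¹` implies convergence in `L^{α+2}_loc`. -/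
theorem tendsto_lpNormOn_ball {d : ℕ} {α : ℝ} (h : Subcritical d α)
    {z : ℕ → H1 d} (hz : WeakTendsto z 0) {B : ℝ}
    (hB : ∀ n, ‖z n‖ ≤ B) (R : ℝ) :
    Tendsto (fun n => lpNormOn α (Metric.ball 0 R) (z n)) atTop (𝓝 0) := by
  have hα := h.pos
  have hp : 0 < α + 2 := by linarith
  obtain ⟨q, hq, hqB⟩ := h.exists_higher_exponent
  obtain ⟨D, hD0, hD⟩ := hqB B
  have key : Tendsto (fun n => ENNReal.ofReal
      (lpNormOn α (Metric.ball 0 R) (z n) ^ (α + 2))) atTop (𝓝 0) := by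
    simp only [h.ofReal_setIntegral]
    rw [ENNReal.tendsto_nhds_zero]
    intro ε hε
    rcases eq_or_ne ε ⊤ with rfl | hε'
    · simp
    have he : 0 < ε.toReal := ENNReal.toReal_pos hε.ne' hε'
    have he' : 0 < ε.toReal / (2 * (D + 1)) := by positivity
    obtain ⟨C, hC0, hC⟩ := exists_rpow_le_add (by linarith : 2 < α + 2) hq he'
    have h1 := ENNReal.Tendsto.const_mul (a := ENNReal.ofReal C) (hz.tendsto_lintegral_ball hB R)
      (Or.inr ENNReal.ofReal_ne_top)
    rw [mul_zero] at h1
    filter_upwards [ENNReal.tendsto_nhds_zero.1 h1 (ε / 2) (ENNReal.half_pos hε.ne')] with n hn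
    have hm : Measurable fun x : Space d => ENNReal.ofReal C * ‖fn (z n) x‖ₑ ^ (2 : ℝ) :=
      ((Lp.stronglyMeasurable (fn (z n))).enorm.pow_const _).const_mul _
    refine (lintegral_mono fun x =>
      enorm_rpow_le_add (by linarith) hq he' hC0 hC (fn (z n) x)).trans ?_
    rw [lintegral_add_left hm, lintegral_const_mul' _ _ ENNReal.ofReal_ne_top,
      lintegral_const_mul' _ _ ENNReal.ofReal_ne_top]
    refine (add_le_add hn ?_).trans (ENNReal.add_halves ε).le
    refine (mul_le_mul_right ((setLIntegral_le_lintegral _ _).trans (hD (z n) (hB n))) _).trans ?_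
    have : ε / 2 = ENNReal.ofReal (ε.toReal / 2) := by
      rw [ENNReal.ofReal_div_of_pos (by norm_num), ENNReal.ofReal_toReal hε', ENNReal.ofReal_ofNat]
    rw [this, ← ENNReal.ofReal_mul he'.le]
    apply ENNReal.ofReal_le_ofReal
    calc ε.toReal / (2 * (D + 1)) * D ≤ ε.toReal / (2 * (D + 1)) * (D + 1) := by gcongr; linarith
      _ = ε.toReal / 2 := by field_simp
  have h2 := (ENNReal.tendsto_toReal (by simp)).comp key
  have h3 : Tendsto (fun n => lpNormOn α (Metric.ball 0 R) (z n) ^ (α + 2)) atTop (𝓝 0) := by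
    refine h2.congr fun n => ?_
    exact ENNReal.toReal_ofReal (Real.rpow_nonneg (lpNormOn_nonneg _ _) _)
  have h4 := h3.rpow_const (p := 1 / (α + 2)) (Or.inr (by positivity))
  rw [Real.zero_rpow (by positivity)] at h4
  refine h4.congr fun n => ?_
  rw [← Real.rpow_mul (lpNormOn_nonneg _ _), mul_one_div_cancel hp.ne', Real.rpow_one]

theorem tendsto_lpNormOn_compl_ball {d : ℕ} {α : ℝ} (h : Subcritical d α)
    (w : H1 d) :
    Tendsto (fun n : ℕ => lpNormOn α (Metric.ball 0 (n : ℝ))ᶜ w) atTop (𝓝 0) := by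
  have hα := h.pos
  have hp : 0 < α + 2 := by linarith
  have hU : (⋃ n : ℕ, Metric.ball (0 : Space d) (n : ℝ)) = Set.univ := Metric.iUnion_ball_nat 0
  have h1 := tendsto_setIntegral_of_monotone (μ := volume)
    (s := fun n : ℕ => Metric.ball (0 : Space d) (n : ℝ)) (f := fun x => ‖fn w x‖ ^ (α + 2))
    (fun n => measurableSet_ball) (fun m n hmn => Metric.ball_subset_ball (by exact_mod_cast hmn))
    (h.integrable w).integrableOn
  rw [hU, setIntegral_univ] at h1
  have h2 := h1.const_sub (N α w)
  have h3 : Tendsto (fun n : ℕ => lpNormOn α (Metric.ball 0 (n : ℝ))ᶜ w ^ (α + 2)) atTop (𝓝 0) := by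
    rw [N, sub_self] at h2
    refine h2.congr fun n => ?_
    have := h.N_eq_add (measurableSet_ball (x := (0 : Space d)) (ε := (n : ℝ))) w
    rw [h.lpNormOn_rpow (Metric.ball 0 (n : ℝ)) w, N] at this
    linarith
  have h4 := h3.rpow_const (p := 1 / (α + 2)) (Or.inr (by positivity))
  rw [Real.zero_rpow (by positivity)] at h4
  refine h4.congr fun n => ?_
  rw [← Real.rpow_mul (lpNormOn_nonneg _ _), mul_one_div_cancel hp.ne', Real.rpow_one]

set_option maxHeartbeats 400000 in
/-- The **Brezis–Lieb** splitting of the nonlinear term along weakly convergent sequences. -/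
theorem tendsto_N_sub {d : ℕ} {α : ℝ} (h : Subcritical d α)
    {u : ℕ → H1 d} {w : H1 d} (hu : WeakTendsto u w) {B : ℝ}
    (hB : ∀ n, ‖u n‖ ≤ B) :
    Tendsto (fun n => N α (u n) - N α (u n - w)) atTop (𝓝 (N α w)) := by
  have hα := h.pos
  have hp : 0 < α + 2 := by linarith
  obtain ⟨C, hC0, hC⟩ := h.exists_lpNormOn_le
  have hB0 : 0 ≤ B := (norm_nonneg _).trans (hB 0)
  have hB' : ∀ n, ‖u n - w‖ ≤ B + ‖w‖ := fun n => (norm_sub_le _ _).trans (by linarith [hB n])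
  set D : ℝ := C * (B + ‖w‖) with hD
  have hzero := hu.sub_const
  rw [Metric.tendsto_atTop]
  intro ε hε
  have huc : UniformContinuousOn (fun t : ℝ => t ^ (α + 2)) (Set.Icc 0 D) :=
    isCompact_Icc.uniformContinuousOn_of_continuous
      (Real.continuous_rpow_const hp.le).continuousOn
  obtain ⟨η, hη0, hη⟩ := Metric.uniformContinuousOn_iff.1 huc (ε / 3) (by positivity)
  have hsmall := (h.tendsto_lpNormOn_compl_ball w)
  have hsmall2 := hsmall.rpow_const (p := α + 2) (Or.inr hp.le)
  rw [Real.zero_rpow hp.ne'] at hsmall2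
  -- Outside the ball of radius m the profile w is small, so there u_n and u_n - w have nearby norms
  -- and uniform continuity of t ↦ t^{α+2} applies. Inside, u_n - w tends to 0 in L^{α+2}.
  obtain ⟨m, hm1, hm2⟩ := ((hsmall.eventually_lt_const hη0).and
    (hsmall2.eventually_lt_const (by positivity : 0 < ε / 3))).exists
  have hz := h.tendsto_lpNormOn_ball hzero hB' (m : ℝ)
  have hsm : MeasurableSet (Metric.ball (0 : Space d) (m : ℝ)) := measurableSet_ball
  generalize Metric.ball (0 : Space d) (m : ℝ) = s at hz hm1 hm2 hsm
  have hus : Tendsto (fun n => lpNormOn α s (u n)) atTop (𝓝 (lpNormOn α s w)) := by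
    rw [tendsto_iff_dist_tendsto_zero]
    refine squeeze_zero (fun n => dist_nonneg) (fun n => ?_) hz
    rw [Real.dist_eq]
    exact h.abs_lpNormOn_sub_le s (u n) w
  have hlim : Tendsto (fun n => lpNormOn α s (u n) ^ (α + 2) - lpNormOn α s (u n - w) ^ (α + 2))
      atTop (𝓝 (lpNormOn α s w ^ (α + 2))) := by
    have := (hus.rpow_const (p := α + 2) (Or.inr hp.le)).sub
      (hz.rpow_const (p := α + 2) (Or.inr hp.le))
    rwa [Real.zero_rpow hp.ne', sub_zero] at this
  obtain ⟨n₀, hn₀⟩ := Metric.tendsto_atTop.1 hlim (ε / 3) (by positivity)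
  refine ⟨n₀, fun n hn => ?_⟩
  have a1 := hn₀ n hn
  have m1 : lpNormOn α sᶜ (u n) ∈ Set.Icc 0 D := ⟨lpNormOn_nonneg _ _, (hC _ _).trans (by
    rw [hD]
    gcongr
    linarith [hB n, norm_nonneg w])⟩
  have m2 : lpNormOn α sᶜ (u n - w) ∈ Set.Icc 0 D := ⟨lpNormOn_nonneg _ _, (hC _ _).trans (by
    rw [hD]
    gcongr
    exact hB' n)⟩
  have a2 := hη _ m1 _ m2 (by
    rw [Real.dist_eq]
    refine (h.abs_lpNormOn_sub_le sᶜ (u n) (u n - w)).trans_lt ?_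
    simpa using hm1)
  rw [Real.dist_eq] at a1 a2 ⊢
  rw [h.N_eq_add hsm (u n), h.N_eq_add hsm (u n - w), h.N_eq_add hsm w]
  have a3 : 0 ≤ lpNormOn α sᶜ w ^ (α + 2) := Real.rpow_nonneg (lpNormOn_nonneg _ _) _
  rw [abs_lt] at a1 a2 ⊢
  constructor <;> linarith [a1.1, a1.2, a2.1, a2.2]

/-- Where |v| ≤ 2c', the factor |v|^α is at most (2c')^α. Where |v| > 2c', the average is less than
half of |v|, so |v| ≤ 2|v - A_r v| and the L² oscillation estimate pays for the quadratic part of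
|v|^{α+2}. -/
theorem N_le_of_norm_avg_lt {d : ℕ} {α : ℝ} (h : Subcritical d α) {q C D ε r c' : ℝ}
    (hq : α + 2 < q) (hC0 : 0 ≤ C) (hD0 : 0 ≤ D) (hε0 : 0 < ε) (hr0 : 0 < r) (hc'0 : 0 < c')
    (hC : ∀ t : ℝ, 0 ≤ t → t ^ (α + 2) ≤ C * t ^ (2 : ℝ) + ε * t ^ q) (v : H1 d)
    (hD : ∫⁻ x, ‖fn v x‖ₑ ^ q ≤ ENNReal.ofReal D) (hcon : ∀ y, ‖avg r (fn v) y‖ < c') :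
    N α v ≤ (2 * c') ^ α * ‖fn v‖ ^ 2 + 4 * C * (r ^ 2 * ‖grad v‖ ^ 2) + ε * D := by
  have hα := h.pos
  have hp : 0 < α + 2 := by linarith
  have hum := Lp.stronglyMeasurable (fn v)
  have ham := stronglyMeasurable_avg hum hr0
  have hreal : ∀ x, ‖fn v x‖ ^ (α + 2) ≤ (2 * c') ^ α * ‖fn v x‖ ^ (2 : ℝ)
      + 4 * C * ‖fn v x - avg r (fn v) x‖ ^ (2 : ℝ) + ε * ‖fn v x‖ ^ q := by
    intro x
    have hn := norm_nonneg (fn v x)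
    have t1 : 0 ≤ ε * ‖fn v x‖ ^ q := by positivity
    have t2 : 0 ≤ 4 * C * ‖fn v x - avg r (fn v) x‖ ^ (2 : ℝ) := by positivity
    have t3 : 0 ≤ (2 * c') ^ α * ‖fn v x‖ ^ (2 : ℝ) := by positivity
    rcases le_total (‖fn v x‖) (2 * c') with hx | hx
    · have : ‖fn v x‖ ^ (α + 2) = ‖fn v x‖ ^ α * ‖fn v x‖ ^ (2 : ℝ) :=
        Real.rpow_add' hn hp.ne'
      have h2 : ‖fn v x‖ ^ α ≤ (2 * c') ^ α := Real.rpow_le_rpow hn hx hα.le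
      have h3 : 0 ≤ ‖fn v x‖ ^ (2 : ℝ) := by positivity
      nlinarith [mul_le_mul_of_nonneg_right h2 h3]
    · have h1 := norm_sub_norm_le (fn v x) (avg r (fn v) x)
      have h2 : ‖fn v x‖ ≤ 2 * ‖fn v x - avg r (fn v) x‖ := by linarith [hcon x]
      have h3 := hC _ hn
      have h4 : ‖fn v x‖ ^ (2 : ℝ) ≤ 4 * ‖fn v x - avg r (fn v) x‖ ^ (2 : ℝ) := by
        rw [Real.rpow_two, Real.rpow_two]
        nlinarith
      nlinarith [mul_le_mul_of_nonneg_left h4 hC0]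
  have hpt : ∀ x, ‖fn v x‖ₑ ^ (α + 2) ≤ ENNReal.ofReal ((2 * c') ^ α) * ‖fn v x‖ₑ ^ (2 : ℝ)
      + ENNReal.ofReal (4 * C) * ‖fn v x - avg r (fn v) x‖ₑ ^ (2 : ℝ)
      + ENNReal.ofReal ε * ‖fn v x‖ₑ ^ q := by
    intro x
    rw [← ofReal_norm, ← ofReal_norm, ENNReal.ofReal_rpow_of_nonneg (norm_nonneg _) hp.le,
      ENNReal.ofReal_rpow_of_nonneg (norm_nonneg _) (by norm_num),
      ENNReal.ofReal_rpow_of_nonneg (norm_nonneg _) (by norm_num),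
      ENNReal.ofReal_rpow_of_nonneg (norm_nonneg _) (by linarith),
      ← ENNReal.ofReal_mul (by positivity), ← ENNReal.ofReal_mul (by positivity),
      ← ENNReal.ofReal_mul hε0.le, ← ENNReal.ofReal_add (by positivity) (by positivity),
      ← ENNReal.ofReal_add (by positivity) (by positivity)]
    exact ENNReal.ofReal_le_ofReal (hreal x)
  have hm1 : Measurable fun x : Space d => ENNReal.ofReal ((2 * c') ^ α) * ‖fn v x‖ₑ ^ (2 : ℝ) :=
    (hum.enorm.pow_const _).const_mul _
  have hm2 : Measurable fun x : Space d =>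
      ENNReal.ofReal (4 * C) * ‖fn v x - avg r (fn v) x‖ₑ ^ (2 : ℝ) :=
    ((hum.sub ham).enorm.pow_const _).const_mul _
  have hm12 : Measurable fun x : Space d => ENNReal.ofReal ((2 * c') ^ α) * ‖fn v x‖ₑ ^ (2 : ℝ)
      + ENNReal.ofReal (4 * C) * ‖fn v x - avg r (fn v) x‖ₑ ^ (2 : ℝ) := hm1.add hm2
  have hInt : ENNReal.ofReal (N α v) ≤ ENNReal.ofReal
      ((2 * c') ^ α * ‖fn v‖ ^ 2 + 4 * C * (r ^ 2 * ‖grad v‖ ^ 2) + ε * D) := by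
    have e := h.ofReal_setIntegral Set.univ v
    rw [← h.N_eq_univ, setLIntegral_univ] at e
    rw [e]
    refine (lintegral_mono hpt).trans ?_
    rw [lintegral_add_left hm12, lintegral_add_left hm1,
      lintegral_const_mul' _ _ ENNReal.ofReal_ne_top,
      lintegral_const_mul' _ _ ENNReal.ofReal_ne_top,
      lintegral_const_mul' _ _ ENNReal.ofReal_ne_top, lintegral_enorm_rpow_two,
      ENNReal.ofReal_add (by positivity) (by positivity),
      ENNReal.ofReal_add (by positivity) (by positivity),
      ENNReal.ofReal_mul (p := (2 * c') ^ α) (by positivity),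
      ENNReal.ofReal_mul (p := 4 * C) (by positivity), ENNReal.ofReal_mul (p := ε) hε0.le]
    gcongr
    exact lintegral_fn_sub_avg_le v hr0
  exact (ENNReal.ofReal_le_ofReal_iff (by positivity)).1 hInt

/-- Bounded functions in `H¹` with large `L^{α+2}` norm do not vanish everywhere locally. -/
theorem exists_avg_ge {d : ℕ} {α : ℝ} (h : Subcritical d α)
    (B : ℝ) {c : ℝ} (hc : 0 < c) : ∃ r c' : ℝ, 0 < r ∧ 0 < c' ∧
    ∀ v : H1 d, ‖v‖ ≤ B → c ≤ N α v → ∃ y, c' ≤ ‖avg r (fn v) y‖ := by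
  have hα := h.pos
  have hp : 0 < α + 2 := by linarith
  obtain ⟨q, hq, hqB⟩ := h.exists_higher_exponent
  obtain ⟨D, hD0, hD⟩ := hqB B
  -- The constants ε, r and c' make each of the three terms of `N_le_of_norm_avg_lt` at most c/4, so
  -- small averages would give N(v) ≤ 3c/4 < c.
  set ε : ℝ := c / (4 * (D + 1)) with hε
  have hε0 : 0 < ε := by positivity
  obtain ⟨C, hC0, hC⟩ := exists_rpow_le_add (by linarith : 2 < α + 2) hq hε0
  set r : ℝ := √(c / (16 * (C + 1) * (B ^ 2 + 1))) with hr
  have hr0 : 0 < r := by positivity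
  set c' : ℝ := (c / (4 * (B ^ 2 + 1))) ^ (1 / α) / 2 with hc'
  have hc'0 : 0 < c' := by positivity
  have hc'α : (2 * c') ^ α = c / (4 * (B ^ 2 + 1)) := by
    rw [hc', mul_div_cancel₀ _ (by norm_num : (2 : ℝ) ≠ 0), ← Real.rpow_mul (by positivity),
      one_div, inv_mul_cancel₀ hα.ne', Real.rpow_one]
  refine ⟨r, c', hr0, hc'0, fun v hv hN => ?_⟩
  by_contra! hcon
  have hfin := h.N_le_of_norm_avg_lt hq hC0 hD0 hε0 hr0 hc'0 hC v (hD v hv) hcon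
  have b1 : ‖fn v‖ ^ 2 ≤ B ^ 2 :=
    pow_le_pow_left₀ (norm_nonneg _) ((norm_fn_le v).trans hv) 2
  have b2 : ‖grad v‖ ^ 2 ≤ B ^ 2 :=
    pow_le_pow_left₀ (norm_nonneg _) ((norm_grad_le v).trans hv) 2
  have c1 : (2 * c') ^ α * ‖fn v‖ ^ 2 ≤ c / 4 := by
    rw [hc'α]
    calc c / (4 * (B ^ 2 + 1)) * ‖fn v‖ ^ 2 ≤ c / (4 * (B ^ 2 + 1)) * (B ^ 2 + 1) := by
          gcongr
          linarith
      _ = c / 4 := by field_simp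
  have c2 : 4 * C * (r ^ 2 * ‖grad v‖ ^ 2) ≤ c / 4 := by
    rw [hr, Real.sq_sqrt (by positivity)]
    calc 4 * C * (c / (16 * (C + 1) * (B ^ 2 + 1)) * ‖grad v‖ ^ 2)
        ≤ 4 * (C + 1) * (c / (16 * (C + 1) * (B ^ 2 + 1)) * (B ^ 2 + 1)) := by
          gcongr
          · linarith
          · linarith
      _ = c / 4 := by
          field_simp
          norm_num
  have c3 : ε * D ≤ c / 4 := by
    rw [hε]
    calc c / (4 * (D + 1)) * D ≤ c / (4 * (D + 1)) * (D + 1) := by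
          gcongr
          linarith
      _ = c / 4 := by field_simp
  linarith

end Subcritical

end

end InversePowerNLS

namespace InversePowerNLS

open MeasureTheory Filter Topology
open scoped ENNReal NNReal

noncomputable section

/-! ### The variational problem -/

/-- The free quadratic form `‖∇v‖² + ω‖v‖²`. -/
def freeForm {d : ℕ} (ω : ℝ) (v : H1 d) : ℝ := ‖grad v‖ ^ 2 + ω * ‖fn v‖ ^ 2

/-- The quadratic form `‖∇v‖² - G(v) + ω‖v‖²`. -/
def quadForm {d : ℕ} (σ ω : ℝ) (v : H1 d) : ℝ := ‖grad v‖ ^ 2 - G σ v + ω * ‖fn v‖ ^ 2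

theorem quadForm_eq {d : ℕ} (σ ω : ℝ) (v : H1 d) : quadForm σ ω v = freeForm ω v - G σ v := by
  unfold quadForm freeForm
  ring

theorem K_eq {d : ℕ} (σ α ω : ℝ) (v : H1 d) : K σ α ω v = quadForm σ ω v - N α v := rfl

theorem S_eq {d : ℕ} (σ α ω : ℝ) (v : H1 d) :
    S σ α ω v = 1 / 2 * quadForm σ ω v - 1 / (α + 2) * N α v := by
  unfold S quadForm
  ring

/-- The standing assumptions on the parameters. -/
structure Admissible (d : ℕ) (σ α ω : ℝ) : Prop where
  sub : Subcritical d α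
  σ_pos : 0 < σ
  σ_lt : σ < min 2 (d : ℝ)
  ω_gt : -mu1 d σ < ω

/-- The underlying function as a bounded linear operator. -/
def fnL (d : ℕ) : H1 d →L[ℂ] Lp ℂ 2 (volume : Measure (Space d)) :=
  LinearMap.mkContinuous { toFun := fn, map_add' := fn_add, map_smul' := fn_smul } 1
    (fun v => by simpa using norm_fn_le v)

/-- The gradient as a bounded linear operator. -/
def gradL (d : ℕ) : H1 d →L[ℂ] Lp (EuclideanSpace ℂ (Fin d)) 2 (volume : Measure (Space d)) :=
  LinearMap.mkContinuous { toFun := grad, map_add' := grad_add, map_smul' := grad_smul } 1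
    (fun v => by simpa using norm_grad_le v)

theorem fnL_apply {d : ℕ} (v : H1 d) : fnL d v = fn v := rfl

theorem gradL_apply {d : ℕ} (v : H1 d) : gradL d v = grad v := rfl

/-- Expanding the square leaves only the cross term 2 Re⟨Lw, Lu_n⟩, which is a weakly continuous
functional of u_n. -/
theorem tendsto_norm_sq_sub_of_weak {E F : Type*} [NormedAddCommGroup E] [NormedSpace ℂ E]
    [NormedAddCommGroup F] [InnerProductSpace ℂ F] (L : E →L[ℂ] F) {u : ℕ → E} {w : E}
    (h : ∀ f : E →L[ℂ] ℂ, Tendsto (fun n => f (u n)) atTop (𝓝 (f w))) :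
    Tendsto (fun n => ‖L (u n)‖ ^ 2 - ‖L (u n - w)‖ ^ 2) atTop (𝓝 (‖L w‖ ^ 2)) := by
  have h1 : Tendsto (fun n => inner ℂ (L w) (L (u n))) atTop (𝓝 (inner ℂ (L w) (L w))) :=
    h ((innerSL ℂ (L w)).comp L)
  have h2 := (Complex.continuous_re.tendsto _).comp h1
  have e : (inner ℂ (L w) (L w)).re = ‖L w‖ ^ 2 := inner_self_eq_norm_sq (𝕜 := ℂ) (L w)
  rw [e] at h2
  have h3 := (h2.const_mul 2).sub_const (‖L w‖ ^ 2)
  rw [two_mul, add_sub_cancel_right] at h3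
  refine h3.congr fun n => ?_
  rw [map_sub, norm_sub_sq (𝕜 := ℂ), inner_re_symm]
  simp only [Function.comp, RCLike.re_eq_complex_re]
  ring

theorem WeakTendsto.tendsto_norm_sq_sub {d : ℕ} {F : Type*} [NormedAddCommGroup F]
    [InnerProductSpace ℂ F] (L : H1 d →L[ℂ] F) {u : ℕ → H1 d} {w : H1 d} (h : WeakTendsto u w) :
    Tendsto (fun n => ‖L (u n)‖ ^ 2 - ‖L (u n - w)‖ ^ 2) atTop (𝓝 (‖L w‖ ^ 2)) :=
  tendsto_norm_sq_sub_of_weak L h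

theorem WeakTendsto.tendsto_freeForm_sub {d : ℕ} (ω : ℝ) {u : ℕ → H1 d} {w : H1 d}
    (h : WeakTendsto u w) :
    Tendsto (fun n => freeForm ω (u n) - freeForm ω (u n - w)) atTop (𝓝 (freeForm ω w)) := by
  have h1 := h.tendsto_norm_sq_sub (gradL d)
  have h2 := h.tendsto_norm_sq_sub (fnL d)
  simp only [gradL_apply, fnL_apply] at h1 h2
  refine (h1.add (h2.const_mul ω)).congr fun n => ?_
  unfold freeForm
  ring

/-! ### Coercivity and the constrained maximization problem -/

namespace Admissible

theorem tendsto_quadForm_sub {d : ℕ} {σ α ω : ℝ} (H : Admissible d σ α ω) {u : ℕ → H1 d}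
    {w : H1 d} (h : WeakTendsto u w) :
    Tendsto (fun n => quadForm σ ω (u n) - quadForm σ ω (u n - w)) atTop
      (𝓝 (quadForm σ ω w)) := by
  have h1 := h.tendsto_norm_sq_sub (weightL H.sub.one_le H.σ_pos H.σ_lt)
  simp only [norm_weightL_sq] at h1
  have h2 := (h.tendsto_freeForm_sub ω).sub h1
  rw [← quadForm_eq] at h2
  refine h2.congr fun n => ?_
  rw [quadForm_eq, quadForm_eq]
  ring

theorem G_smul {d : ℕ} {σ : ℝ} (c : ℝ) (v : H1 d) : G σ (c • v) = c ^ 2 * G σ v := by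
  unfold G
  rw [← integral_const_mul]
  refine integral_congr_ae ?_
  filter_upwards [Lp.coeFn_smul c (fn v)] with x hx
  rw [fn_real_smul, hx, Pi.smul_apply, norm_smul, mul_pow, Real.norm_eq_abs, sq_abs]
  ring

theorem quadForm_smul {d : ℕ} {σ ω : ℝ} (c : ℝ) (v : H1 d) :
    quadForm σ ω (c • v) = c ^ 2 * quadForm σ ω v := by
  unfold quadForm
  rw [G_smul, fn_real_smul, grad_real_smul, norm_smul, norm_smul, mul_pow, mul_pow,
    Real.norm_eq_abs, sq_abs]
  ring

theorem exists_lower_bound {d : ℕ} {σ α ω : ℝ} (H : Admissible d σ α ω) :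
    ∃ C : ℝ, 0 ≤ C ∧ ∀ v : H1 d, 1 / 2 * ‖grad v‖ ^ 2 - C * ‖fn v‖ ^ 2 ≤ ‖grad v‖ ^ 2 - G σ v := by
  obtain ⟨C, hC0, hC⟩ := exists_G_le H.sub.one_le H.σ_pos H.σ_lt (half_pos one_pos)
  refine ⟨C + 1 / 2, by positivity, fun v => ?_⟩
  have := hC v
  rw [norm_sq_eq] at this
  linarith

theorem mu1_mul_le {d : ℕ} {σ α ω : ℝ} (H : Admissible d σ α ω) (v : H1 d) :
    mu1 d σ * ‖fn v‖ ^ 2 ≤ ‖grad v‖ ^ 2 - G σ v := by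
  obtain ⟨C, hC0, hC⟩ := H.exists_lower_bound
  -- Needed because the real `sInf` of a set that is not bounded below is 0 by convention and would
  -- not be a lower bound.
  have hbdd : BddBelow {r : ℝ | ∃ v : H1 d, ‖fn v‖ = 1 ∧ r = ‖grad v‖ ^ 2 - G σ v} := by
    refine ⟨-C, ?_⟩
    rintro _ ⟨w, hw, rfl⟩
    have := hC w
    rw [hw] at this
    linarith [sq_nonneg ‖grad w‖]
  rcases eq_or_ne (fn v) 0 with h0 | h0
  · have hv := eq_zero_of_fn_eq_zero h0
    have := hC v
    rw [h0] at this ⊢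
    simp only [norm_zero, ne_eq, OfNat.ofNat_ne_zero, not_false_eq_true, zero_pow, mul_zero,
      sub_zero] at this ⊢
    linarith [sq_nonneg ‖grad v‖]
  have hn : 0 < ‖fn v‖ := norm_pos_iff.2 h0
  have h1 : mu1 d σ ≤ ‖grad (‖fn v‖⁻¹ • v)‖ ^ 2 - G σ (‖fn v‖⁻¹ • v) := by
    refine csInf_le hbdd ⟨‖fn v‖⁻¹ • v, ?_, rfl⟩
    rw [fn_real_smul, norm_smul, norm_inv, norm_norm, inv_mul_cancel₀ hn.ne']
  rw [G_smul, grad_real_smul, norm_smul, norm_inv, norm_norm, mul_pow, ← mul_sub, inv_pow,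
    ← div_eq_inv_mul, le_div_iff₀ (by positivity)] at h1
  exact h1

/-- Coercivity of the quadratic form. -/
theorem exists_coercive {d : ℕ} {σ α ω : ℝ} (H : Admissible d σ α ω) :
    ∃ c : ℝ, 0 < c ∧ ∀ v : H1 d, c * ‖v‖ ^ 2 ≤ quadForm σ ω v := by
  obtain ⟨C, hC0, hC⟩ := H.exists_lower_bound
  set κ : ℝ := ω + mu1 d σ with hκ
  have hκ0 : 0 < κ := by linarith [H.ω_gt]
  set b : ℝ := |ω - C| with hb
  have hb0 : 0 ≤ b := abs_nonneg _
  have hb1 : -b ≤ ω - C := neg_abs_le _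
  -- Coercivity comes from a convex combination: weight θ on the bound that controls the gradient
  -- but may lose b‖v‖², weight 1 - θ on the spectral bound κ‖v‖². This θ makes the loss small
  -- enough to keep κ/2 of the mass term.
  set θ : ℝ := κ / (2 * (κ + b + 1)) with hθ
  have hθ0 : 0 < θ := by positivity
  have hθ1 : θ * (2 * (κ + b + 1)) = κ := by rw [hθ]; field_simp
  have hθ2 : θ ≤ 1 := by nlinarith
  refine ⟨min (θ / 2) (κ / 2), by positivity, fun v => ?_⟩
  have h1 := hC v
  have h2 := H.mu1_mul_le v
  have hx : 0 ≤ ‖grad v‖ ^ 2 := by positivity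
  have hy : 0 ≤ ‖fn v‖ ^ 2 := by positivity
  have m1 : min (θ / 2) (κ / 2) ≤ θ / 2 := min_le_left _ _
  have m2 : min (θ / 2) (κ / 2) ≤ κ / 2 := min_le_right _ _
  rw [norm_sq_eq]
  unfold quadForm
  have a1 : 1 / 2 * ‖grad v‖ ^ 2 - b * ‖fn v‖ ^ 2 ≤ ‖grad v‖ ^ 2 - G σ v + ω * ‖fn v‖ ^ 2 := by
    nlinarith [mul_le_mul_of_nonneg_right hb1 hy]
  have a2 : κ * ‖fn v‖ ^ 2 ≤ ‖grad v‖ ^ 2 - G σ v + ω * ‖fn v‖ ^ 2 := by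
    rw [hκ]
    linarith
  have a3 : κ / 2 ≤ (1 - θ) * κ - θ * b := by nlinarith
  have a4 := mul_le_mul_of_nonneg_left a1 hθ0.le
  have a5 := mul_le_mul_of_nonneg_left a2 (by linarith : 0 ≤ 1 - θ)
  have a6 := mul_le_mul_of_nonneg_right a3 hy
  have a7 := mul_le_mul_of_nonneg_right m1 hx
  have a8 := mul_le_mul_of_nonneg_right m2 hy
  linarith

theorem quadForm_pos {d : ℕ} {σ α ω : ℝ} (H : Admissible d σ α ω) {v : H1 d} (hv : v ≠ 0) :
    0 < quadForm σ ω v := by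
  obtain ⟨c, hc, h⟩ := H.exists_coercive
  have : 0 < ‖v‖ := norm_pos_iff.2 hv
  exact lt_of_lt_of_le (by positivity) (h v)

theorem quadForm_nonneg {d : ℕ} {σ α ω : ℝ} (H : Admissible d σ α ω) (v : H1 d) :
    0 ≤ quadForm σ ω v := by
  obtain ⟨c, hc, h⟩ := H.exists_coercive
  exact le_trans (by positivity) (h v)

theorem exists_normalized {d : ℕ} {σ α ω : ℝ} (H : Admissible d σ α ω) {v : H1 d} (hv : v ≠ 0) :
    ∃ w : H1 d, quadForm σ ω w = 1 ∧
      N α v = N α w * quadForm σ ω v ^ ((α + 2) / 2) := by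
  have hq := H.quadForm_pos hv
  have hs : 0 < √(quadForm σ ω v) := Real.sqrt_pos.2 hq
  refine ⟨(√(quadForm σ ω v))⁻¹ • v, ?_, ?_⟩
  · rw [quadForm_smul, inv_pow, Real.sq_sqrt hq.le, inv_mul_cancel₀ hq.ne']
  · have e : v = √(quadForm σ ω v) • (√(quadForm σ ω v))⁻¹ • v := by
      rw [smul_smul, mul_inv_cancel₀ hs.ne', one_smul]
    conv_lhs => rw [e, H.sub.N_smul]
    rw [abs_of_pos hs, mul_comm, Real.sqrt_eq_rpow, ← Real.rpow_mul hq.le]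
    congr 2
    ring

/-- Coercivity and Sobolev make the supremum on {q = 1} finite, and homogeneity extends the bound to
all of H¹. The element φ only ensures that the constraint set contains a function with positive N.
-/
theorem exists_sup {d : ℕ} {σ α ω : ℝ} (H : Admissible d σ α ω) {φ : H1 d} (hφ : φ ≠ 0) :
    ∃ M : ℝ, 0 < M ∧ (∀ v : H1 d, N α v ≤ M * quadForm σ ω v ^ ((α + 2) / 2)) ∧
      ∃ u : ℕ → H1 d, (∀ n, quadForm σ ω (u n) = 1) ∧
        Tendsto (fun n => N α (u n)) atTop (𝓝 M) := by
  have hα := H.sub.pos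
  obtain ⟨c, hc, hcoer⟩ := H.exists_coercive
  obtain ⟨C, hC0, hC⟩ := H.sub.exists_lpNormOn_le
  set A : Set ℝ := {r | ∃ v : H1 d, quadForm σ ω v = 1 ∧ N α v = r} with hA
  obtain ⟨w, hw1, hw2⟩ := H.exists_normalized hφ
  have hwN : 0 < N α w := by
    have h1 := H.sub.N_pos hφ
    rw [hw2] at h1
    exact pos_of_mul_pos_left h1 (Real.rpow_nonneg (H.quadForm_nonneg φ) _)
  have hne : A.Nonempty := ⟨N α w, w, hw1, rfl⟩
  have hbdd : BddAbove A := by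
    refine ⟨(C * √(1 / c)) ^ (α + 2), ?_⟩
    rintro _ ⟨v, hv, rfl⟩
    rw [H.sub.N_eq_univ]
    refine Real.rpow_le_rpow (lpNormOn_nonneg _ _) ((hC _ v).trans ?_) (by linarith)
    gcongr
    refine Real.le_sqrt_of_sq_le ?_
    rw [le_div_iff₀ hc, mul_comm]
    exact (hcoer v).trans hv.le
  obtain ⟨f, -, hf2, hf3⟩ := exists_seq_tendsto_sSup hne hbdd
  choose u hu1 hu2 using hf3
  refine ⟨sSup A, hwN.trans_le (le_csSup hbdd ⟨w, hw1, rfl⟩), fun v => ?_, u, hu1, ?_⟩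
  · rcases eq_or_ne v 0 with rfl | hv
    · have h0 := H.sub.N_smul (d := d) 0 0
      rw [smul_zero, abs_zero, Real.zero_rpow (by linarith), zero_mul] at h0
      have h1 := quadForm_smul (d := d) (σ := σ) (ω := ω) 0 0
      rw [smul_zero] at h1
      rw [h0, h1]
      simp [Real.zero_rpow (by linarith : (α + 2) / 2 ≠ 0)]
    · obtain ⟨z, hz1, hz2⟩ := H.exists_normalized hv
      rw [hz2]
      exact mul_le_mul_of_nonneg_right (le_csSup hbdd ⟨z, hz1, rfl⟩)
        (Real.rpow_nonneg (H.quadForm_nonneg v) _)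
  · exact hf2.congr fun n => (hu2 n).symm

end Admissible

/-- The energy bookkeeping for a profile splitting off from a maximizing sequence. -/
theorem le_of_splitting {M A b e : ℝ} (hM : 0 < M) (he : 1 ≤ e) (hA : 0 ≤ A)
    {x y : ℕ → ℝ} (hx : Tendsto x atTop (𝓝 (1 - A))) (hx0 : ∀ n, 0 ≤ x n)
    (hy : Tendsto y atTop (𝓝 (M - b))) (hxy : ∀ n, y n ≤ M * x n ^ e) :
    A ≤ 1 ∧ M * A ≤ b := by
  have h1 : 0 ≤ 1 - A := ge_of_tendsto' hx hx0
  have h2 : M - b ≤ M * (1 - A) ^ e :=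
    le_of_tendsto_of_tendsto' hy ((hx.rpow_const (Or.inr (by linarith))).const_mul M) hxy
  -- As e ≥ 1, the remainder uses its share 1 - A of the constraint no better than linearly, so the
  -- profile must have ratio b/A at least M.
  have h3 : (1 - A) ^ e ≤ 1 - A := by
    have := Real.rpow_le_rpow_of_exponent_ge' h1 (by linarith) zero_le_one he
    rwa [Real.rpow_one] at this
  refine ⟨by linarith, ?_⟩
  nlinarith

/-! ### Attainment of the best constant -/

namespace Admissible

/-- A maximizing sequence cannot be spread out. -/
theorem not_weakTendsto_zero {d : ℕ} {σ α ω : ℝ} (H : Admissible d σ α ω) {M : ℝ} (hM : 0 < M)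
    (hle : ∀ v : H1 d, N α v ≤ M * quadForm σ ω v ^ ((α + 2) / 2)) {u : ℕ → H1 d} {B : ℝ}
    (hB : ∀ n, ‖u n‖ ≤ B) (hu1 : ∀ n, quadForm σ ω (u n) = 1)
    (hu2 : Tendsto (fun n => N α (u n)) atTop (𝓝 M)) : ¬ WeakTendsto u 0 := by
  intro hweak
  have hα := H.sub.pos
  have hG := hweak.tendsto_G H.sub.one_le H.σ_pos H.σ_lt hB
  obtain ⟨r, c', hr, hc', havg⟩ := H.sub.exists_avg_ge B (half_pos hM)
  -- A translation is chosen for every n, arbitrary when N(u_n) is still below M/2; only large n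
  -- matter.
  have hex : ∀ n, ∃ y, M / 2 ≤ N α (u n) → c' ≤ ‖avg r (fn (u n)) y‖ := by
    intro n
    by_cases hn : M / 2 ≤ N α (u n)
    · obtain ⟨y, hy⟩ := havg (u n) (hB n) hn
      exact ⟨y, fun _ => hy⟩
    · exact ⟨0, fun h => absurd h hn⟩
  choose y hy using hex
  obtain ⟨w, k, hk, hw⟩ := exists_weakTendsto_subseq (u := fun n => shift (y n) (u n)) (B := B)
    (fun n => by rw [norm_shift]; exact hB n)
  have hkt := hk.tendsto_atTop
  have hw0 : w ≠ 0 := by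
    rintro rfl
    have h1 := (hw (avgL hr 0)).norm
    simp only [map_zero, norm_zero, Function.comp, avgL_apply, avg_shift] at h1
    have h2 : ∀ᶠ n in atTop, c' ≤ ‖avg r (fn (u (k n))) (y (k n))‖ := by
      filter_upwards [hkt.eventually (hu2.eventually_const_le (half_lt_self hM))] with n hn
      exact hy _ hn
    exact absurd (ge_of_tendsto h1 h2) (not_le.2 hc')
  -- The free form is translation invariant, and G(u_n) → 0, so in the translated frame it plays the
  -- role of the constraint.
  have hfree : ∀ n, freeForm ω (shift (y n) (u n)) = 1 + G σ (u n) := by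
    intro n
    have := hu1 n
    rw [quadForm_eq] at this
    rw [freeForm, norm_fn_shift, norm_grad_shift]
    rw [freeForm] at this
    linarith
  have hx : Tendsto (fun n => freeForm ω (shift (y (k n)) (u (k n)) - w)) atTop
      (𝓝 (1 - freeForm ω w)) := by
    have h1 := hw.tendsto_freeForm_sub ω
    have h2 : Tendsto (fun n => freeForm ω (shift (y (k n)) (u (k n)))) atTop (𝓝 1) := by
      simp only [hfree]
      simpa using (hG.comp hkt).const_add 1
    refine (h2.sub h1).congr fun n => ?_
    simp
  have hyN : Tendsto (fun n => N α (shift (y (k n)) (u (k n)) - w)) atTop (𝓝 (M - N α w)) := by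
    have h1 := H.sub.tendsto_N_sub hw (B := B) (fun n => by
      simp only [Function.comp, norm_shift]
      exact hB _)
    have h2 : Tendsto (fun n => N α (shift (y (k n)) (u (k n)))) atTop (𝓝 M) := by
      simp only [N_shift]
      exact hu2.comp hkt
    refine (h2.sub h1).congr fun n => ?_
    simp
  have hqf : ∀ v : H1 d, quadForm σ ω v ≤ freeForm ω v := fun v => by
    rw [quadForm_eq]
    linarith [G_nonneg (σ := σ) v]
  have hf0 : ∀ v : H1 d, 0 ≤ freeForm ω v := fun v => (H.quadForm_nonneg v).trans (hqf v)
  obtain ⟨hA1, hMA⟩ := le_of_splitting hM (by linarith : 1 ≤ (α + 2) / 2) (hf0 w) hx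
    (fun n => hf0 _) hyN (fun n => by
      have e := shift_sub_shift_neg (y (k n)) (u (k n)) w
      rw [← e, N_shift]
      refine (hle _).trans ?_
      have e2 : freeForm ω (shift (y (k n)) (u (k n) - shift (-y (k n)) w))
          = freeForm ω (u (k n) - shift (-y (k n)) w) := by
        rw [freeForm, norm_fn_shift, norm_grad_shift, freeForm]
      rw [e2]
      gcongr
      · exact H.quadForm_nonneg _
      · exact hqf _)
  -- The contradiction: the splitting gives M · `freeForm ω w` ≤ N(w), while N(w) ≤ M q(w)^e ≤ M
  -- q(w), and q(w) is strictly smaller than the free form as G(w) > 0.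
  have hGw := G_pos H.sub.one_le H.σ_pos H.σ_lt hw0
  have hlt : quadForm σ ω w < freeForm ω w := by
    rw [quadForm_eq]
    linarith
  have h3 : quadForm σ ω w ^ ((α + 2) / 2) ≤ quadForm σ ω w := by
    have := Real.rpow_le_rpow_of_exponent_ge' (H.quadForm_nonneg w) (by linarith) zero_le_one
      (by linarith : 1 ≤ (α + 2) / 2)
    rwa [Real.rpow_one] at this
  have h4 := hle w
  nlinarith

/-- The maximum of `N` on `{quadForm = 1}` is attained. -/
theorem exists_maximizer {d : ℕ} {σ α ω : ℝ} (H : Admissible d σ α ω) {φ : H1 d} (hφ : φ ≠ 0) :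
    ∃ M : ℝ, 0 < M ∧ (∀ v : H1 d, N α v ≤ M * quadForm σ ω v ^ ((α + 2) / 2)) ∧
      ∃ u : H1 d, quadForm σ ω u = 1 ∧ N α u = M := by
  have hα := H.sub.pos
  obtain ⟨M, hM, hle, u, hu1, hu2⟩ := H.exists_sup hφ
  refine ⟨M, hM, hle, ?_⟩
  obtain ⟨c, hc, hcoer⟩ := H.exists_coercive
  have hB : ∀ n, ‖u n‖ ≤ √(1 / c) := by
    intro n
    refine Real.le_sqrt_of_sq_le ?_
    rw [le_div_iff₀ hc, mul_comm]
    exact (hcoer (u n)).trans (hu1 n).le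
  obtain ⟨w, k, hk, hw⟩ := exists_weakTendsto_subseq hB
  have hkt := hk.tendsto_atTop
  have hw0 : w ≠ 0 := by
    rintro rfl
    exact H.not_weakTendsto_zero hM hle (fun n => hB (k n)) (fun n => hu1 (k n))
      (hu2.comp hkt) hw
  have hx : Tendsto (fun n => quadForm σ ω (u (k n) - w)) atTop (𝓝 (1 - quadForm σ ω w)) := by
    have h1 := H.tendsto_quadForm_sub hw
    simp only [Function.comp, hu1] at h1
    refine (h1.const_sub 1).congr fun n => ?_
    ring
  have hyN : Tendsto (fun n => N α (u (k n) - w)) atTop (𝓝 (M - N α w)) := by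
    have h1 := H.sub.tendsto_N_sub hw (fun n => hB (k n))
    refine ((hu2.comp hkt).sub h1).congr fun n => ?_
    simp
  obtain ⟨hA1, hMA⟩ := le_of_splitting hM (by linarith : 1 ≤ (α + 2) / 2) (H.quadForm_nonneg w) hx
    (fun n => H.quadForm_nonneg _) hyN (fun n => hle _)
  have hpos := H.quadForm_pos hw0
  -- If 0 < q(w) < 1, then M q(w) ≤ N(w) ≤ M q(w)^e < M q(w), so no part of the constraint can be
  -- lost in the weak limit.
  have hq1 : quadForm σ ω w = 1 := by
    by_contra hne
    have hlt : quadForm σ ω w < 1 := lt_of_le_of_ne hA1 hne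
    have h3 : quadForm σ ω w ^ ((α + 2) / 2) < quadForm σ ω w := by
      have := Real.rpow_lt_rpow_of_exponent_gt hpos hlt (by linarith : 1 < (α + 2) / 2)
      rwa [Real.rpow_one] at this
    have h4 := hle w
    nlinarith
  refine ⟨w, hq1, le_antisymm ?_ ?_⟩
  · have := hle w
    rwa [hq1, Real.one_rpow, mul_one] at this
  · rwa [hq1, mul_one] at hMA

end Admissible

end

end InversePowerNLS

namespace InversePowerNLS

open MeasureTheory Filter Topology Asymptotics
open scoped ENNReal NNReal

noncomputable section

/-! ### Ground states -/

theorem abs_norm_sq_add_sub_le {E F : Type*} [NormedAddCommGroup E] [NormedSpace ℂ E]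
    [NormedAddCommGroup F] [NormedSpace ℂ F] (L : E →L[ℂ] F) (u w : E) (hw : ‖w‖ ≤ 1) :
    |‖L (u + w)‖ ^ 2 - ‖L u‖ ^ 2| ≤ (2 * ‖L u‖ + ‖L‖) * ‖L‖ * ‖w‖ := by
  have h1 : ‖L w‖ ≤ ‖L‖ * ‖w‖ := L.le_opNorm w
  have h2 : ‖L w‖ ≤ ‖L‖ := h1.trans (mul_le_of_le_one_right (norm_nonneg _) hw)
  have h3 : |‖L (u + w)‖ - ‖L u‖| ≤ ‖L w‖ := by
    have := abs_norm_sub_norm_le (L (u + w)) (L u)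
    rwa [← map_sub, add_sub_cancel_left] at this
  have h4 : ‖L (u + w)‖ ≤ ‖L u‖ + ‖L‖ := by
    rw [map_add]
    exact (norm_add_le _ _).trans (by linarith)
  have e : ‖L (u + w)‖ ^ 2 - ‖L u‖ ^ 2 = (‖L (u + w)‖ + ‖L u‖) * (‖L (u + w)‖ - ‖L u‖) := by ring
  rw [e, abs_mul, abs_of_nonneg (by positivity), mul_assoc]
  exact mul_le_mul (by linarith) (h3.trans h1) (abs_nonneg _) (by positivity)

theorem norm_sq_add_add_norm_sq_sub {E F : Type*} [NormedAddCommGroup E] [NormedSpace ℂ E]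
    [NormedAddCommGroup F] [InnerProductSpace ℂ F] (L : E →L[ℂ] F) (u w : E) :
    ‖L (u + w)‖ ^ 2 + ‖L (u - w)‖ ^ 2 = 2 * ‖L u‖ ^ 2 + 2 * ‖L w‖ ^ 2 := by
  have := parallelogram_law_with_norm ℂ (L u) (L w)
  rw [map_add, map_sub]
  nlinarith

/-- A function squeezed between an `o(h)` minorant and its own second difference has zero
derivative. -/
theorem hasFDerivAt_zero_of_squeeze {E : Type*} [NormedAddCommGroup E] [NormedSpace ℝ E]
    {f : E → ℝ} {x : E} {m : E → ℝ} {C : ℝ} (hm : m =o[𝓝 0] (id : E → E))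
    (hlow : ∀ w, m w ≤ f (x + w) - f x)
    (hup : ∀ w, f (x + w) + f (x - w) - 2 * f x ≤ C * ‖w‖ ^ 2) :
    HasFDerivAt f (0 : E →L[ℝ] ℝ) x := by
  rw [hasFDerivAt_iff_isLittleO_nhds_zero]
  have hneg : (fun w => m (-w)) =o[𝓝 0] (id : E → E) := by
    have ht : Tendsto (fun w : E => -w) (𝓝 0) (𝓝 0) := by
      simpa using (continuous_neg (G := E)).tendsto 0
    have := hm.comp_tendsto ht
    refine (this.trans_isBigO ?_)
    exact IsBigO.of_bound 1 (Eventually.of_forall fun w => by simp)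
  have hsq : (fun w : E => C * ‖w‖ ^ 2) =o[𝓝 0] (id : E → E) := by
    refine IsLittleO.const_mul_left ?_ C
    have : (fun w : E => ‖w‖ ^ 2) =o[𝓝 0] fun w => ‖w‖ := by
      have h0 : Tendsto (fun w : E => ‖w‖) (𝓝 0) (𝓝 0) := tendsto_norm_zero
      have := (isLittleO_one_iff ℝ).2 h0
      have h2 := this.mul_isBigO (isBigO_refl (fun w : E => ‖w‖) (𝓝 0))
      simpa [sq] using h2
    exact this.of_norm_right
  refine IsBigO.trans_isLittleO ?_ ((hsq.norm_left.add hm.norm_left).add hneg.norm_left)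
  refine IsBigO.of_bound 1 (Eventually.of_forall fun w => ?_)
  simp only [_root_.zero_apply, sub_zero, one_mul]
  have h1 := hlow w
  have h2 := hlow (-w)
  -- The second-difference bound combined with the minorant at -w gives the majorant f(x+w) - f(x) ≤
  -- C‖w‖² - m(-w), which is also o(w).
  have h3 := hup w
  rw [← sub_eq_add_neg] at h2
  have a1 := abs_le.1 (le_refl |m w|)
  have a2 := abs_le.1 (le_refl |m (-w)|)
  have a3 := le_abs_self (C * ‖w‖ ^ 2)
  have a4 := abs_nonneg (C * ‖w‖ ^ 2)
  simp only [Real.norm_eq_abs]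
  refine le_trans ?_ (le_abs_self _)
  rw [abs_le]
  constructor <;> linarith [abs_nonneg (m w), abs_nonneg (m (-w))]

/-- If `n ≤ M q^{e}` with equality at `u`, where `n` is midpoint convex and `q` is quadratic, then
`u` is a critical point of `q / 2 - n / (2 e)`. -/
theorem hasFDerivAt_zero_of_extremal {E : Type*} [NormedAddCommGroup E] [NormedSpace ℝ E]
    {q n : E → ℝ} {M e C C' : ℝ} (he : 0 < e) {u : E} (hu0 : 0 < q u) (hu : n u = q u)
    (hM : M * q u ^ (e - 1) = 1) (hle : ∀ v, n v ≤ M * q v ^ e)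
    (hC : ∀ w, ‖w‖ ≤ 1 → |q (u + w) - q u| ≤ C * ‖w‖)
    (hpar : ∀ w, q (u + w) + q (u - w) = 2 * q u + 2 * q w) (hC' : ∀ w, q w ≤ C' * ‖w‖ ^ 2)
    (hconv : ∀ w, 2 * n u ≤ n (u + w) + n (u - w)) :
    HasFDerivAt (fun v => 1 / 2 * q v - 1 / (2 * e) * n v) (0 : E →L[ℝ] ℝ) u := by
  set m := q u with hm
  -- Replacing n by its upper bound M q^e gives the minorant g ∘ q of the functional, which touches
  -- it at u. The normalization of M says exactly that g' vanishes at q(u), so the increment of the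
  -- minorant is o(w).
  set g : ℝ → ℝ := fun x => 1 / 2 * x - 1 / (2 * e) * (M * x ^ e) with hg
  have hMm : M * m ^ e = m := by
    have : e = e - 1 + 1 := by ring
    rw [this, Real.rpow_add hu0, Real.rpow_one, ← mul_assoc, hM, one_mul]
  have hg0 : HasDerivAt g 0 m := by
    refine (((hasDerivAt_id m).const_mul (1 / 2)).sub
      (((Real.hasDerivAt_rpow_const (p := e) (Or.inl hu0.ne')).const_mul M).const_mul
        (1 / (2 * e)))).congr_deriv ?_
    have h2 : M * (e * m ^ (e - 1)) = e := by linear_combination e * hM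
    rw [h2]
    field_simp
    ring
  have hO : (fun w : E => q (u + w) - m) =O[𝓝 0] (id : E → E) := by
    refine IsBigO.of_bound C ?_
    filter_upwards [Metric.closedBall_mem_nhds (0 : E) one_pos] with w hw
    exact hC w (by simpa using hw)
  have hT : Tendsto (fun w : E => q (u + w)) (𝓝 0) (𝓝 m) := by
    have h1 : Tendsto (id : E → E) (𝓝 0) (𝓝 0) := tendsto_id
    have h2 := hO.trans_tendsto h1
    simpa using h2.add_const m
  have ho : (fun w : E => g (q (u + w)) - g m) =o[𝓝 0] (id : E → E) := by
    have h1 := (hasDerivAt_iff_isLittleO.1 hg0).comp_tendsto hT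
    simp only [smul_zero, sub_zero] at h1
    exact h1.trans_isBigO hO
  refine hasFDerivAt_zero_of_squeeze (C := C') ho (fun w => ?_) (fun w => ?_)
  · have h1 : g m = 1 / 2 * q u - 1 / (2 * e) * n u := by
      simp only [hg]
      rw [hMm, hu]
    have h2 : g (q (u + w)) ≤ 1 / 2 * q (u + w) - 1 / (2 * e) * n (u + w) := by
      simp only [hg]
      have := mul_le_mul_of_nonneg_left (hle (u + w)) (by positivity : 0 ≤ 1 / (2 * e))
      linarith
    linarith
  · have h1 := hpar w
    have h2 := mul_le_mul_of_nonneg_left (hconv w) (by positivity : 0 ≤ 1 / (2 * e))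
    linarith [hC' w]

/-! ### Ground states as optimizers -/

namespace Admissible

theorem exists_abs_G_sub_le {d : ℕ} {σ α ω : ℝ} (H : Admissible d σ α ω) (u : H1 d) :
    ∃ C : ℝ, ∀ w : H1 d, ‖w‖ ≤ 1 → |G σ (u + w) - G σ u| ≤ C * ‖w‖ := by
  obtain ⟨C, hC⟩ : ∃ C : ℝ, ∀ w : H1 d, ‖w‖ ≤ 1 →
      |‖weightL H.sub.one_le H.σ_pos H.σ_lt (u + w)‖ ^ 2
        - ‖weightL H.sub.one_le H.σ_pos H.σ_lt u‖ ^ 2| ≤ C * ‖w‖ :=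
    ⟨_, abs_norm_sq_add_sub_le (weightL H.sub.one_le H.σ_pos H.σ_lt) u⟩
  refine ⟨C, fun w hw => ?_⟩
  simpa only [norm_weightL_sq] using hC w hw

theorem exists_abs_quadForm_sub_le {d : ℕ} {σ α ω : ℝ} (H : Admissible d σ α ω) (u : H1 d) :
    ∃ C : ℝ, ∀ w : H1 d, ‖w‖ ≤ 1 → |quadForm σ ω (u + w) - quadForm σ ω u| ≤ C * ‖w‖ := by
  obtain ⟨C₁, h₁⟩ : ∃ C : ℝ, ∀ w : H1 d, ‖w‖ ≤ 1 →
      |‖grad (u + w)‖ ^ 2 - ‖grad u‖ ^ 2| ≤ C * ‖w‖ :=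
    ⟨_, abs_norm_sq_add_sub_le (gradL d) u⟩
  obtain ⟨C₂, h₂⟩ : ∃ C : ℝ, ∀ w : H1 d, ‖w‖ ≤ 1 →
      |‖fn (u + w)‖ ^ 2 - ‖fn u‖ ^ 2| ≤ C * ‖w‖ :=
    ⟨_, abs_norm_sq_add_sub_le (fnL d) u⟩
  obtain ⟨C₃, h₃⟩ := H.exists_abs_G_sub_le u
  refine ⟨C₁ + C₃ + |ω| * C₂, fun w hw => ?_⟩
  have h4 := mul_le_mul_of_nonneg_left (h₂ w hw) (abs_nonneg ω)
  rw [← abs_mul] at h4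
  have e : quadForm σ ω (u + w) - quadForm σ ω u = (‖grad (u + w)‖ ^ 2 - ‖grad u‖ ^ 2)
      - (G σ (u + w) - G σ u) + ω * (‖fn (u + w)‖ ^ 2 - ‖fn u‖ ^ 2) := by
    simp only [quadForm]
    ring
  rw [e]
  refine (abs_add_le _ _).trans ?_
  have := abs_sub (‖grad (u + w)‖ ^ 2 - ‖grad u‖ ^ 2) (G σ (u + w) - G σ u)
  linarith [h₁ w hw, h₃ w hw]

theorem quadForm_add_add_quadForm_sub {d : ℕ} {σ α ω : ℝ} (H : Admissible d σ α ω) (u w : H1 d) :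
    quadForm σ ω (u + w) + quadForm σ ω (u - w)
      = 2 * quadForm σ ω u + 2 * quadForm σ ω w := by
  have h1 := norm_sq_add_add_norm_sq_sub (gradL d) u w
  have h2 := norm_sq_add_add_norm_sq_sub (weightL H.sub.one_le H.σ_pos H.σ_lt) u w
  have h3 := norm_sq_add_add_norm_sq_sub (fnL d) u w
  simp only [norm_weightL_sq, gradL_apply, fnL_apply] at h1 h2 h3
  unfold quadForm
  linear_combination h1 - h2 + ω * h3

theorem exists_quadForm_le (d : ℕ) (σ ω : ℝ) :
    ∃ C : ℝ, ∀ w : H1 d, quadForm σ ω w ≤ C * ‖w‖ ^ 2 := by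
  refine ⟨1 + |ω|, fun w => ?_⟩
  have h1 := norm_sq_eq w
  have h2 := G_nonneg (σ := σ) w
  have h3 := mul_le_mul_of_nonneg_right (le_abs_self ω) (sq_nonneg ‖fn w‖)
  have h4 := mul_nonneg (abs_nonneg ω) (sq_nonneg ‖grad w‖)
  unfold quadForm
  rw [h1]
  nlinarith [sq_nonneg ‖fn w‖]

set_option maxHeartbeats 800000 in
/-- A rescaled optimizer is a critical point of the action. -/
theorem hasFDerivAt_S {d : ℕ} {σ α ω : ℝ} (H : Admissible d σ α ω) {M : ℝ}
    (hle : ∀ v : H1 d, N α v ≤ M * quadForm σ ω v ^ ((α + 2) / 2)) {u : H1 d}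
    (hu0 : 0 < quadForm σ ω u) (hu : N α u = quadForm σ ω u)
    (hM : M * quadForm σ ω u ^ (α / 2) = 1) :
    HasFDerivAt (S σ α ω) (0 : H1 d →L[ℝ] ℝ) u := by
  have hα := H.sub.pos
  obtain ⟨C, hC⟩ := H.exists_abs_quadForm_sub_le u
  obtain ⟨C', hC'⟩ := exists_quadForm_le d σ ω
  have e : (α + 2) / 2 - 1 = α / 2 := by ring
  have hpos : 0 < (α + 2) / 2 := by linarith
  have hM' : M * quadForm σ ω u ^ ((α + 2) / 2 - 1) = 1 := by rwa [e]
  have h1 := H.quadForm_add_add_quadForm_sub u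
  have h2 := H.sub.two_mul_N_le u
  have key := hasFDerivAt_zero_of_extremal (E := H1 d) (q := quadForm σ ω) (n := N α)
    (M := M) (e := (α + 2) / 2) (C := C) (C' := C') (u := u) hpos hu0 hu
    hM' hle hC h1 hC' h2
  have e2 : 2 * ((α + 2) / 2) = α + 2 := by ring
  rw [e2] at key
  have hS : S σ α ω = fun v : H1 d => 1 / 2 * quadForm σ ω v - 1 / (α + 2) * N α v :=
    funext fun v => S_eq σ α ω v
  rw [hS]
  exact key

/-- Differentiate the action along the ray t ↦ tφ at t = 1. -/
theorem K_eq_zero {d : ℕ} {σ α ω : ℝ} (H : Admissible d σ α ω) {φ : H1 d}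
    (hφ : HasFDerivAt (S σ α ω) (0 : H1 d →L[ℝ] ℝ) φ) : quadForm σ ω φ = N α φ := by
  have hα := H.sub.pos
  have hray : HasDerivAt (fun t : ℝ => t • φ) φ 1 := by
    simpa using (hasDerivAt_id (1 : ℝ)).smul_const φ
  have hφ' : HasFDerivAt (S σ α ω) (0 : H1 d →L[ℝ] ℝ) ((1 : ℝ) • φ) := by rwa [one_smul]
  have h1 : HasDerivAt (fun t : ℝ => S σ α ω (t • φ)) 0 1 := by
    simpa [Function.comp_def] using hφ'.comp_hasDerivAt (1 : ℝ) hray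
  have h2 : HasDerivAt (fun t : ℝ => 1 / 2 * (t ^ 2 * quadForm σ ω φ)
      - 1 / (α + 2) * (t ^ (α + 2) * N α φ)) (quadForm σ ω φ - N α φ) 1 := by
    refine ((((hasDerivAt_pow 2 (1 : ℝ)).mul_const (quadForm σ ω φ)).const_mul (1 / 2)).sub
      (((Real.hasDerivAt_rpow_const (x := 1) (p := α + 2) (Or.inl one_ne_zero)).mul_const
        (N α φ)).const_mul (1 / (α + 2)))).congr_deriv ?_
    have : α + 2 ≠ 0 := by linarith
    rw [Real.one_rpow]
    field_simp
    norm_num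
    ring
  have h3 : (fun t : ℝ => S σ α ω (t • φ)) =ᶠ[𝓝 1] fun t : ℝ => 1 / 2 * (t ^ 2 * quadForm σ ω φ)
      - 1 / (α + 2) * (t ^ (α + 2) * N α φ) := by
    filter_upwards [lt_mem_nhds (zero_lt_one (α := ℝ))] with t ht
    rw [S_eq, quadForm_smul, H.sub.N_smul, abs_of_pos ht]
  have := (h1.congr_of_eventuallyEq h3.symm).unique h2
  linarith

/-- Ground states realize the best constant `M`. -/
theorem exists_of_mem_groundStates {d : ℕ} {σ α ω : ℝ} (H : Admissible d σ α ω) {φ : H1 d}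
    (hφ : φ ∈ groundStates d σ α ω) :
    ∃ M : ℝ, 0 < M ∧ (∀ v : H1 d, N α v ≤ M * quadForm σ ω v ^ ((α + 2) / 2)) ∧
      M * quadForm σ ω φ ^ (α / 2) = 1 := by
  obtain ⟨⟨hφ0, hφc⟩, hmin⟩ := hφ
  have hα := H.sub.pos
  obtain ⟨M, hM, hle, u, hu1, hu2⟩ := H.exists_maximizer hφ0
  refine ⟨M, hM, hle, ?_⟩
  have hK := H.K_eq_zero hφc
  have hq := H.quadForm_pos hφ0
  -- The multiple of the maximizer on which N = q: this requires t^{α+2} M = t², that is t^α = 1/M.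
  set t : ℝ := M ^ (-(1 / α)) with ht
  have ht0 : 0 < t := by positivity
  have htα : t ^ α = M⁻¹ := by
    rw [ht, ← Real.rpow_mul hM.le, neg_mul, one_div, inv_mul_cancel₀ hα.ne', Real.rpow_neg_one]
  have hqt : quadForm σ ω (t • u) = t ^ 2 := by rw [quadForm_smul, hu1, mul_one]
  have hNt : N α (t • u) = t ^ 2 := by
    rw [H.sub.N_smul, abs_of_pos ht0, Real.rpow_add ht0, htα, hu2, Real.rpow_two]
    field_simp
  have hMt : M * (t ^ 2) ^ (α / 2) = 1 := by
    rw [← Real.rpow_natCast, ← Real.rpow_mul ht0.le]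
    have : ((2 : ℕ) : ℝ) * (α / 2) = α := by
      push_cast
      ring
    rw [this, htα, mul_inv_cancel₀ hM.ne']
  have hcrit : t • u ∈ criticalPoints d σ α ω := by
    refine ⟨fun h0 => ?_, ?_⟩
    · have h1 := quadForm_smul (d := d) (σ := σ) (ω := ω) 0 0
      rw [smul_zero] at h1
      rw [h0, h1] at hqt
      have : 0 < t ^ 2 := by positivity
      linarith
    · refine H.hasFDerivAt_S hle ?_ ?_ ?_
      · rw [hqt]
        positivity
      · rw [hqt, hNt]
      · rw [hqt, hMt]
  have hS := hmin _ hcrit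
  rw [S_eq, S_eq, ← hK, hqt, hNt] at hS
  -- When N = q the action equals (1/2 - 1/(α+2)) q, so minimality of S at φ compares the values of
  -- q. It yields M q(φ)^{α/2} ≤ 1; the reverse is the inequality N ≤ M q^e at φ itself.
  have hle2 : quadForm σ ω φ ≤ t ^ 2 := by
    have hc : 0 < 1 / 2 - 1 / (α + 2) := by
      have : 1 / (α + 2) < 1 / 2 := by
        apply one_div_lt_one_div_of_lt <;> linarith
      linarith
    nlinarith
  refine le_antisymm ?_ ?_
  · rw [← hMt]
    gcongr
  · have h1 := hle φ
    rw [← hK] at h1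
    have e : (α + 2) / 2 = α / 2 + 1 := by ring
    rw [e, Real.rpow_add hq, Real.rpow_one, ← mul_assoc] at h1
    exact le_of_mul_le_mul_right (by linarith) hq

/-- Ground states minimize `N` below the Nehari manifold. -/
theorem quadForm_le_of_K_nonpos {d : ℕ} {σ α ω : ℝ} (H : Admissible d σ α ω) {M : ℝ}
    (hM0 : 0 < M) (hle : ∀ v : H1 d, N α v ≤ M * quadForm σ ω v ^ ((α + 2) / 2)) {m : ℝ}
    (hm : 0 < m) (hM : M * m ^ (α / 2) = 1) {v : H1 d} (hv : v ≠ 0) (hK : K σ α ω v ≤ 0) :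
    m ≤ quadForm σ ω v := by
  have hα := H.sub.pos
  have hq := H.quadForm_pos hv
  rw [K_eq] at hK
  have h1 := hle v
  have e : (α + 2) / 2 = α / 2 + 1 := by ring
  rw [e, Real.rpow_add hq, Real.rpow_one, ← mul_assoc] at h1
  have h2 : 1 ≤ M * quadForm σ ω v ^ (α / 2) := le_of_mul_le_mul_right (by linarith) hq
  rw [← hM] at h2
  exact (Real.rpow_le_rpow_iff hm.le hq.le (by positivity)).1 (le_of_mul_le_mul_left h2 hM0)

end Admissible

end

end InversePowerNLS

namespace InversePowerNLS

open MeasureTheory Filter Topology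
open scoped ENNReal NNReal

noncomputable section

/-! ### Scaling -/

theorem norm_sq_eq_integral {X E : Type*} [MeasurableSpace X] [NormedAddCommGroup E]
    {ν : Measure X} (f : Lp E 2 ν) : ‖f‖ ^ 2 = ∫ x, ‖f x‖ ^ 2 ∂ν := by
  have h1 := lintegral_enorm_rpow_two f
  have hm : AEStronglyMeasurable (fun x => ‖f x‖ ^ 2) ν := (Lp.aestronglyMeasurable f).norm.pow 2
  rw [integral_eq_lintegral_of_nonneg_ae (Eventually.of_forall fun x => by positivity) hm]
  have e : ∀ x, ENNReal.ofReal (‖f x‖ ^ 2) = ‖f x‖ₑ ^ (2 : ℝ) := fun x => by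
    rw [ENNReal.ofReal_pow (norm_nonneg _), ofReal_norm, ENNReal.rpow_two]
  simp only [e]
  rw [h1, ENNReal.toReal_ofReal (by positivity)]

theorem fn_scale_ae {d : ℕ} (v : H1 d) {lam : ℝ} (hlam : 0 < lam) :
    (fn (scale lam v) : Space d → ℂ) =ᵐ[volume]
      fun x => lam ^ ((d : ℝ) / 2) • fn v (lam • x) := by
  have : fn (scale lam v) = (memLp_scale_fn v hlam).toLp := by
    simp only [scale, hlam, dif_pos]
    rfl
  rw [this]
  exact (memLp_scale_fn v hlam).coeFn_toLp

theorem grad_scale_ae {d : ℕ} (v : H1 d) {lam : ℝ} (hlam : 0 < lam) :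
    (grad (scale lam v) : Space d → EuclideanSpace ℂ (Fin d)) =ᵐ[volume]
      fun x => lam ^ ((d : ℝ) / 2 + 1) • grad v (lam • x) := by
  have : grad (scale lam v) = (memLp_scale_grad v hlam).toLp := by
    simp only [scale, hlam, dif_pos]
    rfl
  rw [this]
  exact (memLp_scale_grad v hlam).coeFn_toLp

theorem integral_dilation {d : ℕ} (f : Space d → ℝ) {lam : ℝ} (hlam : 0 < lam) :
    ∫ x : Space d, f (lam • x) = lam ^ (-(d : ℝ)) * ∫ x, f x := by
  rw [Measure.integral_comp_smul, finrank_euclideanSpace, Fintype.card_fin, smul_eq_mul,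
    abs_of_pos (by positivity), Real.rpow_neg hlam.le, Real.rpow_natCast]

theorem norm_fn_scale_sq {d : ℕ} (v : H1 d) {lam : ℝ} (hlam : 0 < lam) :
    ‖fn (scale lam v)‖ ^ 2 = ‖fn v‖ ^ 2 := by
  rw [norm_sq_eq_integral, norm_sq_eq_integral]
  have h1 : ∫ x, ‖fn (scale lam v) x‖ ^ 2 = ∫ x, lam ^ (d : ℝ) * ‖fn v (lam • x)‖ ^ 2 := by
    refine integral_congr_ae ?_
    filter_upwards [fn_scale_ae v hlam] with x hx
    rw [hx, norm_smul, mul_pow, Real.norm_of_nonneg (by positivity), ← Real.rpow_natCast,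
      ← Real.rpow_mul hlam.le]
    congr 2
    push_cast
    ring
  rw [h1, integral_const_mul, integral_dilation (fun x => ‖fn v x‖ ^ 2) hlam, ← mul_assoc,
    ← Real.rpow_add hlam]
  simp

theorem norm_grad_scale_sq {d : ℕ} (v : H1 d) {lam : ℝ} (hlam : 0 < lam) :
    ‖grad (scale lam v)‖ ^ 2 = lam ^ (2 : ℝ) * ‖grad v‖ ^ 2 := by
  rw [norm_sq_eq_integral, norm_sq_eq_integral]
  have h1 : ∫ x, ‖grad (scale lam v) x‖ ^ 2
      = ∫ x, lam ^ ((d : ℝ) + 2) * ‖grad v (lam • x)‖ ^ 2 := by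
    refine integral_congr_ae ?_
    filter_upwards [grad_scale_ae v hlam] with x hx
    rw [hx, norm_smul, mul_pow, Real.norm_of_nonneg (by positivity), ← Real.rpow_natCast,
      ← Real.rpow_mul hlam.le]
    congr 2
    push_cast
    ring
  rw [h1, integral_const_mul, integral_dilation (fun x => ‖grad v x‖ ^ 2) hlam, ← mul_assoc,
    ← Real.rpow_add hlam]
  congr 2
  ring

theorem G_scale {d : ℕ} {σ : ℝ} (v : H1 d) {lam : ℝ} (hlam : 0 < lam) :
    G σ (scale lam v) = lam ^ σ * G σ v := by
  unfold G
  have h1 : ∫ x, ‖x‖ ^ (-σ) * ‖fn (scale lam v) x‖ ^ 2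
      = ∫ x, lam ^ ((d : ℝ) + σ) * (‖lam • x‖ ^ (-σ) * ‖fn v (lam • x)‖ ^ 2) := by
    refine integral_congr_ae ?_
    filter_upwards [fn_scale_ae v hlam] with x hx
    have e1 : ‖lam • x‖ ^ (-σ) = lam ^ (-σ) * ‖x‖ ^ (-σ) := by
      rw [norm_smul, Real.norm_of_nonneg hlam.le, Real.mul_rpow hlam.le (norm_nonneg _)]
    have e2 : (lam ^ ((d : ℝ) / 2)) ^ 2 = lam ^ ((d : ℝ) + σ) * lam ^ (-σ) := by
      rw [← Real.rpow_natCast, ← Real.rpow_mul hlam.le, ← Real.rpow_add hlam]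
      congr 1
      push_cast
      ring
    rw [hx, norm_smul, mul_pow, Real.norm_of_nonneg (by positivity), e1, e2]
    ring
  rw [h1, integral_const_mul,
    integral_dilation (fun x => ‖x‖ ^ (-σ) * ‖fn v x‖ ^ 2) hlam, ← mul_assoc,
    ← Real.rpow_add hlam]
  congr 2
  ring

theorem N_scale {d : ℕ} {α : ℝ} (v : H1 d) {lam : ℝ} (hlam : 0 < lam) :
    N α (scale lam v) = lam ^ ((d : ℝ) * α / 2) * N α v := by
  unfold N
  have h1 : ∫ x, ‖fn (scale lam v) x‖ ^ (α + 2)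
      = ∫ x, lam ^ ((d : ℝ) / 2 * (α + 2)) * ‖fn v (lam • x)‖ ^ (α + 2) := by
    refine integral_congr_ae ?_
    filter_upwards [fn_scale_ae v hlam] with x hx
    rw [hx, norm_smul, Real.norm_of_nonneg (by positivity),
      Real.mul_rpow (by positivity) (norm_nonneg _), ← Real.rpow_mul hlam.le]
  rw [h1, integral_const_mul,
    integral_dilation (fun x => ‖fn v x‖ ^ (α + 2)) hlam, ← mul_assoc,
    ← Real.rpow_add hlam]
  congr 2
  ring

theorem quadForm_scale {d : ℕ} {σ ω : ℝ} (v : H1 d) {lam : ℝ} (hlam : 0 < lam) :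
    quadForm σ ω (scale lam v)
      = lam ^ (2 : ℝ) * ‖grad v‖ ^ 2 - lam ^ σ * G σ v + ω * ‖fn v‖ ^ 2 := by
  rw [quadForm, norm_grad_scale_sq v hlam, norm_fn_scale_sq v hlam, G_scale v hlam]

theorem scale_ne_zero {d : ℕ} {v : H1 d} (hv : v ≠ 0) {lam : ℝ} (hlam : 0 < lam) :
    scale lam v ≠ 0 := by
  intro h0
  have h1 := norm_fn_scale_sq v hlam
  rw [h0] at h1
  have h2 : fn (0 : H1 d) = 0 := rfl
  rw [h2, norm_zero, zero_pow two_ne_zero, eq_comm, sq_eq_zero_iff, norm_eq_zero] at h1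
  exact hv (eq_zero_of_fn_eq_zero h1)

/-- Second derivative of the action along the scaling. -/
theorem iteratedDeriv_two_S_scale {d : ℕ} {σ α ω : ℝ} (φ : H1 d) :
    iteratedDeriv 2 (fun lam : ℝ => S σ α ω (scale lam φ)) 1
      = ‖grad φ‖ ^ 2 - σ * (σ - 1) / 2 * G σ φ
        - (d * α / 2) * (d * α / 2 - 1) / (α + 2) * N α φ := by
  set X := ‖grad φ‖ ^ 2
  set Y := G σ φ
  set P := N α φ
  set β : ℝ := d * α / 2 with hβ
  -- The explicit formula holds only for λ > 0, as `scale` is 0 elsewhere; agreement near 1 is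
  -- enough for the derivatives.
  have h0 : (fun lam : ℝ => S σ α ω (scale lam φ)) =ᶠ[𝓝 1] fun lam : ℝ =>
      1 / 2 * (lam ^ (2 : ℝ) * X - lam ^ σ * Y + ω * ‖fn φ‖ ^ 2)
        - 1 / (α + 2) * (lam ^ β * P) := by
    filter_upwards [lt_mem_nhds (zero_lt_one (α := ℝ))] with t ht
    rw [S_eq, quadForm_scale φ ht, N_scale φ ht]
  rw [h0.iteratedDeriv_eq, iteratedDeriv_succ, iteratedDeriv_one]
  have h1 : deriv (fun lam : ℝ => 1 / 2 * (lam ^ (2 : ℝ) * X - lam ^ σ * Y + ω * ‖fn φ‖ ^ 2)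
        - 1 / (α + 2) * (lam ^ β * P)) =ᶠ[𝓝 1] fun lam : ℝ =>
      1 / 2 * (2 * lam ^ ((2 : ℝ) - 1) * X - σ * lam ^ (σ - 1) * Y)
        - 1 / (α + 2) * (β * lam ^ (β - 1) * P) := by
    filter_upwards [lt_mem_nhds (zero_lt_one (α := ℝ))] with t ht
    have r := fun p : ℝ => Real.hasDerivAt_rpow_const (x := t) (p := p) (Or.inl ht.ne')
    exact ((((((r 2).mul_const X).sub ((r σ).mul_const Y)).add_const _).const_mul (1 / 2)).sub
      (((r β).mul_const P).const_mul (1 / (α + 2)))).deriv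
  rw [h1.deriv_eq]
  have r := fun p : ℝ => Real.hasDerivAt_rpow_const (x := 1) (p := p) (Or.inl one_ne_zero)
  have h2 := ((((((r (2 - 1)).const_mul 2).mul_const X).sub
    (((r (σ - 1)).const_mul σ).mul_const Y)).const_mul (1 / 2)).sub
      ((((r (β - 1)).const_mul β).mul_const P).const_mul (1 / (α + 2)))).deriv
  rw [Real.one_rpow, Real.one_rpow, Real.one_rpow] at h2
  refine h2.trans ?_
  ring

/-- The virial identity for ground states. -/
theorem Admissible.Q_eq_zero {d : ℕ} {σ α ω : ℝ} (H : Admissible d σ α ω) {φ : H1 d} {M : ℝ}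
    (hle : ∀ v : H1 d, N α v ≤ M * quadForm σ ω v ^ ((α + 2) / 2))
    (hq : 0 < quadForm σ ω φ) (hK : quadForm σ ω φ = N α φ)
    (hM : M * quadForm σ ω φ ^ (α / 2) = 1) : Q σ α φ = 0 := by
  have hα := H.sub.pos
  set X := ‖grad φ‖ ^ 2 with hX
  set Y := G σ φ with hY
  set Z := ω * ‖fn φ‖ ^ 2 with hZ
  set P := N α φ with hP
  set β : ℝ := d * α / 2 with hβ
  have hsum : quadForm σ ω φ = X - Y + Z := rfl
  -- The defect M q(φ^t)^e - N(φ^t), nonnegative for t > 0 and zero at t = 1. Its vanishing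
  -- derivative there is a multiple of the identity Q(φ) = 0.
  set F : ℝ → ℝ := fun t =>
    M * (t ^ (2 : ℝ) * X - t ^ σ * Y + Z) ^ ((α + 2) / 2) - t ^ β * P with hF
  have hF1 : F 1 = 0 := by
    simp only [hF, Real.one_rpow, one_mul]
    rw [← hsum]
    have : (α + 2) / 2 = α / 2 + 1 := by ring
    rw [this, Real.rpow_add hq, Real.rpow_one, ← mul_assoc, hM, one_mul, hK, sub_self]
  have hmin : IsLocalMin F 1 := by
    filter_upwards [lt_mem_nhds (zero_lt_one (α := ℝ))] with t ht
    rw [hF1]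
    have := hle (scale t φ)
    rw [quadForm_scale φ ht, N_scale φ ht] at this
    simp only [hF]
    linarith
  have r := fun p : ℝ => Real.hasDerivAt_rpow_const (x := 1) (p := p) (Or.inl one_ne_zero)
  have hA : HasDerivAt (fun t : ℝ => t ^ (2 : ℝ) * X - t ^ σ * Y + Z) (2 * X - σ * Y) 1 := by
    have := (((r 2).mul_const X).sub ((r σ).mul_const Y)).add_const Z
    simpa using this
  have hne : (1 : ℝ) ^ (2 : ℝ) * X - (1 : ℝ) ^ σ * Y + Z ≠ 0 := by
    rw [Real.one_rpow, Real.one_rpow, one_mul, one_mul, ← hsum]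
    exact hq.ne'
  have hder : HasDerivAt F (M * ((2 * X - σ * Y) * ((α + 2) / 2) *
      ((1 : ℝ) ^ (2 : ℝ) * X - (1 : ℝ) ^ σ * Y + Z) ^ ((α + 2) / 2 - 1))
      - β * (1 : ℝ) ^ (β - 1) * P) 1 :=
    ((hA.rpow_const (p := (α + 2) / 2) (Or.inl hne)).const_mul M).sub ((r β).mul_const P)
  have h0 := hmin.hasDerivAt_eq_zero hder
  rw [Real.one_rpow, Real.one_rpow, Real.one_rpow, one_mul, one_mul, ← hsum] at h0
  have e : (α + 2) / 2 - 1 = α / 2 := by ring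
  rw [e] at h0
  have h1 : (2 * X - σ * Y) * ((α + 2) / 2) = β * P := by
    linear_combination h0 - (2 * X - σ * Y) * ((α + 2) / 2) * hM
  have : α + 2 ≠ 0 := by linarith
  change X - σ / 2 * Y - β / (α + 2) * P = 0
  have h2 : β / (α + 2) * P = X - σ / 2 * Y := by
    rw [div_mul_eq_mul_div, div_eq_iff this]
    linear_combination -h1
  rw [h2, sub_self]

end

end InversePowerNLS

namespace InversePowerNLS

open MeasureTheory Filter Topology
open scoped ENNReal NNReal

noncomputable section

/-! ### The main inequality -/

/-- Bernoulli: the concave power s^a lies below its tangent at s = 1. -/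
theorem one_sub_add_mul_sub_rpow_nonneg {a s : ℝ} (ha0 : 0 < a) (ha1 : a < 1) (hs : 0 < s) :
    0 ≤ 1 - a + a * s - s ^ a := by
  have := rpow_one_add_le_one_add_mul_self (s := s - 1) (by linarith) ha0.le ha1.le
  rw [add_sub_cancel] at this
  linarith

/-- An elementary inequality comparing the defects of the powers `s^a` and `s^b`,
`0 < a < 1 < b`, from their tangent lines at `s = 1`. -/
theorem mul_rpow_mul_le {a b s : ℝ} (ha0 : 0 < a) (ha1 : a < 1) (hb : 1 < b) (hs0 : 0 < s)
    (hs1 : s ≤ 1) :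
    (b - 1) * (b - a) * s ^ b * (1 - a + a * s - s ^ a)
      ≤ a * ((b - 1) * (s ^ a - s) - (1 - a) * (s - s ^ b)) := by
  -- D is right side minus left side, divided by t^b. This division makes D' factor as
  -- -a(b-1)(b-a)(t^{-b} - 1)(t^{a-1} - 1), so D decreases to D(1) = 0 on (0, 1].
  set D : ℝ → ℝ := fun t => a * (b - 1) * (t ^ (a - b) - t ^ (1 - b))
    - a * (1 - a) * (t ^ (1 - b) - 1) - (b - 1) * (b - a) * (1 - a + a * t - t ^ a) with hD
  set D' : ℝ → ℝ := fun t => a * (b - 1) * ((a - b) * t ^ (a - b - 1) - (1 - b) * t ^ (1 - b - 1))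
    - a * (1 - a) * ((1 - b) * t ^ (1 - b - 1)) - (b - 1) * (b - a) * (a - a * t ^ (a - 1)) with hD'
  have hder : ∀ t : ℝ, 0 < t → HasDerivAt D (D' t) t := by
    intro t ht
    have r := fun p : ℝ => Real.hasDerivAt_rpow_const (x := t) (p := p) (Or.inl ht.ne')
    refine (((((r (a - b)).sub (r (1 - b))).const_mul (a * (b - 1))).sub
      (((r (1 - b)).sub_const 1).const_mul (a * (1 - a)))).sub
      (((((hasDerivAt_id t).const_mul a).const_add (1 - a)).sub (r a)).const_mul
        ((b - 1) * (b - a)))).congr_deriv ?_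
    simp only [hD', mul_one]
  have hanti : AntitoneOn D (Set.Icc s 1) := by
    refine antitoneOn_of_deriv_nonpos (convex_Icc s 1)
      (fun t ht => (hder t (hs0.trans_le ht.1)).continuousAt.continuousWithinAt) ?_ ?_
    · intro t ht
      rw [interior_Icc] at ht
      exact (hder t (hs0.trans ht.1)).differentiableAt.differentiableWithinAt
    · intro t ht
      rw [interior_Icc] at ht
      have ht0 := hs0.trans ht.1
      rw [(hder t ht0).deriv]
      have e1 : t ^ (a - b - 1) = t ^ (-b) * t ^ (a - 1) := by
        rw [← Real.rpow_add ht0]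
        congr 1
        ring
      have e2 : t ^ (1 - b - 1) = t ^ (-b) := by
        congr 1
        ring
      have h1 : 1 ≤ t ^ (-b) :=
        Real.one_le_rpow_of_pos_of_le_one_of_nonpos ht0 ht.2.le (by linarith)
      have h2 : 1 ≤ t ^ (a - 1) :=
        Real.one_le_rpow_of_pos_of_le_one_of_nonpos ht0 ht.2.le (by linarith)
      have e3 : D' t = -(a * (b - 1) * (b - a) * ((t ^ (-b) - 1) * (t ^ (a - 1) - 1))) := by
        simp only [hD', e1, e2]
        ring
      rw [e3, neg_nonpos]
      have hb1 : 0 ≤ b - 1 := by linarith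
      have hba : 0 ≤ b - a := by linarith
      exact mul_nonneg (by positivity) (mul_nonneg (by linarith) (by linarith))
  have h0 : 0 ≤ D s := by
    have h1 := hanti ⟨le_rfl, hs1⟩ ⟨hs1, le_rfl⟩ hs1
    have h2 : D 1 = 0 := by
      simp only [hD, Real.one_rpow]
      ring
    rwa [h2] at h1
  have hsb : 0 < s ^ b := by positivity
  have h3 := mul_nonneg hsb.le h0
  have e1 : s ^ b * s ^ (a - b) = s ^ a := by
    rw [← Real.rpow_add hs0, add_sub_cancel]
  have e2 : s ^ b * s ^ (1 - b) = s := by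
    rw [← Real.rpow_add hs0, add_sub_cancel, Real.rpow_one]
  have e3 : s ^ b * D s = a * ((b - 1) * (s ^ a - s) - (1 - a) * (s - s ^ b))
      - (b - 1) * (b - a) * s ^ b * (1 - a + a * s - s ^ a) := by
    simp only [hD]
    linear_combination a * (b - 1) * e1 - (a * (b - 1) + a * (1 - a)) * e2
  linarith

/-- Multiply the bound on g by the nonnegative defect 1 - a + as - s^a. After cancelling a(s^a - as)
> 0, what is needed is a rearrangement of `mul_rpow_mul_le`. -/
theorem mul_defect_le {a b s g n : ℝ} (ha0 : 0 < a) (ha1 : a < 1) (hb : 1 < b) (hs0 : 0 < s)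
    (hs1 : s ≤ 1) (hn : 0 ≤ n)
    (h : a * (s ^ a - a * s) * g ≤ 2 * b * n * (a * s + (b - 1 - a) * s ^ b)) :
    g * (1 - a + a * s - s ^ a) ≤ 2 * n * (b - 1 - b * s + s ^ b) := by
  have hH := one_sub_add_mul_sub_rpow_nonneg ha0 ha1 hs0
  have hE := mul_rpow_mul_le ha0 ha1 hb hs0 hs1
  have hX : s ≤ s ^ a := by
    simpa using Real.rpow_le_rpow_of_exponent_ge hs0 hs1 ha1.le
  have hpos : 0 < a * (s ^ a - a * s) := mul_pos ha0 (by nlinarith)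
  set X := s ^ a
  set Y := s ^ b
  have h1 := mul_le_mul_of_nonneg_right h hH
  have h2 : b * (a * s + (b - 1 - a) * Y) * (1 - a + a * s - X)
      ≤ a * (X - a * s) * (b - 1 - b * s + Y) := by linear_combination hE
  have h3 := mul_le_mul_of_nonneg_left h2 (by linarith : 0 ≤ 2 * n)
  refine le_of_mul_le_mul_left ?_ hpos
  linear_combination h1 + h3

theorem fn_norm_pos {d : ℕ} {v : H1 d} (hv : v ≠ 0) : 0 < ‖fn v‖ :=
  norm_pos_iff.2 fun h => hv (eq_zero_of_fn_eq_zero h)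

/-! ### The variational estimate -/

namespace Admissible

theorem Q_le_two_mul_S_sub {d : ℕ} {σ α ω : ℝ} (H : Admissible d σ α ω) (hα4 : 4 < d * α)
    {φ : H1 d} (hφ : φ ∈ groundStates d σ α ω)
    (hφ2 : iteratedDeriv 2 (fun lam : ℝ => S σ α ω (scale lam φ)) 1 ≤ 0) {v : H1 d} (hv : v ≠ 0)
    (hvφ : ‖fn v‖ ≤ ‖fn φ‖) (hK : K σ α ω v ≤ 0) (hQ : Q σ α v ≤ 0) :
    Q σ α v ≤ 2 * (S σ α ω v - S σ α ω φ) := by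
  have hα := H.sub.pos
  have hφ0 : φ ≠ 0 := hφ.1.1
  obtain ⟨M, hM0, hle, hM⟩ := H.exists_of_mem_groundStates hφ
  have hKφ := H.K_eq_zero hφ.1.2
  have hqφ := H.quadForm_pos hφ0
  have hQφ := H.Q_eq_zero hle hqφ hKφ hM
  rw [iteratedDeriv_two_S_scale] at hφ2
  have hmv := H.quadForm_le_of_K_nonpos hM0 hle hqφ hM hv hK
  -- With s = λ² the three terms scale as s, s^a and s^b; mass supercriticality is b > 1.
  obtain ⟨a, ha⟩ : ∃ a : ℝ, σ = 2 * a := ⟨σ / 2, by ring⟩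
  obtain ⟨b, hb⟩ : ∃ b : ℝ, (d : ℝ) * α / 2 = 2 * b := ⟨d * α / 2 / 2, by ring⟩
  have ha0 : 0 < a := by linarith [H.σ_pos]
  have ha1 : a < 1 := by linarith [H.σ_lt, min_le_left 2 (d : ℝ)]
  have hb1 : 1 < b := by linarith
  have hbα : 2 * b < α + 2 := by
    have h1 := H.sub.lt
    have hd : (0 : ℝ) < d := by exact_mod_cast H.sub.one_le
    have h2 : α < 2 * (α + 2) / d := by linarith
    rw [lt_div_iff₀ hd] at h2
    linarith
  have hKv := hK
  rw [K_eq] at hKv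
  have hNφ : 0 < N α φ := hKφ ▸ hqφ
  have hNv : N α φ ≤ N α v := by linarith
  have hNv0 : 0 < N α v := hNφ.trans_le hNv
  -- The dilation λ = √s gives N(v^λ) = N(φ); s ≤ 1 because N(φ) = q(φ) ≤ q(v) ≤ N(v).
  set s : ℝ := (N α φ / N α v) ^ (1 / b) with hs
  have hr0 : 0 < N α φ / N α v := by positivity
  have hs0 : 0 < s := by positivity
  have hs1 : s ≤ 1 := Real.rpow_le_one hr0.le ((div_le_one hNv0).2 hNv) (by positivity)
  have hsb : s ^ b * N α v = N α φ := by
    rw [hs, ← Real.rpow_mul hr0.le, one_div, inv_mul_cancel₀ (by linarith), Real.rpow_one,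
      div_mul_cancel₀ _ hNv0.ne']
  have hl0 : 0 < s ^ (1 / 2 : ℝ) := by positivity
  have hpow : ∀ p : ℝ, (s ^ (1 / 2 : ℝ)) ^ (2 * p) = s ^ p := fun p => by
    rw [← Real.rpow_mul hs0.le]
    congr 1
    ring
  have hq := quadForm_scale (σ := σ) (ω := ω) v hl0
  have hN := N_scale (α := α) v hl0
  have hpow1 : (s ^ (1 / 2 : ℝ)) ^ (2 : ℝ) = s := by simpa using hpow 1
  rw [hb, hpow, hsb] at hN
  rw [hpow1, ha, hpow, ← ha] at hq
  -- Otherwise K_ω(v^λ) < 0, and the minimality of q(φ) would give N(φ) = q(φ) ≤ q(v^λ) < N(φ).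
  have hKs : N α φ ≤ quadForm σ ω (scale (s ^ (1 / 2 : ℝ)) v) := by
    by_contra! hlt
    have := H.quadForm_le_of_K_nonpos hM0 hle hqφ hM (scale_ne_zero hv hl0)
      (by rw [K_eq, hN]; linarith)
    linarith
  rw [hq] at hKs
  have hα2 : 0 < α + 2 := by linarith
  obtain ⟨n, hn⟩ : ∃ n : ℝ, N α v = (α + 2) * n := ⟨N α v / (α + 2), by field_simp⟩
  have hn0 : 0 < n := by
    rw [hn] at hNv0
    exact pos_of_mul_pos_right hNv0 hα2.le
  have hnφ : N α φ = (α + 2) * (s ^ b * n) := by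
    rw [← hsb, hn]
    ring
  have hdiv : ∀ c x : ℝ, c / (α + 2) * ((α + 2) * x) = c * x := fun c x => by field_simp
  unfold Q at hQφ hQ ⊢
  rw [hb, ha, hnφ, hdiv] at hQφ hφ2
  rw [hb, hn, hdiv] at hQ ⊢
  rw [S_eq, S_eq, hKφ, hnφ, hn, hdiv, hdiv]
  unfold quadForm at hKφ ⊢
  rw [hnφ] at hKφ hKs
  rw [ha] at *
  have hY : 0 < s ^ b := by positivity
  have hGφ := G_nonneg (σ := 2 * a) φ
  set Y := s ^ b
  set X := s ^ a
  -- Eliminates the gradient of φ between the Nehari identity and Q(φ) = 0. The right side is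
  -- nonnegative because 2b < α + 2, which forces ω ≥ 0; only then does the mass condition survive
  -- multiplication by ω.
  have hωφ : ω * ‖fn φ‖ ^ 2 = (1 - a) * G (2 * a) φ + (α + 2 - 2 * b) * (Y * n) := by
    linear_combination hKφ - hQφ
  have hω0 : 0 ≤ ω := by
    have h1 : 0 ≤ ω * ‖fn φ‖ ^ 2 := by
      rw [hωφ]
      exact add_nonneg (mul_nonneg (by linarith) hGφ) (mul_nonneg (by linarith) (by positivity))
    have := fn_norm_pos hφ0
    exact nonneg_of_mul_nonneg_left h1 (by positivity)
  have hωv : ω * ‖fn v‖ ^ 2 ≤ ω * ‖fn φ‖ ^ 2 := by gcongr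
  -- The second derivative condition after removing ‖∇φ‖² with Q(φ) = 0; here Y n = N(φ)/(α+2).
  have hcurv : a * ((1 - a) * G (2 * a) φ) ≤ 2 * b * (b - 1) * (Y * n) := by
    linear_combination 1 / 2 * hφ2 - 1 / 2 * hQφ
  have hmain := mul_defect_le (g := G (2 * a) v) ha0 ha1 hb1 hs0 hs1 hn0.le (by
    have h1 := mul_le_mul_of_nonneg_left hQ hs0.le
    -- Q(v) ≤ 0 bounds s‖∇v‖² from above, the lower bound on q(v^λ) then bounds s^a G(v), and the
    -- mass condition replaces ω‖v‖² by quantities of φ. The curvature bound afterwards removes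
    -- G(φ).
    have h2 : (X - a * s) * G (2 * a) v
        ≤ 2 * b * n * s + ((1 - a) * G (2 * a) φ - 2 * b * (Y * n)) := by
      linear_combination h1 + hωv + hωφ + hKs
    have h3 := mul_le_mul_of_nonneg_left h2 ha0.le
    linear_combination h3 + hcurv)
  have hsQ := mul_nonpos_of_nonneg_of_nonpos hs0.le hQ
  linear_combination hmain + hKs + hsQ

end Admissible

theorem subcritical_of_lt {d : ℕ} {α : ℝ} (hd : 1 ≤ d) (hα : 0 < α)
    (hα' : 3 ≤ d → α < 4 / ((d : ℝ) - 2)) : Subcritical d α := by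
  refine ⟨hd, hα, ?_⟩
  have hd0 : (0 : ℝ) < d := by exact_mod_cast hd
  suffices h : α * d < 2 * (α + 2) by
    have := (lt_div_iff₀ hd0).2 h
    linarith
  rcases Nat.lt_or_ge d 3 with h | h
  · have h2 : (d : ℝ) ≤ 2 := by exact_mod_cast Nat.le_of_lt_succ h
    nlinarith
  · have h3 : (3 : ℝ) ≤ d := by exact_mod_cast h
    have := (lt_div_iff₀ (by linarith)).1 (hα' h)
    linarith

end

end InversePowerNLS

theorem mainTheorem6 (d : ℕ) (hd : 1 ≤ d) (σ α ω : ℝ)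
    (hσ0 : 0 < σ) (hσ : σ < min 2 (d : ℝ))
    (hα : 4 / (d : ℝ) < α) (hα' : 3 ≤ d → α < 4 / ((d : ℝ) - 2))
    (hω : -InversePowerNLS.mu1 d σ < ω)
    (φ : InversePowerNLS.H1 d) (hφ : φ ∈ InversePowerNLS.groundStates d σ α ω)
    (hφ2 : iteratedDeriv 2
      (fun lam : ℝ => InversePowerNLS.S σ α ω (InversePowerNLS.scale lam φ)) 1 ≤ 0)
    (v : InversePowerNLS.H1 d) (hv : v ≠ 0)
    (hvφ : ‖InversePowerNLS.fn v‖ ≤ ‖InversePowerNLS.fn φ‖)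
    (hK : InversePowerNLS.K σ α ω v ≤ 0) (hQ : InversePowerNLS.Q σ α v ≤ 0) :
    InversePowerNLS.Q σ α v
      ≤ 2 * (InversePowerNLS.S σ α ω v - InversePowerNLS.S σ α ω φ) := by
  have hd0 : (0 : ℝ) < d := by exact_mod_cast hd
  have hα0 : 0 < α := lt_trans (by positivity) hα
  have hα4 : 4 < d * α := by
    rw [div_lt_iff₀ hd0] at hα
    linarith
  exact InversePowerNLS.Admissible.Q_le_two_mul_S_sub
    ⟨InversePowerNLS.subcritical_of_lt hd hα0 hα', hσ0, hσ, hω⟩ hα4 hφ hφ2 hv hvφ hK hQ
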